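/- Let $M$ be a compact $3$-dimensional $C^\infty$ Riemannian manifold without boundary, let $0<\beta<1$, let $X$ be a $C^{1+\beta}$ vector field on $M$ with $X_p\neq 0$ for all $p$, let $\varphi=(\varphi^t)_{t\in\mathbb R}$ be the flow generated by $X$, and let $\mu$ be a $\varphi$-invariant Borel probability measure on $M$. **Definitions.** A *Poincaré section* is a Borel set $\Lambda\subset M$ such that for every $p\in M$ the set $\{t>0:\varphi^t(p)\in\Lambda\}$ is a sequence tending to $+\infty$ and $\{t<0:\varphi^t(p)\in\Lambda\}$ is a sequence tending to $-\infty$. Its *roof function* is $R_\Lambda(p)=\min\{t>0:\varphi^t(p)\in\Lambda\}$ and its *Poincaré map* is $f_\Lambda(p)=\varphi^{R_\Lambda(p)}(p)$ $(p\in\Lambda)$; $f_\Lambda:\Lambda\to\Lambda$ is invertible. The *canonical transverse disc* with center $p$ and radius $r$ is $S_r(p)=\{\exp_p(v):v\in T_pM,\ v\perp X_p,\ \|v\|_p\le r\}$, and $\partial S_r(p)=\{\exp_p(v): v\perp X_p,\ \|v\|_p=r\}$. Let $\mathfrak r>0$. A *standard Poincaré section* (with size bound $\mathfrak r$) is a Poincaré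 section of the form $\Lambda=\Lambda(p_1,\dots,p_N;r)=S_r(p_1)\cup\dots\cup S_r(p_N)$, where $0<r<\mathfrak r$, $\sup R_\Lambda<\mathfrak r$, and the $S_r(p_i)$ are pairwise disjoint $C^\infty$ embedded closed discs transverse to $X$. Put $\partial\Lambda=\bigcup_i\partial S_r(p_i)$. The *singular set* $\mathfrak S(\Lambda)$ consists of the $p\in\Lambda$ that do not have a relatively open neighborhood $V\subset\Lambda\setminus\partial\Lambda$ such that $V$ is diffeomorphic to an open disc and $f_\Lambda:V\to f_\Lambda(V)$, $f_\Lambda^{-1}:V\to f_\Lambda^{-1}(V)$ are ($C^1$) diffeomorphisms. The *induced probability measure* is given, with $\epsilon=\frac12\inf R_\Lambda$, by $\mu_\Lambda(A)=\mu\bigl[\bigcup_{0<t<\epsilon}\varphi^t(A)\bigr]\big/\mu\bigl[\bigcup_{0<t<\epsilon}\varphi^t(\Lambda)\bigr]$ for Borel $A\subset\Lambda$. Let $\mathrm{dist}_\Lambda(x,y)$ be the infimum of the lengths of curves in $\Lambda$ from $x$ to $y$ ($\infty$ if there are none). $\Lambda$ is *adapted to $\mu$* if $\mu_\Lambda$ is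 a well-defined probability measure and 1. $\mu_\Lambda(\mathfrak S(\Lambda))=0$; 2. $\lim_{n\to\infty}\frac1n\log\mathrm{dist}_\Lambda(f_\Lambda^{n}(p),\mathfrak S(\Lambda))=0$ for $\mu_\Lambda$-a.e. $p$; 3. $\lim_{n\to\infty}\frac1n\log\mathrm{dist}_\Lambda(f_\Lambda^{-n}(p),\mathfrak S(\Lambda))=0$ for $\mu_\Lambda$-a.e. $p$. **Theorem.** For every $\mathfrak r>0$ and every $h_0>0$ there are $N$, $p_1,\dots,p_N\in M$ and $r>0$ such that $\Lambda(p_1,\dots,p_N;r)$ is a standard Poincaré section (with size bound $\mathfrak r$), $\sup R_\Lambda<h_0$, and $\Lambda(p_1,\dots,p_N;r)$ is adapted to $\mu$. -/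

import Mathlib

open Set Filter Topology MeasureTheory Manifold Bundle
open scoped ENNReal NNReal ContDiff

noncomputable section

/-! ### Riemannian geometry: geodesics and the exponential map -/

section Riemannian

variable {E : Type*} [NormedAddCommGroup E] [NormedSpace ℝ E]
  {H : Type*} [TopologicalSpace H] (I : ModelWithCorners ℝ E H)
  {M : Type*} [TopologicalSpace M] [ChartedSpace H M]
  [RiemannianBundle (fun x : M => TangentSpace I x)]

/-- The Riemannian metric in the coordinates of the chart at `x₀`: the value at the coordinate point
`y`, on the coordinate vectors `v` and `w`. -/
def chartMetric (x₀ : M) (y v w : E) : ℝ :=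
  inner ℝ
    (mfderiv 𝓘(ℝ, E) I (extChartAt I x₀).symm y v :
      TangentSpace I ((extChartAt I x₀).symm y))
    (mfderiv 𝓘(ℝ, E) I (extChartAt I x₀).symm y w :
      TangentSpace I ((extChartAt I x₀).symm y))

/-- `γ : ℝ → M` is a geodesic: it is `C²`, and in each chart its coordinate expression `c` solves the
geodesic equation `c'' + Γ(c', c') = 0`, where `Γ` is the Christoffel symbol of the metric `g`.
Since `g(Γ(v, v), z) = D_v g (v, z) - (1/2) D_z g (v, v)`, the equation says that for all `z`
`g_c(c'', z) + (D_{c'} g)_c (c', z) = (1/2) (D_z g)_c (c', c')`. -/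
structure IsGeodesic (γ : ℝ → M) : Prop where
  contMDiff : ContMDiff 𝓘(ℝ, ℝ) I 2 γ
  equation : ∀ (x₀ : M) (t : ℝ), γ t ∈ (chartAt H x₀).source →
    let c : ℝ → E := fun s => extChartAt I x₀ (γ s)
    ∀ z : E,
      chartMetric I x₀ (c t) (deriv (deriv c) t) z
        + fderiv ℝ (fun y => chartMetric I x₀ y (deriv c t) z) (c t) (deriv c t)
      = (1 / 2) * fderiv ℝ (fun y => chartMetric I x₀ y (deriv c t) (deriv c t)) (c t) z

open Classical in
/-- The Riemannian exponential map `exp_p(v) = γ(1)`, where `γ` is the geodesic with `γ(0) = p` and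
`γ'(0) = v` (on a compact manifold it exists for all `p` and `v`). -/
def expMap (p : M) (v : E) : M :=
  if h : ∃ γ : ℝ → M, IsGeodesic I γ ∧
      tangentMap 𝓘(ℝ, ℝ) I γ (⟨0, (1 : ℝ)⟩ : TangentBundle 𝓘(ℝ, ℝ) ℝ)
        = (⟨p, v⟩ : TangentBundle I M)
  then h.choose 1 else p

/-- The canonical transverse disc `S_r(p) = {exp_p(v) : v ∈ T_p M, v ⟂ X_p, ‖v‖_p ≤ r}`. -/
def transverseDisc (X : (x : M) → TangentSpace I x) (p : M) (r : ℝ) : Set M :=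
  {q | ∃ v : TangentSpace I p, inner ℝ v (X p) = 0 ∧ ‖v‖ ≤ r ∧ expMap I p v = q}

/-- The boundary `∂S_r(p) = {exp_p(v) : v ∈ T_p M, v ⟂ X_p, ‖v‖_p = r}`. -/
def transverseDiscBoundary (X : (x : M) → TangentSpace I x) (p : M) (r : ℝ) : Set M :=
  {q | ∃ v : TangentSpace I p, inner ℝ v (X p) = 0 ∧ ‖v‖ = r ∧ expMap I p v = q}

/-- `S_r(p)` is a `C^∞` embedded closed disc transverse to `X`: on the closed disc
`{v ⟂ X_p, ‖v‖ ≤ r}` the map `exp_p` is smooth and injective, its differential along the disc is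
injective, and `X` is not tangent to the image. -/
structure IsEmbeddedTransverseDisc (X : (x : M) → TangentSpace I x) (p : M) (r : ℝ) : Prop where
  smooth : ∀ v : TangentSpace I p, inner ℝ v (X p) = 0 → ‖v‖ ≤ r →
    ContMDiffAt 𝓘(ℝ, E) I ∞ (expMap I p) (v : E)
  injective : ∀ v w : TangentSpace I p, inner ℝ v (X p) = 0 → ‖v‖ ≤ r →
    inner ℝ w (X p) = 0 → ‖w‖ ≤ r → expMap I p v = expMap I p w → v = w
  immersion : ∀ v w : TangentSpace I p, inner ℝ v (X p) = 0 → ‖v‖ ≤ r →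
    inner ℝ w (X p) = 0 → mfderiv 𝓘(ℝ, E) I (expMap I p) (v : E) w = 0 → w = 0
  transverse : ∀ v w : TangentSpace I p, inner ℝ v (X p) = 0 → ‖v‖ ≤ r →
    inner ℝ w (X p) = 0 →
      mfderiv 𝓘(ℝ, E) I (expMap I p) (v : E) w ≠ X (expMap I p v)

/-- A vector field of class `C^{1+β}`: in every chart its coordinate expression is `C¹` and has a
locally `β`-Hölder continuous derivative. -/
def IsC1HolderVectorField (β : ℝ≥0) (X : (x : M) → TangentSpace I x) : Prop :=
  ∀ x₀ : M,
    let Y : E → E := fun y =>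
      mfderiv I 𝓘(ℝ, E) (extChartAt I x₀) ((extChartAt I x₀).symm y)
        (X ((extChartAt I x₀).symm y))
    ContDiffOn ℝ 1 Y (extChartAt I x₀).target ∧
      ∀ y ∈ (extChartAt I x₀).target, ∃ U ∈ 𝓝 y, ∃ C : ℝ≥0, HolderOnWith C β (fderiv ℝ Y) U

end Riemannian

/-- `f` restricts to a `C¹` diffeomorphism from the subset `A` of a manifold onto the subset `f(A)`
of another manifold. -/
def IsC1DiffeoOn {E : Type*} [NormedAddCommGroup E] [NormedSpace ℝ E]
    {H : Type*} [TopologicalSpace H] (I : ModelWithCorners ℝ E H)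
    {E' : Type*} [NormedAddCommGroup E'] [NormedSpace ℝ E']
    {H' : Type*} [TopologicalSpace H'] (J : ModelWithCorners ℝ E' H')
    {M : Type*} [TopologicalSpace M] [ChartedSpace H M]
    {M' : Type*} [TopologicalSpace M'] [ChartedSpace H' M']
    (f : M → M') (A : Set M) : Prop :=
  ContMDiffOn I J 1 f A ∧
    ∃ g : M' → M, ContMDiffOn J I 1 g (f '' A) ∧ ∀ x ∈ A, g (f x) = x

/-! ### The intrinsic distance of a subset -/

section Intrinsic

variable {M : Type*} [EMetricSpace M]

/-- `dist_Y(x, y)`: the infimum of the lengths of the curves inside `Y` from `x` to `y` (`∞` if there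
are none). -/
def intrinsicEDist (Y : Set M) (x y : M) : ℝ≥0∞ :=
  ⨅ (γ : Path x y) (_ : ∀ t, γ t ∈ Y), eVariationOn (γ : unitInterval → M) univ

/-- `dist_Y(x, S)`, the infimum of `dist_Y(x, s)` over `s ∈ S`. -/
def intrinsicInfEDist (Y : Set M) (x : M) (S : Set M) : ℝ≥0∞ :=
  ⨅ s ∈ S, intrinsicEDist Y x s

end Intrinsic

/-! ### Poincaré sections -/

section Section

variable {M : Type*} [TopologicalSpace M]

/-- `Λ` is a Poincaré section of the flow `φ`: a Borel set such that for every `p` the positive times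
`t` with `φᵗ(p) ∈ Λ` form a sequence tending to `+∞`, and the negative ones a sequence tending to
`-∞`. -/
structure IsPoincareSection [MeasurableSpace M] (φ : Flow ℝ M) (Λ : Set M) : Prop where
  measurableSet : MeasurableSet Λ
  forward : ∀ p : M, ∃ τ : ℕ → ℝ, StrictMono τ ∧ Tendsto τ atTop atTop ∧
    range τ = {t : ℝ | 0 < t ∧ φ t p ∈ Λ}
  backward : ∀ p : M, ∃ τ : ℕ → ℝ, StrictAnti τ ∧ Tendsto τ atTop atBot ∧
    range τ = {t : ℝ | t < 0 ∧ φ t p ∈ Λ}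

/-- The roof function `R_Λ(p) = min {t > 0 : φᵗ(p) ∈ Λ}` (as a total function on `M`). -/
def roofFunction (φ : Flow ℝ M) (Λ : Set M) (p : M) : ℝ :=
  sInf {t : ℝ | 0 < t ∧ φ t p ∈ Λ}

/-- The Poincaré map `f_Λ(p) = φ^{R_Λ(p)}(p)` (as a total function on `M`, where it is the first hit of
`Λ` at a positive time). -/
def poincareMap (φ : Flow ℝ M) (Λ : Set M) (p : M) : M :=
  φ (roofFunction φ Λ p) p

/-- The inverse `f_Λ⁻¹` of the Poincaré map: the last hit of `Λ` at a negative time, that is, the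
Poincaré map of the reversed flow `t ↦ φ⁻ᵗ` (see `poincareMapInv_apply_poincareMap`). -/
def poincareMapInv (φ : Flow ℝ M) (Λ : Set M) : M → M :=
  poincareMap φ.reverse Λ

/-- `sup R_Λ < c`. -/
def RoofSupLT (φ : Flow ℝ M) (Λ : Set M) (c : ℝ) : Prop :=
  ∃ c' < c, ∀ x ∈ Λ, roofFunction φ Λ x ≤ c'

/-- `⋃_{0 < t < ε} φᵗ(A)`. -/
def flowTube (φ : Flow ℝ M) (ε : ℝ) (A : Set M) : Set M :=
  ⋃ t ∈ Ioo 0 ε, φ t '' A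

/-- The probability measure `μ_Λ` induced by the flow invariant probability measure `μ` on the uniform
section `Λ`, regarded as a measure on `M` that is carried by `Λ`. For `ε = (inf R_Λ) / 2` it is the
image of the normalized restriction of `μ` to `⋃_{0 < t < ε} φᵗ(Λ)` under the projection
`φᵗ(q) ↦ q` (`q ∈ Λ`, `0 < t < ε`) along the flow, which means that
`μ_Λ(A) = μ(⋃_{0 < t < ε} φᵗ(A)) / μ(⋃_{0 < t < ε} φᵗ(Λ))`, see `inducedMeasure_apply`. -/
def inducedMeasure [MeasurableSpace M] (φ : Flow ℝ M) (μ : Measure M) (Λ : Set M) : Measure M :=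
  (ProbabilityTheory.cond μ (flowTube φ (sInf (roofFunction φ Λ '' Λ) / 2) Λ)).map
    (poincareMapInv φ Λ)

theorem poincareMapInv_flow [MeasurableSpace M] {φ : Flow ℝ M} {Λ : Set M} {q : M} (hq : q ∈ Λ)
    {t : ℝ} (ht : 0 < t) (htR : t ≤ roofFunction φ Λ q) : poincareMapInv φ Λ (φ t q) = q := by
  have hmem : t ∈ {s : ℝ | 0 < s ∧ φ.reverse s (φ t q) ∈ Λ} := by
    refine ⟨ht, ?_⟩
    rw [Flow.reverse_apply, ← Flow.map_add]
    simpa using hq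
  have hlb : ∀ s ∈ {s : ℝ | 0 < s ∧ φ.reverse s (φ t q) ∈ Λ}, t ≤ s := by
    rintro s ⟨hs, hs'⟩
    by_contra! hlt
    rw [Flow.reverse_apply, ← Flow.map_add] at hs'
    have : roofFunction φ Λ q ≤ -s + t :=
      csInf_le ⟨0, fun u hu => hu.1.le⟩ ⟨by linarith, hs'⟩
    linarith
  have hR : roofFunction φ.reverse Λ (φ t q) = t :=
    (IsLeast.csInf_eq ⟨hmem, hlb⟩)
  unfold poincareMapInv poincareMap
  rw [hR, Flow.reverse_apply, ← Flow.map_add]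
  simp

theorem poincareMapInv_apply_poincareMap [MeasurableSpace M] {φ : Flow ℝ M} {Λ : Set M}
    (hΛ : IsPoincareSection φ Λ) {q : M} (hq : q ∈ Λ) :
    poincareMapInv φ Λ (poincareMap φ Λ q) = q := by
  obtain ⟨τ, hτ, -, hr⟩ := hΛ.forward q
  have h0 : τ 0 ∈ {t : ℝ | 0 < t ∧ φ t q ∈ Λ} := hr ▸ mem_range_self 0
  have hR : roofFunction φ Λ q = τ 0 := by
    refine IsLeast.csInf_eq ⟨h0, ?_⟩
    rw [← hr]
    rintro _ ⟨n, rfl⟩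
    exact hτ.monotone (Nat.zero_le n)
  exact poincareMapInv_flow hq (hR ▸ h0.1) le_rfl

theorem inducedMeasure_apply [MeasurableSpace M] {φ : Flow ℝ M} {μ : Measure M} {Λ : Set M}
    {ε : ℝ} (hε : ε = sInf (roofFunction φ Λ '' Λ) / 2) (hR : 0 < sInf (roofFunction φ Λ '' Λ))
    (hT : MeasurableSet (flowTube φ ε Λ))
    (hf : AEMeasurable (poincareMapInv φ Λ) (ProbabilityTheory.cond μ (flowTube φ ε Λ)))
    {A : Set M} (hA : MeasurableSet A) (hAΛ : A ⊆ Λ) :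
    inducedMeasure φ μ Λ A = μ (flowTube φ ε A) / μ (flowTube φ ε Λ) := by
  have hle : ∀ q ∈ Λ, ∀ t < ε, t ≤ roofFunction φ Λ q := by
    intro q hq t ht
    have hb : BddBelow (roofFunction φ Λ '' Λ) := by
      refine ⟨0, ?_⟩
      rintro _ ⟨x, -, rfl⟩
      exact Real.sInf_nonneg (fun u hu => hu.1.le)
    have := csInf_le hb (mem_image_of_mem _ hq)
    linarith
  have hset : flowTube φ ε Λ ∩ poincareMapInv φ Λ ⁻¹' A = flowTube φ ε A := by
    ext y
    simp only [flowTube, mem_inter_iff, mem_iUnion, mem_image, mem_preimage, exists_prop]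
    constructor
    · rintro ⟨⟨t, ht, q, hq, rfl⟩, hy⟩
      rw [poincareMapInv_flow hq ht.1 (hle q hq t ht.2)] at hy
      exact ⟨t, ht, q, hy, rfl⟩
    · rintro ⟨t, ht, q, hq, rfl⟩
      refine ⟨⟨t, ht, q, hAΛ hq, rfl⟩, ?_⟩
      rwa [poincareMapInv_flow (hAΛ hq) ht.1 (hle q (hAΛ hq) t ht.2)]
  subst hε
  rw [inducedMeasure, Measure.map_apply_of_aemeasurable hf hA, ProbabilityTheory.cond_apply hT,
    hset, ENNReal.div_eq_inv_mul]

end Section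

/-! ### Standard and adapted Poincaré sections -/

section Standard

variable {E : Type*} [NormedAddCommGroup E] [NormedSpace ℝ E]
  {H : Type*} [TopologicalSpace H] (I : ModelWithCorners ℝ E H)
  {M : Type*} [EMetricSpace M] [ChartedSpace H M]

/-- The singular set of a section `Λ` with boundary `∂Λ = B`: the points of `Λ` that have no relatively
open neighbourhood `V ⊆ Λ ∖ B` which is diffeomorphic to an open disc and on which `f_Λ` and `f_Λ⁻¹`
are diffeomorphisms onto their images. -/
def singularSet (φ : Flow ℝ M) (Λ B : Set M) : Set M :=
  {p ∈ Λ | ¬ ∃ V : Set M, p ∈ V ∧ (∃ U : Set M, IsOpen U ∧ V = U ∩ Λ) ∧ V ⊆ Λ \ B ∧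
    (∃ ψ : EuclideanSpace ℝ (Fin 2) → M,
      IsC1DiffeoOn (𝓡 2) I ψ (Metric.ball 0 1) ∧ ψ '' Metric.ball 0 1 = V) ∧
    IsC1DiffeoOn I I (poincareMap φ Λ) V ∧ IsC1DiffeoOn I I (poincareMapInv φ Λ) V}

/-- `Λ`, with boundary `B`, is adapted to `μ`: the induced measure gives no mass to the singular set
`𝔖`, and `(1/n) log dist_Λ(f_Λⁿ(p), 𝔖) → 0` and `(1/n) log dist_Λ(f_Λ⁻ⁿ(p), 𝔖) → 0` for almost every
`p` with respect to the induced (probability) measure. The logarithm takes values in `[-∞, ∞]`, with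
`log 0 = -∞` and `log ∞ = ∞`. -/
structure IsAdapted [MeasurableSpace M] (φ : Flow ℝ M) (μ : Measure M) (Λ B : Set M) : Prop where
  isProbabilityMeasure : IsProbabilityMeasure (inducedMeasure φ μ Λ)
  measure_singularSet : inducedMeasure φ μ Λ (singularSet I φ Λ B) = 0
  tendsto_forward : ∀ᵐ p ∂(inducedMeasure φ μ Λ),
    Tendsto (fun n : ℕ =>
      ENNReal.log (intrinsicInfEDist Λ ((poincareMap φ Λ)^[n] p) (singularSet I φ Λ B))
        / (n : EReal)) atTop (𝓝 0)
  tendsto_backward : ∀ᵐ p ∂(inducedMeasure φ μ Λ),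
    Tendsto (fun n : ℕ =>
      ENNReal.log (intrinsicInfEDist Λ ((poincareMapInv φ Λ)^[n] p) (singularSet I φ Λ B))
        / (n : EReal)) atTop (𝓝 0)

variable [RiemannianBundle (fun x : M => TangentSpace I x)]

/-- `Λ(p₁, …, p_N; r) = ⋃ᵢ S_r(pᵢ)`. -/
def discUnion (X : (x : M) → TangentSpace I x) {N : ℕ} (p : Fin N → M) (r : ℝ) : Set M :=
  ⋃ i, transverseDisc I X (p i) r

/-- `∂Λ(p₁, …, p_N; r) = ⋃ᵢ ∂S_r(pᵢ)`. -/
def discUnionBoundary (X : (x : M) → TangentSpace I x) {N : ℕ} (p : Fin N → M) (r : ℝ) : Set M :=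
  ⋃ i, transverseDiscBoundary I X (p i) r

/-- `Λ(p₁, …, p_N; r)` is a standard Poincaré section, where `𝔯 > 0` is the constant that bounds the
size of standard sections: a Poincaré section which is the disjoint union of the canonical transverse
discs `S_r(pᵢ)`, with `r < 𝔯` and `sup R_Λ < 𝔯`. (For a small constant `𝔯` depending on the manifold
and the flow the discs are automatically embedded and transverse to the flow; this is made part of the
definition, so that it makes sense for every `𝔯`.) -/
structure IsStandardPoincareSection [MeasurableSpace M] (φ : Flow ℝ M)
    (X : (x : M) → TangentSpace I x) (𝔯 : ℝ) {N : ℕ} (p : Fin N → M) (r : ℝ) : Prop where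
  radius_pos : 0 < r
  radius_lt : r < 𝔯
  embedded : ∀ i, IsEmbeddedTransverseDisc I X (p i) r
  pairwise_disjoint : Pairwise fun i j =>
    Disjoint (transverseDisc I X (p i) r) (transverseDisc I X (p j) r)
  isPoincareSection : IsPoincareSection φ (discUnion I X p r)
  roof_lt : RoofSupLT φ (discUnion I X p r) 𝔯

end Standard

end

noncomputable section

/-! ### Superposition operators on spaces of continuous curves -/

section Nemytskii

set_option linter.unusedSectionVars false
set_option synthInstance.maxHeartbeats 200000

universe u

variable {K : Type*} [TopologicalSpace K] [CompactSpace K]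
  {F G : Type u} [NormedAddCommGroup F] [NormedSpace ℝ F] [NormedAddCommGroup G] [NormedSpace ℝ G]

open Classical in
/-- The superposition operator `c ↦ f ∘ c` on continuous maps (zero if `f ∘ c` is discontinuous). -/
def superposition (f : F → G) (c : C(K, F)) : C(K, G) :=
  if h : Continuous (fun s => f (c s)) then ⟨fun s => f (c s), h⟩ else 0

theorem superposition_apply {f : F → G} {Ω : Set F} (hf : ContinuousOn f Ω) {c : C(K, F)}
    (hc : ∀ s, c s ∈ Ω) (s : K) : superposition f c s = f (c s) := by
  have h : Continuous (fun s => f (c s)) := hf.comp_continuous c.continuous hc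
  simp [superposition, h]

theorem isOpen_forall_mem {Ω : Set F} (hΩ : IsOpen Ω) : IsOpen {c : C(K, F) | ∀ s, c s ∈ Ω} := by
  have := ContinuousMap.isOpen_setOfPred_mapsTo (X := K) (Y := F) isCompact_univ hΩ
  simpa [MapsTo] using this

theorem continuousOn_superposition {f : F → G} {Ω : Set F} (hf : ContinuousOn f Ω) :
    ContinuousOn (superposition f) {c : C(K, F) | ∀ s, c s ∈ Ω} := by
  rw [continuousOn_iff_continuous_domRestrict]
  refine ContinuousMap.continuous_of_continuous_uncurry _ ?_
  have h : Continuous (fun p : {c : C(K, F) | ∀ s, c s ∈ Ω} × K => f (p.1.1 p.2)) := by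
    refine hf.comp_continuous ?_ (fun p => p.1.2 p.2)
    exact (continuous_subtype_val.comp continuous_fst).eval continuous_snd
  refine h.congr fun p => ?_
  exact (superposition_apply hf p.1.2 p.2).symm

/-- Pointwise application of a continuous family of operators to a continuous curve, as a bilinear
map. -/
def pointwiseApplyBilin : C(K, F →L[ℝ] G) →ₗ[ℝ] C(K, F) →ₗ[ℝ] C(K, G) :=
  LinearMap.mk₂ ℝ
    (fun (A : C(K, F →L[ℝ] G)) (h : C(K, F)) =>
      (⟨fun s => A s (h s), A.continuous.clm_apply h.continuous⟩ : C(K, G)))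
    (fun _ _ _ => ContinuousMap.ext fun _ => rfl)
    (fun _ _ _ => ContinuousMap.ext fun _ => rfl)
    (fun A h k => ContinuousMap.ext fun s => (A s).map_add (h s) (k s))
    (fun a A h => ContinuousMap.ext fun s => (A s).map_smul a (h s))

theorem norm_pointwiseApplyBilin_le (A : C(K, F →L[ℝ] G)) (h : C(K, F)) :
    ‖pointwiseApplyBilin A h‖ ≤ 1 * ‖A‖ * ‖h‖ := by
  rw [one_mul, ContinuousMap.norm_le _ (mul_nonneg (norm_nonneg A) (norm_nonneg h))]
  intro s
  exact ((A s).le_opNorm_of_le (h.norm_coe_le_norm s)).trans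
    (mul_le_mul_of_nonneg_right (A.norm_coe_le_norm s) (norm_nonneg _))

/-- Pointwise application of a continuous family of operators to a continuous curve. -/
def pointwiseApply : C(K, F →L[ℝ] G) →L[ℝ] C(K, F) →L[ℝ] C(K, G) :=
  LinearMap.mkContinuous₂ (E := C(K, F →L[ℝ] G)) (F := C(K, F)) (G := C(K, G))
    (σ₁₃ := RingHom.id ℝ) (σ₂₃ := RingHom.id ℝ)
    (pointwiseApplyBilin (K := K) (F := F) (G := G)) 1 norm_pointwiseApplyBilin_le

@[simp]
theorem pointwiseApply_apply (A : C(K, F →L[ℝ] G)) (h : C(K, F)) (s : K) :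
    pointwiseApply A h s = A s (h s) := rfl

theorem hasFDerivAt_superposition {f : F → G} {Ω : Set F} (hΩ : IsOpen Ω)
    (hf : ContDiffOn ℝ 1 f Ω) {c : C(K, F)} (hc : ∀ s, c s ∈ Ω) :
    HasFDerivAt (superposition f) (pointwiseApply (superposition (fderiv ℝ f) c)) c := by
  have hf' : ContinuousOn (fderiv ℝ f) Ω := hf.continuousOn_fderiv_of_isOpen hΩ le_rfl
  have hd : ∀ x ∈ Ω, HasFDerivAt f (fderiv ℝ f x) x := fun x hx =>
    ((hf.differentiableOn one_ne_zero).differentiableAt (hΩ.mem_nhds hx)).hasFDerivAt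
  rw [hasFDerivAt_iff_isLittleO_nhds_zero, Asymptotics.isLittleO_iff]
  intro ε hε
  have hcont := (continuousOn_superposition (K := K) hf').continuousAt
    ((isOpen_forall_mem hΩ).mem_nhds hc)
  obtain ⟨δ, hδ, hδs⟩ := Metric.mem_nhds_iff.1 (inter_mem
    (hcont (Metric.ball_mem_nhds _ hε)) ((isOpen_forall_mem hΩ).mem_nhds hc))
  filter_upwards [Metric.ball_mem_nhds (0 : C(K, F)) hδ] with h hh
  rw [ContinuousMap.norm_le _ (by positivity)]
  intro s
  have hseg : ∀ x ∈ segment ℝ (c s) (c s + h s), x ∈ Ω ∧ ‖fderiv ℝ f x - fderiv ℝ f (c s)‖ ≤ ε := by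
    intro x hx
    rw [segment_eq_image'] at hx
    obtain ⟨θ, hθ, rfl⟩ := hx
    have hmem : c + θ • h ∈ Metric.ball c δ := by
      rw [mem_ball_iff_norm, add_sub_cancel_left, norm_smul, Real.norm_of_nonneg hθ.1]
      rw [mem_ball_zero_iff] at hh
      nlinarith [norm_nonneg h, hθ.2]
    obtain ⟨h1, h2⟩ := hδs hmem
    have h2' : (c + θ • h) s ∈ Ω := h2 s
    simp only [mem_preimage, mem_ball_iff_norm] at h1
    have h3 := (ContinuousMap.norm_coe_le_norm _ s).trans h1.le
    rw [ContinuousMap.sub_apply, superposition_apply hf' h2, superposition_apply hf' hc] at h3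
    simp only [add_sub_cancel_left]
    exact ⟨h2', h3⟩
  have hch : ∀ t, (c + h) t ∈ Ω := (hδs (by simpa [mem_ball_iff_norm] using hh)).2
  have := (convex_segment (𝕜 := ℝ) (c s) (c s + h s)).norm_image_sub_le_of_norm_hasFDerivWithin_le'
    (fun x hx => (hd x (hseg x hx).1).hasFDerivWithinAt) (fun x hx => (hseg x hx).2)
    (left_mem_segment ℝ _ _) (right_mem_segment ℝ _ _)
  simp only [ContinuousMap.sub_apply, superposition_apply hf.continuousOn hch,
    superposition_apply hf.continuousOn hc, pointwiseApply_apply, superposition_apply hf' hc,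
    ContinuousMap.add_apply]
  rw [add_sub_cancel_left] at this
  exact this.trans (mul_le_mul_of_nonneg_left (h.norm_coe_le_norm s) hε.le)

theorem contDiffOn_superposition_nat {K : Type*} [TopologicalSpace K] [CompactSpace K]
    {F : Type u} [NormedAddCommGroup F] [NormedSpace ℝ F] {Ω : Set F} (hΩ : IsOpen Ω) (n : ℕ) :
    ∀ {G : Type u} [NormedAddCommGroup G] [NormedSpace ℝ G] {f : F → G}, ContDiffOn ℝ n f Ω →
    ContDiffOn ℝ n (superposition f) {c : C(K, F) | ∀ s, c s ∈ Ω} := by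
  induction n with
  | zero =>
    intro G _ _ f hf
    simp only [Nat.cast_zero, contDiffOn_zero] at hf ⊢
    exact continuousOn_superposition hf
  | succ n ih =>
    intro G _ _ f hf
    have h1 : ContDiffOn ℝ 1 f Ω := hf.of_le (by exact_mod_cast Nat.le_add_left 1 n)
    have hO := isOpen_forall_mem (K := K) hΩ
    push_cast at hf ⊢
    rw [contDiffOn_succ_iff_fderiv_of_isOpen hΩ] at hf
    rw [contDiffOn_succ_iff_fderiv_of_isOpen hO]
    refine ⟨fun c hc => (hasFDerivAt_superposition hΩ h1 hc).differentiableAt.differentiableWithinAt,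
      by simp, ?_⟩
    have := (pointwiseApply (K := K) (F := F) (G := G)).contDiff.comp_contDiffOn (ih hf.2.2)
    exact this.congr fun c hc => (hasFDerivAt_superposition hΩ h1 hc).fderiv

theorem contDiffOn_superposition {Ω : Set F} (hΩ : IsOpen Ω) {n : ℕ∞} {f : F → G}
    (hf : ContDiffOn ℝ n f Ω) :
    ContDiffOn ℝ n (superposition f) {c : C(K, F) | ∀ s, c s ∈ Ω} := by
  rw [contDiffOn_iff_forall_nat_le]
  intro m hm
  exact contDiffOn_superposition_nat hΩ m (hf.of_le (by exact_mod_cast hm))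

end Nemytskii

/-! ### Local flows by the implicit function theorem -/

section LocalFlow

set_option linter.unusedSectionVars false

universe u

variable {F : Type u} [NormedAddCommGroup F] [NormedSpace ℝ F] [CompleteSpace F]

/-- The integration operator `c ↦ (s ↦ ∫₀ˢ c)` on curves parametrized by `[-1, 1]`. -/
def integrationOp : C(Icc (-1 : ℝ) 1, F) →L[ℝ] C(Icc (-1 : ℝ) 1, F) :=
  LinearMap.mkContinuous
    { toFun := fun c => ⟨fun s => ∫ t in (0 : ℝ)..s, IccExtend (by norm_num : (-1 : ℝ) ≤ 1) c t, by
        have h : Continuous (IccExtend (by norm_num : (-1 : ℝ) ≤ 1) c) := c.continuous.Icc_extend'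
        exact (intervalIntegral.continuous_primitive (fun a b => h.intervalIntegrable a b) 0).comp
          continuous_subtype_val⟩
      map_add' := fun c d => by
        ext s
        have h : Continuous (IccExtend (by norm_num : (-1 : ℝ) ≤ 1) c) := c.continuous.Icc_extend'
        have h' : Continuous (IccExtend (by norm_num : (-1 : ℝ) ≤ 1) d) := d.continuous.Icc_extend'
        exact intervalIntegral.integral_add (h.intervalIntegrable _ _) (h'.intervalIntegrable _ _)
      map_smul' := fun a c => by
        ext s
        exact intervalIntegral.integral_smul a _ } 1 (by
    intro c
    rw [one_mul, ContinuousMap.norm_le _ (by positivity)]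
    intro s
    refine (intervalIntegral.norm_integral_le_of_norm_le_const
      (fun t _ => c.norm_coe_le_norm _)).trans ?_
    have : |(s : ℝ) - 0| ≤ 1 := by rw [sub_zero, abs_le]; exact s.2
    nlinarith [norm_nonneg c])

theorem integrationOp_apply (c : C(Icc (-1 : ℝ) 1, F)) (s : Icc (-1 : ℝ) 1) :
    integrationOp c s = ∫ t in (0 : ℝ)..s, IccExtend (by norm_num : (-1 : ℝ) ≤ 1) c t := rfl

/-- The constant curves, as a continuous linear map. -/
def constCurve : F →L[ℝ] C(Icc (-1 : ℝ) 1, F) :=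
  LinearMap.mkContinuous
    { toFun := fun y => ContinuousMap.const _ y
      map_add' := fun _ _ => rfl
      map_smul' := fun _ _ => rfl } 1 (by
    intro y
    rw [one_mul, ContinuousMap.norm_le _ (norm_nonneg _)]
    exact fun _ => le_rfl)

@[simp]
theorem constCurve_apply (y : F) (s : Icc (-1 : ℝ) 1) : constCurve y s = y := rfl

/-- `c` solves `c' = τ f(c)`, `c 0 = y` in integrated form. -/
def IsIntegralSolution (f : F → F) (τ : ℝ) (y : F) (c : C(Icc (-1 : ℝ) 1, F)) : Prop :=
  c - constCurve y - τ • integrationOp (superposition f c) = 0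

/-- The implicit function theorem at a constant curve: for small `τ` and initial value `y` near `y₀`
the equation `c' = τ f(c)` has a unique solution near the constant curve, as smooth as `f`. -/
theorem exists_localFlow {n : ℕ∞} (hn : 1 ≤ n) {f : F → F} {Ω : Set F} (hΩ : IsOpen Ω)
    (hf : ContDiffOn ℝ n f Ω) {y₀ : F} (hy₀ : y₀ ∈ Ω) :
    ∃ (O : Set (ℝ × F)) (c : ℝ × F → C(Icc (-1 : ℝ) 1, F)) (δ : ℝ), IsOpen O ∧ (0, y₀) ∈ O ∧ 0 < δ ∧
      ContDiffOn ℝ n c O ∧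
      (∀ z ∈ O, (∀ s, c z s ∈ Ω ∧ dist (c z s) y₀ < δ) ∧ IsIntegralSolution f z.1 z.2 (c z)) ∧
      (∀ z ∈ O, ∀ d : C(Icc (-1 : ℝ) 1, F), (∀ s, dist (d s) y₀ < δ) →
        IsIntegralSolution f z.1 z.2 d → d = c z) := by
  have hn0 : (n : WithTop ℕ∞) ≠ 0 := by
    rintro h
    rw [show n = 0 by exact_mod_cast h] at hn
    simp at hn
  set X := C(Icc (-1 : ℝ) 1, F)
  let Φ : (ℝ × F) × X → X := fun u =>
    u.2 - constCurve u.1.2 - u.1.1 • integrationOp (superposition f u.2)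
  let S : Set ((ℝ × F) × X) := {u | ∀ s, u.2 s ∈ Ω}
  have hS : IsOpen S := (isOpen_forall_mem hΩ).preimage continuous_snd
  have hΦ : ContDiffOn ℝ n Φ S := by
    have h1 : ContDiffOn ℝ n (fun u : (ℝ × F) × X => superposition f u.2) S :=
      (contDiffOn_superposition hΩ hf).comp contDiffOn_snd (fun u hu => hu)
    have h2 : ContDiffOn ℝ n (fun u : (ℝ × F) × X => integrationOp (superposition f u.2)) S :=
      (integrationOp (F := F)).contDiff.comp_contDiffOn h1
    have h3 : ContDiffOn ℝ n (fun u : (ℝ × F) × X => u.1.1) S :=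
      (contDiff_fst.comp contDiff_fst).contDiffOn
    have h4 : ContDiffOn ℝ n (fun u : (ℝ × F) × X => constCurve u.1.2) S :=
      ((constCurve (F := F)).contDiff.comp
        (contDiff_snd.comp contDiff_fst)).contDiffOn
    exact (contDiffOn_snd.sub h4).sub (h3.smul h2)
  have hΦat : ∀ u ∈ S, ContDiffAt ℝ n Φ u := fun u hu => hΦ.contDiffAt (hS.mem_nhds hu)
  let u₀ : (ℝ × F) × X := ((0, y₀), constCurve y₀)
  have hu₀ : u₀ ∈ S := fun s => hy₀
  have hΦ₀ : Φ u₀ = 0 := by simp [Φ, u₀]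
  have hsol : ∀ u, Φ u = 0 ↔ IsIntegralSolution f u.1.1 u.1.2 u.2 := fun u => Iff.rfl
  have hid : fderiv ℝ Φ u₀ ∘L .inr ℝ (ℝ × F) X = ContinuousLinearMap.id ℝ X := by
    have h1 : HasFDerivAt (fun d : X => Φ ((0, y₀), d)) (fderiv ℝ Φ u₀ ∘L .inr ℝ (ℝ × F) X)
        (constCurve y₀) :=
      HasFDerivAt.comp (g := Φ) (f := fun d : X => (((0 : ℝ), y₀), d)) _
        ((hΦat u₀ hu₀).differentiableAt hn0).hasFDerivAt (hasFDerivAt_prodMk_right _ _)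
    have h2 : (fun d : X => Φ ((0, y₀), d)) = fun d => d - constCurve y₀ := by
      funext d; simp [Φ]
    rw [h2] at h1
    exact h1.unique ((hasFDerivAt_id _).sub_const _)
  have hinv : ∀ᶠ u in 𝓝 u₀, (fderiv ℝ Φ u ∘L .inr ℝ (ℝ × F) X).IsInvertible := by
    have hc : ContinuousAt (fun u => fderiv ℝ Φ u ∘L .inr ℝ (ℝ × F) X) u₀ := by
      have := (hΦ.continuousOn_fderiv_of_isOpen hS (by exact_mod_cast hn)).continuousAt
        (hS.mem_nhds hu₀)
      exact this.clm_comp continuousAt_const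
    have hne : {A : X →L[ℝ] X | IsUnit A} ∈ 𝓝 (fderiv ℝ Φ u₀ ∘L .inr ℝ (ℝ × F) X) := by
      rw [hid]
      exact (Units.isOpen (R := X →L[ℝ] X)).mem_nhds (isUnit_one (M := X →L[ℝ] X))
    filter_upwards [hc hne] with u hu
    obtain ⟨a, ha⟩ := hu
    exact ⟨ContinuousLinearEquiv.unitsEquiv ℝ X a, ha⟩
  let ψ := (hΦat u₀ hu₀).implicitFunction hn0 hinv.self_of_nhds
  have hψ₀ : ψ (0, y₀) = constCurve y₀ :=
    (hΦat u₀ hu₀).implicitFunction_apply_self hn0 hinv.self_of_nhds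
  have hψd : ContDiffAt ℝ n ψ (0, y₀) :=
    (hΦat u₀ hu₀).contDiffAt_implicitFunction hn0 hinv.self_of_nhds
  have hψe : ∀ᶠ z in 𝓝 ((0 : ℝ), y₀), Φ (z, ψ z) = 0 := by
    have := (hΦat u₀ hu₀).eventually_apply_implicitFunction hn0 hinv.self_of_nhds
    rw [hΦ₀] at this
    exact this
  have hψc : ∀ᶠ z in 𝓝 ((0 : ℝ), y₀), ContinuousAt ψ z := by
    have h1 : ContDiffAt ℝ 1 ψ (0, y₀) := hψd.of_le (by exact_mod_cast hn)
    filter_upwards [h1.eventually (by simp)] with z hz using hz.continuousAt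
  have hgr : ContinuousAt (fun z => (z, ψ z)) ((0 : ℝ), y₀) :=
    continuousAt_id.prodMk hψd.continuousAt
  have hgr0 : ((((0 : ℝ), y₀), ψ (0, y₀)) : (ℝ × F) × X) = u₀ := by rw [hψ₀]
  have hSe : ∀ᶠ z in 𝓝 ((0 : ℝ), y₀), (z, ψ z) ∈ S :=
    hgr (by simpa only [hgr0] using hS.mem_nhds hu₀)
  have hinve : ∀ᶠ z in 𝓝 ((0 : ℝ), y₀),
      (fderiv ℝ Φ (z, ψ z) ∘L .inr ℝ (ℝ × F) X).IsInvertible :=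
    hgr.eventually (by simpa only [hgr0] using hinv)
  have hsm : ∀ᶠ z in 𝓝 ((0 : ℝ), y₀), ContDiffAt ℝ n ψ z := by
    filter_upwards [hψe.eventually_nhds, hψc, hSe, hinve] with z hz hzc hzS hzi
    have h1 := (hΦat _ hzS).eventually_apply_eq_iff_implicitFunction hn0 hzi
    have h2 : ContinuousAt (fun x => (x, ψ x)) z := continuousAt_id.prodMk hzc
    have h3 : (hΦat _ hzS).implicitFunction hn0 hzi =ᶠ[𝓝 z] ψ := by
      filter_upwards [h2.eventually h1, hz] with x hx hx'
      exact hx.1 (by rw [hx', hz.self_of_nhds])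
    exact ((hΦat _ hzS).contDiffAt_implicitFunction hn0 hzi).congr_of_eventuallyEq h3.symm
  have huniq := (hΦat u₀ hu₀).eventually_apply_eq_iff_implicitFunction hn0 hinv.self_of_nhds
  rw [hΦ₀, nhds_prod_eq] at huniq
  obtain ⟨pa, hpa, pb, hpb, hab⟩ := eventually_prod_iff.1 huniq
  obtain ⟨δ, hδ, hδs⟩ := Metric.mem_nhds_iff.1 hpb
  have hball : ∀ d : X, (∀ s, dist (d s) y₀ < δ) → pb d := fun d hd => by
    refine hδs (Metric.mem_ball.2 ?_)
    rw [ContinuousMap.dist_lt_iff hδ]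
    exact hd
  have hcl : ∀ᶠ z in 𝓝 ((0 : ℝ), y₀), ψ z ∈ Metric.ball (constCurve y₀ : X) δ :=
    hψd.continuousAt (by rw [hψ₀]; exact Metric.ball_mem_nhds _ hδ)
  obtain ⟨O, hOs, hO, hO0⟩ := mem_nhds_iff.1 (hpa.and (hsm.and (hψe.and (hSe.and hcl))))
  refine ⟨O, ψ, δ, hO, hO0, hδ, fun z hz => (hOs hz).2.1.contDiffWithinAt, fun z hz => ?_,
    fun z hz d hd hd' => ?_⟩
  · obtain ⟨-, -, h1, h2, h3⟩ := hOs hz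
    exact ⟨fun s => ⟨h2 s, (ContinuousMap.dist_lt_iff hδ).1 h3 s⟩, h1⟩
  · exact ((hab (hOs hz).1 (hball d hd)).1 hd').symm

end LocalFlow

/-! ### Charts of a Riemannian manifold are locally bi-Lipschitz -/

section ChartLipschitz

set_option linter.unusedSectionVars false

variable {E : Type*} [NormedAddCommGroup E] [NormedSpace ℝ E]
  {H : Type*} [TopologicalSpace H] {I : ModelWithCorners ℝ E H} [I.Boundaryless]
  {M : Type*} [EMetricSpace M] [ChartedSpace H M] [IsManifold I 1 M]
  [RiemannianBundle (fun x : M => TangentSpace I x)]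
  [IsContinuousRiemannianBundle E (fun x : M => TangentSpace I x)]

section NormBounds

attribute [local instance] normedAddCommGroupTangentSpaceVectorSpace
attribute [local instance] normedSpaceTangentSpaceVectorSpace

variable (I) in
theorem exists_norm_mfderiv_extChartAt_le (x : M) :
    ∃ C : ℝ≥0, ∀ᶠ y in 𝓝 x, ∀ v : TangentSpace I y,
      ‖(mfderiv I 𝓘(ℝ, E) (extChartAt I x) y v : E)‖ ≤ C * ‖v‖ := by
  obtain ⟨C, hC, h⟩ := eventually_norm_mfderiv_extChartAt_lt I x
  refine ⟨⟨C, hC.le⟩, ?_⟩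
  filter_upwards [h] with y hy v
  exact (ContinuousLinearMap.le_opNorm (mfderiv I 𝓘(ℝ, E) (extChartAt I x) y) v).trans
    (mul_le_mul_of_nonneg_right hy.le (norm_nonneg _))

variable (I) in
theorem exists_norm_mfderiv_extChartAt_symm_le (x : M) :
    ∃ C : ℝ≥0, ∀ᶠ y in 𝓝 (extChartAt I x x), ∀ v : E,
      ‖(mfderiv 𝓘(ℝ, E) I (extChartAt I x).symm y v :
        TangentSpace I ((extChartAt I x).symm y))‖ ≤ C * ‖v‖ := by
  obtain ⟨C, hC, h⟩ := eventually_norm_mfderivWithin_symm_extChartAt_lt I x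
  refine ⟨⟨C, hC.le⟩, ?_⟩
  rw [I.range_eq_univ, nhdsWithin_univ] at h
  filter_upwards [h] with y hy v
  rw [mfderivWithin_univ] at hy
  exact (ContinuousLinearMap.le_opNorm (mfderiv 𝓘(ℝ, E) I (extChartAt I x).symm y) v).trans
    (mul_le_mul_of_nonneg_right hy.le (norm_nonneg _))

end NormBounds

variable [IsRiemannianManifold I M]

variable (I) in
/-- A `C¹` curve whose velocity is bounded by `C` is `C`-Lipschitz. -/
theorem edist_le_of_norm_mfderivWithin_le {γ : ℝ → M} {a b : ℝ} (hab : a ≤ b)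
    (hγ : ContMDiffOn 𝓘(ℝ, ℝ) I 1 γ (Icc a b)) {C : ℝ≥0}
    (hC : ∀ t ∈ Ioo a b, ‖(mfderiv 𝓘(ℝ, ℝ) I γ t (1 : ℝ) : TangentSpace I (γ t))‖ ≤ C) :
    edist (γ a) (γ b) ≤ C * ENNReal.ofReal (b - a) := by
  rw [IsRiemannianManifold.out (I := I) (γ a) (γ b)]
  refine (riemannianEDist_le_pathELength hγ rfl rfl hab).trans ?_
  rw [pathELength_eq_lintegral_mfderiv_Ioo]
  calc _ ≤ ∫⁻ t in Ioo a b, (C : ℝ≥0∞) := by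
        refine setLIntegral_mono' measurableSet_Ioo fun t ht => ?_
        have := hC t ht
        rw [← ofReal_norm, ← ENNReal.ofReal_coe_nnreal]
        exact ENNReal.ofReal_le_ofReal this
    _ = _ := by simp

variable (I) in
theorem exists_edist_le_edist_extChartAt (x : M) :
    ∃ C : ℝ≥0, ∃ W ∈ 𝓝 x, ∀ y ∈ W, ∀ z ∈ W,
      edist y z ≤ C * edist (extChartAt I x y) (extChartAt I x z) := by
  obtain ⟨C, hC⟩ := exists_norm_mfderiv_extChartAt_symm_le I x
  obtain ⟨r, hr, hball⟩ := Metric.mem_nhds_iff.1 (inter_mem hC (extChartAt_target_mem_nhds (I := I) x))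
  refine ⟨C, _, inter_mem ((continuousAt_extChartAt (I := I) x).preimage_mem_nhds
    (Metric.ball_mem_nhds _ hr)) (extChartAt_source_mem_nhds (I := I) x), ?_⟩
  rintro y ⟨hy, hys⟩ z ⟨hz, hzs⟩
  set a := extChartAt I x y
  set b := extChartAt I x z
  let η : ℝ → E := fun t => a + t • (b - a)
  have hη : ∀ t ∈ Icc (0 : ℝ) 1, η t ∈ Metric.ball (extChartAt I x x) r := by
    intro t ht
    have : η t ∈ segment ℝ a b := by rw [segment_eq_image']; exact ⟨t, ht, rfl⟩
    exact (convex_ball _ _).segment_subset hy hz this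
  have hηd : ∀ t, HasMFDerivAt 𝓘(ℝ, ℝ) 𝓘(ℝ, E) η t
      ((1 : ℝ →L[ℝ] ℝ).smulRight (b - a)) := by
    intro t
    have : HasDerivAt η (b - a) t := by
      have := ((hasDerivAt_id t).smul_const (b - a)).const_add a
      rwa [one_smul] at this
    exact this.hasFDerivAt.hasMFDerivAt
  have hηs : ContMDiff 𝓘(ℝ, ℝ) 𝓘(ℝ, E) 1 η := by
    rw [contMDiff_iff_contDiff]
    fun_prop
  have hsm : ContMDiffOn 𝓘(ℝ, ℝ) I 1 ((extChartAt I x).symm ∘ η) (Icc 0 1) :=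
    (contMDiffOn_extChartAt_symm (I := I) (n := 1) x).comp hηs.contMDiffOn fun t ht => (hball (hη t ht)).2
  have h0 : ((extChartAt I x).symm ∘ η) 0 = y := by
    simp only [η, Function.comp, zero_smul, add_zero]; exact (extChartAt I x).left_inv hys
  have h1 : ((extChartAt I x).symm ∘ η) 1 = z := by
    simp only [η, Function.comp, one_smul, add_sub_cancel]; exact (extChartAt I x).left_inv hzs
  have key := edist_le_of_norm_mfderivWithin_le I (C := C * ‖b - a‖₊) zero_le_one hsm (by
    intro t ht
    have ht' := hball (hη t (Ioo_subset_Icc_self ht))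
    have hd : MDifferentiableAt 𝓘(ℝ, E) I (extChartAt I x).symm (η t) := by
      have := mdifferentiableWithinAt_extChartAt_symm (I := I) (x := x) ht'.2
      rwa [I.range_eq_univ, mdifferentiableWithinAt_univ] at this
    have hcomp := (hd.hasMFDerivAt.comp t (hηd t)).mfderiv
    rw [hcomp]
    have := ht'.1 (b - a)
    rw [NNReal.coe_mul, coe_nnnorm]
    have he : ((mfderiv 𝓘(ℝ, E) I (extChartAt I x).symm (η t)).comp
        ((1 : ℝ →L[ℝ] ℝ).smulRight (b - a))) (1 : ℝ) =
        mfderiv 𝓘(ℝ, E) I (extChartAt I x).symm (η t) (b - a) :=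
      congrArg (mfderiv 𝓘(ℝ, E) I (extChartAt I x).symm (η t)) (one_smul ℝ (b - a))
    rw [← he] at this
    exact this)
  rw [h0, h1] at key
  refine key.trans ?_
  rw [edist_comm a b, edist_eq_enorm_sub]
  simp [enorm_eq_nnnorm]

variable (I) in
theorem exists_edist_extChartAt_le (x : M) :
    ∃ C : ℝ≥0, ∃ W ∈ 𝓝 x, ∀ y ∈ W, ∀ z ∈ W,
      edist (extChartAt I x y) (extChartAt I x z) ≤ C * edist y z := by
  obtain ⟨C, hC⟩ := exists_norm_mfderiv_extChartAt_le I x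
  obtain ⟨r, hr, hball⟩ := EMetric.mem_nhds_iff.1 (inter_mem hC (chart_source_mem_nhds H x))
  refine ⟨C, _, Metric.eball_mem_nhds x (ENNReal.div_pos hr.ne' (by norm_num) : 0 < r / 3), ?_⟩
  intro y hy z hz
  have hyz : edist y z < r / 3 + r / 3 := by
    refine (edist_triangle_right y z x).trans_lt (ENNReal.add_lt_add hy hz)
  have hstep : ∀ s, edist y z < s → s < r / 3 + r / 3 →
      edist (extChartAt I x y) (extChartAt I x z) ≤ C * s := by
    intro s hs hsr
    rw [IsRiemannianManifold.out (I := I) y z] at hs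
    obtain ⟨γ, rfl, rfl, hγ, hγs⟩ := exists_lt_of_riemannianEDist_lt hs
    have hin : ∀ t ∈ Icc (0 : ℝ) 1, γ t ∈ Metric.eball x r := by
      intro t ht
      have h1 : edist (γ 0) (γ t) ≤ pathELength I γ 0 1 := by
        rw [IsRiemannianManifold.out (I := I) (γ 0) (γ t)]
        exact (riemannianEDist_le_pathELength (hγ.mono (Icc_subset_Icc le_rfl ht.2)) rfl rfl
          ht.1).trans (pathELength_mono le_rfl ht.2)
      have h2 : edist (γ t) x ≤ edist (γ 0) (γ t) + edist (γ 0) x := by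
        rw [edist_comm (γ 0) (γ t)]
        exact edist_triangle _ _ _
      rw [Metric.mem_eball]
      calc edist (γ t) x ≤ edist (γ 0) (γ t) + edist (γ 0) x := h2
        _ < (r / 3 + r / 3) + r / 3 :=
            ENNReal.add_lt_add (h1.trans_lt (hγs.trans hsr)) hy
        _ = r := ENNReal.add_thirds r
    have hcd : ContDiffOn ℝ 1 (extChartAt I x ∘ γ) (Icc 0 1) := by
      rw [← contMDiffOn_iff_contDiffOn]
      exact contMDiffOn_extChartAt.comp (I' := I) (t := (chartAt H x).source) hγ
        fun t ht => (hball (hin t ht)).2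
    calc edist (extChartAt I x (γ 0)) (extChartAt I x (γ 1))
        = ‖(extChartAt I x ∘ γ) 1 - (extChartAt I x ∘ γ) 0‖ₑ := by
          rw [edist_comm, edist_eq_enorm_sub]; rfl
      _ ≤ ∫⁻ t in Icc 0 1, ‖derivWithin (extChartAt I x ∘ γ) (Icc 0 1) t‖ₑ :=
          enorm_sub_le_lintegral_derivWithin_Icc_of_contDiffOn_Icc hcd zero_le_one
      _ ≤ ∫⁻ t in Icc 0 1, C * ‖(mfderivWithin 𝓘(ℝ, ℝ) I γ (Icc 0 1) t (1 : ℝ) :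
            TangentSpace I (γ t))‖ₑ := by
          refine setLIntegral_mono' measurableSet_Icc fun t ht => ?_
          have hc : mfderivWithin 𝓘(ℝ, ℝ) 𝓘(ℝ, E) (extChartAt I x ∘ γ) (Icc 0 1) t =
              (mfderiv I 𝓘(ℝ, E) (extChartAt I x) (γ t)).comp
                (mfderivWithin 𝓘(ℝ, ℝ) I γ (Icc 0 1) t) := by
            apply mfderiv_comp_mfderivWithin
            · exact mdifferentiableAt_extChartAt (hball (hin t ht)).2
            · exact hγ.mdifferentiableOn one_ne_zero _ ht
            · rw [uniqueMDiffWithinAt_iff_uniqueDiffWithinAt]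
              exact uniqueDiffOn_Icc zero_lt_one _ ht
          have hd : derivWithin (extChartAt I x ∘ γ) (Icc 0 1) t =
              (mfderiv I 𝓘(ℝ, E) (extChartAt I x) (γ t)
                (mfderivWithin 𝓘(ℝ, ℝ) I γ (Icc 0 1) t (1 : ℝ)) : E) := by
            rw [← fderivWithin_derivWithin]
            rw [mfderivWithin_eq_fderivWithin] at hc
            exact congr($hc (1 : ℝ))
          have aux : ∀ (e : E) (w : TangentSpace I (γ t)), ‖e‖ ≤ C * ‖w‖ → ‖e‖ₑ ≤ C * ‖w‖ₑ := by
            intro e w hew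
            rw [← ofReal_norm, ← ofReal_norm, ← ENNReal.ofReal_coe_nnreal,
              ← ENNReal.ofReal_mul (NNReal.coe_nonneg C)]
            exact ENNReal.ofReal_le_ofReal hew
          rw [hd]
          exact aux _ _ ((hball (hin t ht)).1 _)
      _ = C * pathELength I γ 0 1 := by
          rw [lintegral_const_mul' _ _ ENNReal.coe_ne_top,
            pathELength_eq_lintegral_mfderivWithin_Icc]
          rfl
      _ ≤ C * s := by gcongr
  have hne : (𝓝[>] (edist y z)).NeBot := nhdsGT_neBot_of_exists_gt ⟨_, hyz⟩
  have htend : Tendsto (fun s => (C : ℝ≥0∞) * s) (𝓝[>] (edist y z)) (𝓝 (C * edist y z)) :=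
    (ENNReal.Tendsto.const_mul tendsto_id (Or.inr ENNReal.coe_ne_top)).mono_left nhdsWithin_le_nhds
  refine ge_of_tendsto htend ?_
  filter_upwards [Ioo_mem_nhdsGT hyz] with s hs using hstep s hs.1 hs.2

/-! ### Local Lipschitz continuity -/

/-- `f` is Lipschitz on a neighbourhood of `x`. -/
def LocLipAt {X Y : Type*} [PseudoEMetricSpace X] [PseudoEMetricSpace Y] (f : X → Y) (x : X) :
    Prop :=
  ∃ C : ℝ≥0, ∃ W ∈ 𝓝 x, LipschitzOnWith C f W

namespace LocLipAt

variable {X Y Z : Type*} [PseudoEMetricSpace X] [PseudoEMetricSpace Y] [PseudoEMetricSpace Z]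

theorem continuousAt {f : X → Y} {x : X} (h : LocLipAt f x) : ContinuousAt f x := by
  obtain ⟨C, W, hW, h⟩ := h
  exact h.continuousOn.continuousAt hW

theorem comp {g : Y → Z} {f : X → Y} {x : X} (hg : LocLipAt g (f x)) (hf : LocLipAt f x) :
    LocLipAt (g ∘ f) x := by
  have hc := hf.continuousAt
  obtain ⟨C, W, hW, hf⟩ := hf
  obtain ⟨C', W', hW', hg⟩ := hg
  exact ⟨C' * C, _, inter_mem hW (hc hW'), hg.comp (hf.mono inter_subset_left)
    fun y hy => hy.2⟩

theorem congr {f g : X → Y} {x : X} (hf : LocLipAt f x) (h : g =ᶠ[𝓝 x] f) : LocLipAt g x := by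
  obtain ⟨C, W, hW, hf⟩ := hf
  refine ⟨C, _, inter_mem hW h, fun y hy z hz => ?_⟩
  rw [hy.2, hz.2]
  exact hf hy.1 hz.1

theorem prodMk {f : X → Y} {g : X → Z} {x : X} (hf : LocLipAt f x) (hg : LocLipAt g x) :
    LocLipAt (fun y => (f y, g y)) x := by
  obtain ⟨C, W, hW, hf⟩ := hf
  obtain ⟨C', W', hW', hg⟩ := hg
  exact ⟨max C C', _, inter_mem hW hW', (hf.mono inter_subset_left).prodMk
    (hg.mono inter_subset_right)⟩

theorem fst (x : X × Y) : LocLipAt Prod.fst x :=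
  ⟨1, univ, univ_mem, LipschitzWith.prod_fst.lipschitzOnWith⟩

theorem snd (x : X × Y) : LocLipAt Prod.snd x :=
  ⟨1, univ, univ_mem, LipschitzWith.prod_snd.lipschitzOnWith⟩

end LocLipAt

theorem ContDiffAt.locLipAt {F F' : Type*} [NormedAddCommGroup F] [NormedSpace ℝ F]
    [NormedAddCommGroup F'] [NormedSpace ℝ F'] {f : F → F'} {x : F} (h : ContDiffAt ℝ 1 f x) :
    LocLipAt f x := by
  obtain ⟨K, t, ht, h⟩ := h.exists_lipschitzOnWith
  exact ⟨K, t, ht, h⟩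

variable (I) in
theorem locLipAt_extChartAt (x : M) : LocLipAt (extChartAt I x) x := by
  obtain ⟨C, W, hW, h⟩ := exists_edist_extChartAt_le I x
  exact ⟨C, W, hW, fun y hy z hz => h y hy z hz⟩

variable (I) in
/-- A map into a Riemannian manifold is locally Lipschitz if its expression in a chart is. -/
theorem LocLipAt.of_extChartAt_comp {X : Type*} [PseudoEMetricSpace X] {g : X → M} {x : X}
    (hg : ContinuousAt g x) (h : LocLipAt (fun y => extChartAt I (g x) (g y)) x) :
    LocLipAt g x := by
  obtain ⟨C, W, hW, hC⟩ := exists_edist_le_edist_extChartAt I (g x)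
  obtain ⟨C', W', hW', hC'⟩ := h
  refine ⟨C * C', _, inter_mem hW' (hg hW), fun y hy z hz => ?_⟩
  refine (hC _ hy.2 _ hz.2).trans ?_
  rw [ENNReal.coe_mul, mul_assoc]
  gcongr
  exact hC' hy.1 hz.1

theorem ContMDiffAt.locLipAt {F : Type*} [NormedAddCommGroup F] [NormedSpace ℝ F] {f : M → F}
    {x : M} (h : ContMDiffAt I 𝓘(ℝ, F) 1 f x) : LocLipAt f x := by
  have h1 : ContDiffAt ℝ 1 (f ∘ (extChartAt I x).symm) (extChartAt I x x) := by
    have := (contMDiffAt_iff.1 h).2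
    rw [I.range_eq_univ, contDiffWithinAt_univ] at this
    exact this
  refine (h1.locLipAt.comp (locLipAt_extChartAt I x)).congr ?_
  filter_upwards [extChartAt_source_mem_nhds (I := I) x] with y hy
  simp only [Function.comp, (extChartAt I x).left_inv hy]

theorem ContMDiffAt.locLipAt_of_normedSpace {F : Type*} [NormedAddCommGroup F] [NormedSpace ℝ F]
    {f : F → M} {x : F} (h : ContMDiffAt 𝓘(ℝ, F) I 1 f x) : LocLipAt f x := by
  refine LocLipAt.of_extChartAt_comp I h.continuousAt ?_
  have := (contMDiffAt_iff.1 h).2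
  simp only [ModelWithCorners.range_eq_univ, contDiffWithinAt_univ] at this
  exact this.locLipAt

end ChartLipschitz

/-- A map which is Lipschitz near every point of a compact set is Lipschitz at small scales. -/
theorem IsCompact.exists_edist_le_of_locLipAt {X Y : Type*} [PseudoEMetricSpace X]
    [PseudoEMetricSpace Y] {f : X → Y} {K : Set X} (hK : IsCompact K)
    (hf : ∀ x ∈ K, LocLipAt f x) :
    ∃ (C : ℝ≥0) (δ : ℝ≥0), 0 < δ ∧ ∀ x ∈ K, ∀ y, edist x y < δ → edist (f x) (f y) ≤ C * edist x y := by
  choose! C W hW hL using hf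
  obtain ⟨t, htK, ht⟩ := hK.elim_nhds_subcover (fun x => interior (W x))
    fun x hx => interior_mem_nhds.2 (hW x hx)
  obtain ⟨δ, hδ, h⟩ := lebesgue_number_lemma_of_emetric hK
    (c := fun x : t => interior (W x)) (fun _ => isOpen_interior)
    (by simpa [iUnion_subtype] using ht)
  obtain ⟨δ', hδ'0, hδ'⟩ := ENNReal.lt_iff_exists_nnreal_btwn.1 hδ
  refine ⟨t.sup C, δ', by exact_mod_cast hδ'0, fun x hx y hxy => ?_⟩
  obtain ⟨i, hi⟩ := h x hx
  refine (hL i (htK i i.2) (interior_subset (hi (Metric.mem_eball_self hδ)))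
    (interior_subset (hi ?_))).trans ?_
  · rw [Metric.mem_eball, edist_comm]
    exact hxy.trans hδ'
  · gcongr
    exact Finset.le_sup i.2

/-! ### The metric in a chart -/

section ChartMetric

set_option linter.unusedSectionVars false

variable {E : Type*} [NormedAddCommGroup E] [NormedSpace ℝ E] [FiniteDimensional ℝ E]
  {H : Type*} [TopologicalSpace H] {I : ModelWithCorners ℝ E H} [I.Boundaryless]
  {M : Type*} [TopologicalSpace M] [ChartedSpace H M] [IsManifold I ∞ M]
  [RiemannianBundle (fun x : M => TangentSpace I x)]

variable (I) in
/-- The Riemannian inner product at `p`, of vectors in the model space. -/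
def metricAt (p : M) (a b : E) : ℝ :=
  inner ℝ (show TangentSpace I p from a) (show TangentSpace I p from b)

theorem metricAt_self (p : M) (a : E) :
    metricAt I p a a = ‖(show TangentSpace I p from a)‖ ^ 2 :=
  real_inner_self_eq_norm_sq _

theorem metricAt_comm (p : M) (a b : E) : metricAt I p a b = metricAt I p b a :=
  real_inner_comm _ _

variable (I) in
/-- The inverse of the chart at `x₀`, differentiated at `y`, as a map of the model space. -/
def chartSymmDeriv (x₀ : M) (y : E) : E →L[ℝ] E :=
  mfderiv 𝓘(ℝ, E) I (extChartAt I x₀).symm y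

variable (I) in
/-- The derivative of the chart at `x₀`, as a map of the model space. -/
def chartDeriv (x₀ p : M) : E →L[ℝ] E :=
  mfderiv I 𝓘(ℝ, E) (extChartAt I x₀) p

theorem chartMetric_eq_metricAt (x₀ : M) (y v w : E) :
    chartMetric I x₀ y v w =
      metricAt I ((extChartAt I x₀).symm y) (chartSymmDeriv I x₀ y v) (chartSymmDeriv I x₀ y w) :=
  rfl

theorem isOpen_target (x₀ : M) : IsOpen (extChartAt I x₀).target := isOpen_extChartAt_target x₀

theorem mdifferentiableAt_extChartAt_symm' {x₀ : M} {y : E} (hy : y ∈ (extChartAt I x₀).target) :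
    MDifferentiableAt 𝓘(ℝ, E) I (extChartAt I x₀).symm y := by
  have : IsManifold I 1 M := .of_le (n := ∞) (by simp)
  have := mdifferentiableWithinAt_extChartAt_symm (I := I) (x := x₀) hy
  rwa [I.range_eq_univ, mdifferentiableWithinAt_univ] at this

theorem mdifferentiableAt_extChartAt' {x₀ p : M} (hp : p ∈ (extChartAt I x₀).source) :
    MDifferentiableAt I 𝓘(ℝ, E) (extChartAt I x₀) p := by
  have : IsManifold I 1 M := .of_le (n := ∞) (by simp)
  exact mdifferentiableAt_extChartAt (by simpa using hp)

theorem chartDeriv_chartSymmDeriv {x₀ : M} {y : E} (hy : y ∈ (extChartAt I x₀).target) (v : E) :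
    chartDeriv I x₀ ((extChartAt I x₀).symm y) (chartSymmDeriv I x₀ y v) = v := by
  have h1 := (mdifferentiableAt_extChartAt' (I := I) ((extChartAt I x₀).map_target hy)).hasMFDerivAt
  have h2 := (mdifferentiableAt_extChartAt_symm' hy).hasMFDerivAt
  have h3 := h1.comp y h2
  have h4 : HasMFDerivAt 𝓘(ℝ, E) 𝓘(ℝ, E) (extChartAt I x₀ ∘ (extChartAt I x₀).symm) y
      (ContinuousLinearMap.id ℝ E) := by
    refine (hasMFDerivAt_id y).congr_of_eventuallyEq ?_
    filter_upwards [(isOpen_target x₀).mem_nhds hy] with z hz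
    exact (extChartAt I x₀).right_inv hz
  have := hasMFDerivAt_unique h3 h4
  exact congr($this v)

theorem chartSymmDeriv_chartDeriv {x₀ p : M} (hp : p ∈ (extChartAt I x₀).source) (v : E) :
    chartSymmDeriv I x₀ (extChartAt I x₀ p) (chartDeriv I x₀ p v) = v := by
  have h1 := (mdifferentiableAt_extChartAt' (I := I) hp).hasMFDerivAt
  have h2 := (mdifferentiableAt_extChartAt_symm' ((extChartAt I x₀).map_source hp)).hasMFDerivAt
  have h3 := h2.comp p h1
  have h4 : HasMFDerivAt I I ((extChartAt I x₀).symm ∘ extChartAt I x₀) p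
      (ContinuousLinearMap.id ℝ (TangentSpace I p)) := by
    refine (hasMFDerivAt_id p).congr_of_eventuallyEq ?_
    filter_upwards [extChartAt_source_mem_nhds' hp] with z hz
    exact (extChartAt I x₀).left_inv hz
  have := hasMFDerivAt_unique h3 h4
  exact congr($this v)

theorem metricAt_eq_chartMetric {x₀ p : M} (hp : p ∈ (extChartAt I x₀).source) (v w : E) :
    metricAt I p v w =
      chartMetric I x₀ (extChartAt I x₀ p) (chartDeriv I x₀ p v) (chartDeriv I x₀ p w) := by
  rw [chartMetric_eq_metricAt, chartSymmDeriv_chartDeriv hp, chartSymmDeriv_chartDeriv hp,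
    (extChartAt I x₀).left_inv hp]

variable (I) in
/-- The metric in the chart at `x₀`, as a bilinear form. -/
def chartMetricL (x₀ : M) (y : E) : E →L[ℝ] E →L[ℝ] ℝ :=
  LinearMap.toContinuousLinearMap
    { toFun := fun v => LinearMap.toContinuousLinearMap
        { toFun := fun w => chartMetric I x₀ y v w
          map_add' := fun w w' => by
            simp only [chartMetric_eq_metricAt, map_add]
            exact inner_add_right _ _ _
          map_smul' := fun a w => by
            simp only [chartMetric_eq_metricAt, map_smul]
            exact inner_smul_right _ _ _ }
      map_add' := fun v v' => by
        ext w
        change chartMetric I x₀ y (v + v') w = chartMetric I x₀ y v w + chartMetric I x₀ y v' w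
        simp only [chartMetric_eq_metricAt, map_add]
        exact inner_add_left _ _ _
      map_smul' := fun a v => by
        ext w
        change chartMetric I x₀ y (a • v) w = a * chartMetric I x₀ y v w
        simp only [chartMetric_eq_metricAt, map_smul]
        exact real_inner_smul_left _ _ _ }

theorem chartMetricL_apply (x₀ : M) (y v w : E) :
    chartMetricL I x₀ y v w = chartMetric I x₀ y v w := rfl

theorem chartMetric_pos {x₀ : M} {y : E} (hy : y ∈ (extChartAt I x₀).target) {v : E} (hv : v ≠ 0) :
    0 < chartMetric I x₀ y v v := by
  rw [chartMetric_eq_metricAt, metricAt_self]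
  have : chartSymmDeriv I x₀ y v ≠ 0 := by
    intro h
    apply hv
    rw [← chartDeriv_chartSymmDeriv hy v, h, map_zero]
  exact pow_pos ((norm_pos_iff (E := TangentSpace I ((extChartAt I x₀).symm y))).2 this) 2

theorem contDiffOn_chartMetricL [IsContMDiffRiemannianBundle I ∞ E (fun x : M => TangentSpace I x)]
    (x₀ : M) : ContDiffOn ℝ ∞ (chartMetricL I x₀) (extChartAt I x₀).target := by
  rw [contDiffOn_clm_apply]
  intro v
  rw [contDiffOn_clm_apply]
  intro w
  have hs : ∀ v : E, ContMDiffOn 𝓘(ℝ, E) I.tangent ∞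
      (fun y => (⟨(extChartAt I x₀).symm y, chartSymmDeriv I x₀ y v⟩ : TangentBundle I M))
      (extChartAt I x₀).target := by
    intro v
    have h1 := (contMDiffOn_extChartAt_symm (I := I) (n := ∞) x₀).contMDiffOn_tangentMapWithin
      (m := ∞) (by simp) (isOpen_target x₀).uniqueMDiffOn
    have h2 : ContMDiff 𝓘(ℝ, E) 𝓘(ℝ, E).tangent ∞
        (fun y : E => (⟨y, v⟩ : TangentBundle 𝓘(ℝ, E) E)) :=
      contMDiff_vectorSpace_iff_contDiff.2 contDiff_const
    refine (h1.comp h2.contMDiffOn fun y hy => hy).congr fun y hy => ?_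
    simp only [Function.comp, tangentMapWithin]
    rw [mfderivWithin_of_isOpen (isOpen_target x₀) hy]
    rfl
  rw [← contMDiffOn_iff_contDiffOn]
  exact ContMDiffOn.inner_bundle (F := E) (IB := I) (E := fun x : M => TangentSpace I x)
    (b := (extChartAt I x₀).symm) (v := fun y => chartSymmDeriv I x₀ y v)
    (w := fun y => chartSymmDeriv I x₀ y w) (hs v) (hs w)

/-- The derivative of the transition map between two charts. -/
theorem fderiv_transition {x₀ x₁ : M} {y : E} (hy : y ∈ (extChartAt I x₀).target)
    (hy₁ : (extChartAt I x₀).symm y ∈ (extChartAt I x₁).source) :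
    fderiv ℝ (fun y => extChartAt I x₁ ((extChartAt I x₀).symm y)) y =
      (chartDeriv I x₁ ((extChartAt I x₀).symm y)).comp (chartSymmDeriv I x₀ y) := by
  have h1 := (mdifferentiableAt_extChartAt' (I := I) hy₁).hasMFDerivAt
  have h2 := (mdifferentiableAt_extChartAt_symm' hy).hasMFDerivAt
  have h3 := (h1.comp y h2).mfderiv
  rw [mfderiv_eq_fderiv] at h3
  exact h3

theorem surjective_fderiv_transition {x₀ x₁ : M} {y : E} (hy : y ∈ (extChartAt I x₀).target)
    (hy₁ : (extChartAt I x₀).symm y ∈ (extChartAt I x₁).source) :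
    Function.Surjective
      (fderiv ℝ (fun y => extChartAt I x₁ ((extChartAt I x₀).symm y)) y) := by
  intro z
  set p := (extChartAt I x₀).symm y with hp
  have hps : p ∈ (extChartAt I x₀).source := (extChartAt I x₀).map_target hy
  have hyp : extChartAt I x₀ p = y := (extChartAt I x₀).right_inv hy
  refine ⟨chartDeriv I x₀ p (chartSymmDeriv I x₁ (extChartAt I x₁ p) z), ?_⟩
  rw [fderiv_transition hy hy₁, ContinuousLinearMap.comp_apply]
  have h1 := chartSymmDeriv_chartDeriv hps (chartSymmDeriv I x₁ (extChartAt I x₁ p) z)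
  rw [hyp] at h1
  rw [h1]
  have h2 := chartDeriv_chartSymmDeriv ((extChartAt I x₁).map_source hy₁) z
  rwa [(extChartAt I x₁).left_inv hy₁] at h2

theorem chartMetric_transition {x₀ x₁ : M} {y : E} (hy : y ∈ (extChartAt I x₀).target)
    (hy₁ : (extChartAt I x₀).symm y ∈ (extChartAt I x₁).source) (v w : E) :
    chartMetric I x₀ y v w =
      chartMetric I x₁ (extChartAt I x₁ ((extChartAt I x₀).symm y))
        (fderiv ℝ (fun y => extChartAt I x₁ ((extChartAt I x₀).symm y)) y v)
        (fderiv ℝ (fun y => extChartAt I x₁ ((extChartAt I x₀).symm y)) y w) := by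
  rw [fderiv_transition hy hy₁]
  exact metricAt_eq_chartMetric hy₁ _ _

theorem chartMetric_comm (x₀ : M) (y v w : E) :
    chartMetric I x₀ y v w = chartMetric I x₀ y w v := by
  rw [chartMetric_eq_metricAt, chartMetric_eq_metricAt, metricAt_comm]

end ChartMetric

/-! ### The geodesic equation in charts -/

section GeodesicEquation

variable {E : Type*} [NormedAddCommGroup E] [NormedSpace ℝ E]

/-- A shortcut for instance search. -/
local instance : NormedAddCommGroup (E →L[ℝ] E →L[ℝ] ℝ) := ContinuousLinearMap.toNormedAddCommGroup

/-- A shortcut for instance search. -/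
local instance : NormedSpace ℝ (E →L[ℝ] E →L[ℝ] ℝ) := ContinuousLinearMap.toNormedSpace

/-- The defect of the geodesic equation for the metric `G`, at the point `y` with velocity `u` and
acceleration `a`, tested against `z`. -/
def geodesicDefect (G : E → E →L[ℝ] E →L[ℝ] ℝ) (y u a z : E) : ℝ :=
  G y a z + fderiv ℝ G y u u z - (1 / 2) * fderiv ℝ G y z u u

/-- The geodesic equation is invariant under changes of coordinates. -/
theorem geodesicDefect_transition {G G' : E → E →L[ℝ] E →L[ℝ] ℝ} {ψ : E → E} {y : E}
    (hψ : ContDiffAt ℝ 2 ψ y) (hG' : DifferentiableAt ℝ G' (ψ y))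
    (h : ∀ᶠ x in 𝓝 y, ∀ v w, G x v w = G' (ψ x) (fderiv ℝ ψ x v) (fderiv ℝ ψ x w))
    (hsym : ∀ v w, G' (ψ y) v w = G' (ψ y) w v) (hG : DifferentiableAt ℝ G y) (u a z : E) :
    geodesicDefect G y u a z = geodesicDefect G' (ψ y) (fderiv ℝ ψ y u)
      (fderiv ℝ ψ y a + fderiv ℝ (fderiv ℝ ψ) y u u) (fderiv ℝ ψ y z) := by
  have hψ' : HasFDerivAt ψ (fderiv ℝ ψ y) y := (hψ.differentiableAt two_ne_zero).hasFDerivAt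
  have hψ'' : HasFDerivAt (fderiv ℝ ψ) (fderiv ℝ (fderiv ℝ ψ) y) y :=
    ((hψ.fderiv_right (m := 1) (by norm_num)).differentiableAt one_ne_zero).hasFDerivAt
  have hsymm : ∀ v w, fderiv ℝ (fderiv ℝ ψ) y v w = fderiv ℝ (fderiv ℝ ψ) y w v := by
    intro v w
    exact (hψ.isSymmSndFDerivAt (by simp)).eq v w
  have key : ∀ h' v w, fderiv ℝ G y h' v w =
      fderiv ℝ G' (ψ y) (fderiv ℝ ψ y h') (fderiv ℝ ψ y v) (fderiv ℝ ψ y w) +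
      G' (ψ y) (fderiv ℝ (fderiv ℝ ψ) y h' v) (fderiv ℝ ψ y w) +
      G' (ψ y) (fderiv ℝ ψ y v) (fderiv ℝ (fderiv ℝ ψ) y h' w) := by
    intro h' v w
    have h1 : HasFDerivAt (fun x => G x v w)
        (((ContinuousLinearMap.apply ℝ ℝ w).comp (ContinuousLinearMap.apply ℝ (E →L[ℝ] ℝ) v)).comp
          (fderiv ℝ G y)) y :=
      ((ContinuousLinearMap.apply ℝ ℝ w).comp
        (ContinuousLinearMap.apply ℝ (E →L[ℝ] ℝ) v)).hasFDerivAt.comp y hG.hasFDerivAt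
    have h20 : HasFDerivAt (fun x => G' (ψ x)) ((fderiv ℝ G' (ψ y)).comp (fderiv ℝ ψ y)) y :=
      hG'.hasFDerivAt.comp y hψ'
    have h2 := (h20.clm_apply (hψ''.clm_apply (hasFDerivAt_const v y))).clm_apply
      (hψ''.clm_apply (hasFDerivAt_const w y))
    have h3 := h1.unique (h2.congr_of_eventuallyEq (h.mono fun x hx => hx v w))
    have h4 := congr($h3 h')
    simp at h4
    rw [h4]
    ring
  have h0 : G y a z = G' (ψ y) (fderiv ℝ ψ y a) (fderiv ℝ ψ y z) := h.self_of_nhds a z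
  simp only [geodesicDefect, key, h0, map_add, ContinuousLinearMap.add_apply]
  rw [hsymm z u, hsym (fderiv ℝ (fderiv ℝ ψ) y u z)]
  ring

end GeodesicEquation

section Geodesic

set_option linter.unusedSectionVars false

variable {E : Type*} [NormedAddCommGroup E] [NormedSpace ℝ E] [FiniteDimensional ℝ E]
  {H : Type*} [TopologicalSpace H] {I : ModelWithCorners ℝ E H} [I.Boundaryless]
  {M : Type*} [TopologicalSpace M] [ChartedSpace H M] [IsManifold I ∞ M]
  [RiemannianBundle (fun x : M => TangentSpace I x)]
  [IsContMDiffRiemannianBundle I ∞ E (fun x : M => TangentSpace I x)]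

/-- A shortcut for instance search. -/
local instance : NormedAddCommGroup (E →L[ℝ] E →L[ℝ] ℝ) := ContinuousLinearMap.toNormedAddCommGroup

/-- A shortcut for instance search. -/
local instance : NormedSpace ℝ (E →L[ℝ] E →L[ℝ] ℝ) := ContinuousLinearMap.toNormedSpace

/-- A shortcut for instance search. -/
local instance : NormedAddCommGroup ((E →L[ℝ] ℝ) →L[ℝ] E) := ContinuousLinearMap.toNormedAddCommGroup

/-- A shortcut for instance search. -/
local instance : NormedSpace ℝ ((E →L[ℝ] ℝ) →L[ℝ] E) := ContinuousLinearMap.toNormedSpace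

theorem two_le_infty : (2 : WithTop ℕ∞) ≤ (∞ : WithTop ℕ∞) := ENat.LEInfty.out

theorem differentiableAt_chartMetricL {x₀ : M} {y : E} (hy : y ∈ (extChartAt I x₀).target) :
    DifferentiableAt ℝ (chartMetricL I x₀) y :=
  ((contDiffOn_chartMetricL x₀).differentiableOn (by simp)).differentiableAt
    ((isOpen_target x₀).mem_nhds hy)

theorem fderiv_chartMetric {x₀ : M} {y : E} (hy : y ∈ (extChartAt I x₀).target) (v w h : E) :
    fderiv ℝ (fun y => chartMetric I x₀ y v w) y h = fderiv ℝ (chartMetricL I x₀) y h v w := by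
  have h1 : HasFDerivAt (fun x => chartMetricL I x₀ x v w)
      (((ContinuousLinearMap.apply ℝ ℝ w).comp (ContinuousLinearMap.apply ℝ (E →L[ℝ] ℝ) v)).comp
        (fderiv ℝ (chartMetricL I x₀) y)) y :=
    ((ContinuousLinearMap.apply ℝ ℝ w).comp
      (ContinuousLinearMap.apply ℝ (E →L[ℝ] ℝ) v)).hasFDerivAt.comp y
        (differentiableAt_chartMetricL hy).hasFDerivAt
  have := h1.fderiv
  exact congr($this h)

variable (I) in
/-- `γ` satisfies the geodesic equation at the time `t`. -/
def IsGeodesicAt (γ : ℝ → M) (t : ℝ) : Prop :=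
  ContMDiffAt 𝓘(ℝ, ℝ) I 2 γ t ∧ ∀ x₀ : M, γ t ∈ (extChartAt I x₀).source → ∀ z : E,
    geodesicDefect (chartMetricL I x₀) (extChartAt I x₀ (γ t))
      (deriv (fun s => extChartAt I x₀ (γ s)) t)
      (deriv (deriv (fun s => extChartAt I x₀ (γ s))) t) z = 0

theorem isGeodesic_iff {γ : ℝ → M} : IsGeodesic I γ ↔ ∀ t, IsGeodesicAt I γ t := by
  have key : ∀ (x₀ : M) (t : ℝ) (z : E), γ t ∈ (chartAt H x₀).source →
      ((chartMetric I x₀ (extChartAt I x₀ (γ t))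
          (deriv (deriv (fun s => extChartAt I x₀ (γ s))) t) z
        + fderiv ℝ (fun y => chartMetric I x₀ y (deriv (fun s => extChartAt I x₀ (γ s)) t) z)
          (extChartAt I x₀ (γ t)) (deriv (fun s => extChartAt I x₀ (γ s)) t)
      = (1 / 2) * fderiv ℝ (fun y => chartMetric I x₀ y (deriv (fun s => extChartAt I x₀ (γ s)) t)
          (deriv (fun s => extChartAt I x₀ (γ s)) t)) (extChartAt I x₀ (γ t)) z) ↔
      geodesicDefect (chartMetricL I x₀) (extChartAt I x₀ (γ t))
        (deriv (fun s => extChartAt I x₀ (γ s)) t)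
        (deriv (deriv (fun s => extChartAt I x₀ (γ s))) t) z = 0) := by
    intro x₀ t z ht
    have ht' : extChartAt I x₀ (γ t) ∈ (extChartAt I x₀).target :=
      (extChartAt I x₀).map_source (by simpa using ht)
    rw [fderiv_chartMetric ht', fderiv_chartMetric ht', geodesicDefect, sub_eq_zero,
      chartMetricL_apply]
  constructor
  · intro h t
    exact ⟨h.contMDiff t, fun x₀ hx z =>
      (key x₀ t z (by simpa using hx)).1 (h.equation x₀ t (by simpa using hx) z)⟩
  · intro h
    exact ⟨fun t => (h t).1, fun x₀ t hx z =>
      (key x₀ t z hx).2 ((h t).2 x₀ (by simpa using hx) z)⟩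

theorem contDiffAt_extChartAt_comp {γ : ℝ → M} {t : ℝ} {n : WithTop ℕ∞} (hn : n ≤ (∞ : WithTop ℕ∞))
    (hγ : ContMDiffAt 𝓘(ℝ, ℝ) I n γ t) {x₀ : M} (hx : γ t ∈ (extChartAt I x₀).source) :
    ContDiffAt ℝ n (fun s => extChartAt I x₀ (γ s)) t := by
  rw [← contMDiffAt_iff_contDiffAt]
  have := (contMDiffOn_extChartAt (I := I) (n := ∞) (x := x₀)).contMDiffAt
    ((chartAt H x₀).open_source.mem_nhds (by simpa using hx))
  exact (this.of_le hn).comp t hγ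

theorem contDiffAt_transition {x₀ x₁ : M} {y : E} (hy : y ∈ (extChartAt I x₀).target)
    (hy₁ : (extChartAt I x₀).symm y ∈ (extChartAt I x₁).source) :
    ContDiffAt ℝ ∞ (fun y => extChartAt I x₁ ((extChartAt I x₀).symm y)) y := by
  rw [← contMDiffAt_iff_contDiffAt]
  have h1 := (contMDiffOn_extChartAt (I := I) (n := ∞) (x := x₁)).contMDiffAt
    ((chartAt H x₁).open_source.mem_nhds (by simpa using hy₁))
  have h2 := (contMDiffOn_extChartAt_symm (I := I) (n := ∞) x₀).contMDiffAt
    ((isOpen_target x₀).mem_nhds hy)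
  exact h1.comp y h2

/-- It suffices to check the geodesic equation in one chart. -/
theorem isGeodesicAt_of_chart {γ : ℝ → M} {t : ℝ} (hγ : ContMDiffAt 𝓘(ℝ, ℝ) I 2 γ t) {x₀ : M}
    (hx : γ t ∈ (extChartAt I x₀).source)
    (h : ∀ z : E, geodesicDefect (chartMetricL I x₀) (extChartAt I x₀ (γ t))
      (deriv (fun s => extChartAt I x₀ (γ s)) t)
      (deriv (deriv (fun s => extChartAt I x₀ (γ s))) t) z = 0) : IsGeodesicAt I γ t := by
  refine ⟨hγ, fun x₁ hx₁ z => ?_⟩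
  set c := fun s => extChartAt I x₀ (γ s) with hc
  set c₁ := fun s => extChartAt I x₁ (γ s) with hc₁
  set ψ := fun y => extChartAt I x₁ ((extChartAt I x₀).symm y) with hψ
  have hct : c t ∈ (extChartAt I x₀).target := (extChartAt I x₀).map_source hx
  have hct₁ : c₁ t ∈ (extChartAt I x₁).target := (extChartAt I x₁).map_source hx₁
  have hleft : (extChartAt I x₀).symm (c t) = γ t := (extChartAt I x₀).left_inv hx
  have hψc : ψ (c t) = c₁ t := by simp only [hψ, hleft, hc₁]
  have hψd : ContDiffAt ℝ ∞ ψ (c t) := contDiffAt_transition hct (by rw [hleft]; exact hx₁)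
  have hcd : ContDiffAt ℝ 2 c t :=
    contDiffAt_extChartAt_comp two_le_infty hγ hx
  have hev : ∀ᶠ s in 𝓝 t, γ s ∈ (extChartAt I x₀).source :=
    hγ.continuousAt ((isOpen_extChartAt_source x₀).mem_nhds hx)
  have hcc : c₁ =ᶠ[𝓝 t] ψ ∘ c := by
    filter_upwards [hev] with s hs
    simp only [hc₁, hψ, hc, Function.comp, (extChartAt I x₀).left_inv hs]
  have hcd' : ∀ᶠ s in 𝓝 t, ContDiffAt ℝ 2 c s := hcd.eventually (by simp)
  have hψd' : ∀ᶠ s in 𝓝 t, ContDiffAt ℝ 2 ψ (c s) :=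
    hcd.continuousAt.eventually ((hψd.of_le two_le_infty).eventually (by simp))
  have hd1 : deriv c₁ =ᶠ[𝓝 t] fun s => fderiv ℝ ψ (c s) (deriv c s) := by
    filter_upwards [hcc.eventuallyEq_nhds, hcd', hψd'] with s h1 h2 h3
    rw [h1.deriv_eq]
    exact ((h3.differentiableAt two_ne_zero).hasFDerivAt.comp_hasDerivAt s
      (h2.differentiableAt two_ne_zero).hasDerivAt).deriv
  have hd2 : deriv (deriv c₁) t = fderiv ℝ ψ (c t) (deriv (deriv c) t) +
      fderiv ℝ (fderiv ℝ ψ) (c t) (deriv c t) (deriv c t) := by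
    rw [hd1.deriv_eq]
    have h1 : HasDerivAt (fun s => fderiv ℝ ψ (c s))
        (fderiv ℝ (fderiv ℝ ψ) (c t) (deriv c t)) t :=
      ((hψd.fderiv_right (m := 1) two_le_infty).differentiableAt
        one_ne_zero).hasFDerivAt.comp_hasDerivAt t (hcd.differentiableAt two_ne_zero).hasDerivAt
    have h2 : HasDerivAt (deriv c) (deriv (deriv c) t) t := by
      have : ContDiffAt ℝ 1 (deriv c) t :=
        (hcd.fderiv_right (m := 1) (by norm_num)).clm_apply contDiffAt_const
      exact (this.differentiableAt one_ne_zero).hasDerivAt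
    rw [(h1.clm_apply h2).deriv]
    abel
  obtain ⟨w, rfl⟩ : ∃ w, fderiv ℝ ψ (c t) w = z :=
    surjective_fderiv_transition hct (by rw [hleft]; exact hx₁) z
  rw [show extChartAt I x₁ (γ t) = ψ (c t) from hψc.symm, hd1.self_of_nhds, hd2,
    ← geodesicDefect_transition (G := chartMetricL I x₀)
    (hψd.of_le two_le_infty) _ _ (chartMetric_comm x₁ _) (differentiableAt_chartMetricL hct)]
  · exact h w
  · rw [hψc]; exact differentiableAt_chartMetricL hct₁
  · have h1 : ∀ᶠ y in 𝓝 (c t), y ∈ (extChartAt I x₀).target :=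
      (isOpen_target x₀).mem_nhds hct
    have h2 : ∀ᶠ y in 𝓝 (c t), (extChartAt I x₀).symm y ∈ (extChartAt I x₁).source := by
      have := (continuousOn_extChartAt_symm (I := I) x₀).continuousAt
        ((isOpen_target x₀).mem_nhds hct)
      exact this ((isOpen_extChartAt_source x₁).mem_nhds (by rw [hleft]; exact hx₁))
    filter_upwards [h1, h2] with y hy hy' v w
    exact chartMetric_transition hy hy' v w


/-! ### Geodesic acceleration -/

theorem isInvertible_chartMetricL {x₀ : M} {y : E} (hy : y ∈ (extChartAt I x₀).target) :
    (chartMetricL I x₀ y).IsInvertible := by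
  have hinj : Function.Injective (chartMetricL I x₀ y) := by
    rw [injective_iff_map_eq_zero]
    intro v hv
    by_contra hne
    have := chartMetric_pos hy hne
    rw [← chartMetricL_apply, hv] at this
    simp at this
  have hdim : Module.finrank ℝ E = Module.finrank ℝ (E →L[ℝ] ℝ) := by
    rw [← LinearEquiv.finrank_eq (LinearMap.toContinuousLinearMap (𝕜 := ℝ) (E := E) (F' := ℝ))]
    exact (Subspace.dual_finrank_eq (K := ℝ) (V := E)).symm
  let e : E ≃ₗ[ℝ] (E →L[ℝ] ℝ) :=
    LinearMap.linearEquivOfInjective (chartMetricL I x₀ y).toLinearMap hinj hdim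
  exact ⟨e.toContinuousLinearEquiv, by ext v w; rfl⟩

variable (I) in
/-- The right-hand side of the geodesic equation `g(c'', ·) = R(c, c')`. -/
def geodesicForce (x₀ : M) (p : E × E) : E →L[ℝ] ℝ :=
  (1 / 2 : ℝ) • ((fderiv ℝ (chartMetricL I x₀) p.1).flip p.2).flip p.2 -
    fderiv ℝ (chartMetricL I x₀) p.1 p.2 p.2

variable (I) in
/-- The acceleration of geodesics in the chart at `x₀`. -/
def geodesicAccel (x₀ : M) (p : E × E) : E :=
  (chartMetricL I x₀ p.1).inverse (geodesicForce I x₀ p)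

theorem geodesicDefect_eq_zero_iff {x₀ : M} {y : E} (hy : y ∈ (extChartAt I x₀).target)
    (u a : E) : (∀ z, geodesicDefect (chartMetricL I x₀) y u a z = 0) ↔
      a = geodesicAccel I x₀ (y, u) := by
  have h1 : (∀ z, geodesicDefect (chartMetricL I x₀) y u a z = 0) ↔
      chartMetricL I x₀ y a = geodesicForce I x₀ (y, u) := by
    rw [ContinuousLinearMap.ext_iff]
    refine forall_congr' fun z => ?_
    simp only [geodesicDefect, geodesicForce, ContinuousLinearMap.sub_apply,
      ContinuousLinearMap.smul_apply, ContinuousLinearMap.flip_apply, smul_eq_mul]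
    constructor <;> intro h <;> linarith
  rw [h1]
  obtain ⟨e, he⟩ := isInvertible_chartMetricL hy
  simp only [geodesicAccel]
  rw [← he, ContinuousLinearMap.inverse_equiv]
  simp only [ContinuousLinearEquiv.coe_coe]
  rw [ContinuousLinearEquiv.eq_symm_apply]

theorem geodesicAccel_smul (x₀ : M) (y u : E) (a : ℝ) :
    geodesicAccel I x₀ (y, a • u) = a ^ 2 • geodesicAccel I x₀ (y, u) := by
  have : geodesicForce I x₀ (y, a • u) = a ^ 2 • geodesicForce I x₀ (y, u) := by
    ext z
    simp only [geodesicForce, ContinuousLinearMap.sub_apply, map_smul,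
      ContinuousLinearMap.smul_apply, ContinuousLinearMap.flip_apply, smul_eq_mul]
    ring
  rw [geodesicAccel, this, map_smul]
  rfl

theorem contDiffOn_geodesicAccel (x₀ : M) :
    ContDiffOn ℝ ∞ (geodesicAccel I x₀) ((extChartAt I x₀).target ×ˢ univ) := by
  have hG : ContDiffOn ℝ ∞ (fun p : E × E => chartMetricL I x₀ p.1)
      ((extChartAt I x₀).target ×ˢ univ) :=
    (contDiffOn_chartMetricL x₀).comp contDiffOn_fst fun p hp => hp.1
  have hdG : ContDiffOn ℝ ∞ (fun p : E × E => fderiv ℝ (chartMetricL I x₀) p.1)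
      ((extChartAt I x₀).target ×ˢ univ) :=
    ((contDiffOn_chartMetricL x₀).fderiv_of_isOpen (isOpen_target x₀) (by simp)).comp
      contDiffOn_fst fun p hp => hp.1
  have hF : ContDiffOn ℝ ∞ (geodesicForce I x₀) ((extChartAt I x₀).target ×ˢ univ) := by
    have h1 : ContDiffOn ℝ ∞ (fun p : E × E => (fderiv ℝ (chartMetricL I x₀) p.1).flip)
        ((extChartAt I x₀).target ×ˢ univ) :=
      (ContinuousLinearMap.flipₗᵢ ℝ E E (E →L[ℝ] ℝ)).toContinuousLinearEquiv.contDiff.comp_contDiffOn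
        hdG
    have h2 : ContDiffOn ℝ ∞ (fun p : E × E => ((fderiv ℝ (chartMetricL I x₀) p.1).flip p.2).flip)
        ((extChartAt I x₀).target ×ˢ univ) :=
      (ContinuousLinearMap.flipₗᵢ ℝ E E ℝ).toContinuousLinearEquiv.contDiff.comp_contDiffOn
        (h1.clm_apply contDiffOn_snd)
    exact ((h2.clm_apply contDiffOn_snd).const_smul (1 / 2 : ℝ)).sub
      ((hdG.clm_apply contDiffOn_snd).clm_apply contDiffOn_snd)
  have hI : ContDiffOn ℝ ∞ (fun p : E × E => (chartMetricL I x₀ p.1).inverse)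
      ((extChartAt I x₀).target ×ˢ univ) := by
    intro p hp
    obtain ⟨e, he⟩ := isInvertible_chartMetricL hp.1
    have h := contDiffAt_map_inverse (𝕜 := ℝ) (n := ∞) e
    rw [he] at h
    exact h.comp_contDiffWithinAt p (hG p hp)
  exact hI.clm_apply hF

/-! ### Geodesics as solutions of the chart equation -/

theorem IsGeodesicAt.continuousAt {γ : ℝ → M} {t : ℝ} (h : IsGeodesicAt I γ t) :
    ContinuousAt γ t := h.1.continuousAt

theorem IsGeodesicAt.hasDerivAt {γ : ℝ → M} {t : ℝ} (h : IsGeodesicAt I γ t) {x₀ : M}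
    (hx : γ t ∈ (extChartAt I x₀).source) :
    HasDerivAt (fun s => extChartAt I x₀ (γ s)) (deriv (fun s => extChartAt I x₀ (γ s)) t) t ∧
    HasDerivAt (deriv (fun s => extChartAt I x₀ (γ s)))
      (geodesicAccel I x₀ (extChartAt I x₀ (γ t), deriv (fun s => extChartAt I x₀ (γ s)) t)) t := by
  have hcd : ContDiffAt ℝ 2 (fun s => extChartAt I x₀ (γ s)) t :=
    contDiffAt_extChartAt_comp two_le_infty h.1 hx
  refine ⟨(hcd.differentiableAt two_ne_zero).hasDerivAt, ?_⟩
  rw [← (geodesicDefect_eq_zero_iff ((extChartAt I x₀).map_source hx) _ _).1 (h.2 x₀ hx)]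
  have : ContDiffAt ℝ 1 (deriv (fun s => extChartAt I x₀ (γ s))) t :=
    (hcd.fderiv_right (m := 1) (by norm_num)).clm_apply contDiffAt_const
  exact (this.differentiableAt one_ne_zero).hasDerivAt

theorem isGeodesicAt_of_hasDerivAt {x₀ : M} {c w : ℝ → E} {t : ℝ}
    (hc : ∀ᶠ s in 𝓝 t, HasDerivAt c (w s) s)
    (hw : ∀ᶠ s in 𝓝 t, HasDerivAt w (geodesicAccel I x₀ (c s, w s)) s)
    (ht : c t ∈ (extChartAt I x₀).target) :
    IsGeodesicAt I (fun s => (extChartAt I x₀).symm (c s)) t := by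
  have hct : ContinuousAt c t := hc.self_of_nhds.continuousAt
  have hin : ∀ᶠ s in 𝓝 t, c s ∈ (extChartAt I x₀).target :=
    hct ((isOpen_target x₀).mem_nhds ht)
  obtain ⟨u, hu, huo, htu⟩ := eventually_nhds_iff.1 (hc.and (hw.and hin))
  have hdc : EqOn (deriv c) w u := fun s hs => (hu s hs).1.deriv
  have hdw : EqOn (deriv w) (fun s => geodesicAccel I x₀ (c s, w s)) u :=
    fun s hs => (hu s hs).2.1.deriv
  have hcu : ContinuousOn c u := fun s hs => (hu s hs).1.continuousAt.continuousWithinAt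
  have hwu : ContinuousOn w u := fun s hs => (hu s hs).2.1.continuousAt.continuousWithinAt
  have hw1 : ContDiffOn ℝ 1 w u := by
    rw [show (1 : WithTop ℕ∞) = 0 + 1 by norm_num, contDiffOn_succ_iff_deriv_of_isOpen huo]
    refine ⟨fun s hs => (hu s hs).2.1.differentiableAt.differentiableWithinAt, by simp, ?_⟩
    rw [contDiffOn_zero]
    refine ContinuousOn.congr ?_ hdw
    exact (contDiffOn_geodesicAccel x₀).continuousOn.comp (hcu.prodMk hwu)
      fun s hs => ⟨(hu s hs).2.2, mem_univ _⟩
  have hc2 : ContDiffOn ℝ 2 c u := by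
    rw [show (2 : WithTop ℕ∞) = 1 + 1 by norm_num, contDiffOn_succ_iff_deriv_of_isOpen huo]
    exact ⟨fun s hs => (hu s hs).1.differentiableAt.differentiableWithinAt, by simp,
      hw1.congr hdc⟩
  have hsm : ContMDiffAt 𝓘(ℝ, ℝ) I 2 (fun s => (extChartAt I x₀).symm (c s)) t := by
    have h1 := (contMDiffOn_extChartAt_symm (I := I) (n := ∞) x₀).contMDiffAt
      ((isOpen_target x₀).mem_nhds ht)
    exact (h1.of_le two_le_infty).comp t
      (contMDiffAt_iff_contDiffAt.2 (hc2.contDiffAt (huo.mem_nhds htu)))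
  have heq : (fun s => extChartAt I x₀ ((extChartAt I x₀).symm (c s))) =ᶠ[𝓝 t] c := by
    filter_upwards [hin] with s hs using (extChartAt I x₀).right_inv hs
  refine isGeodesicAt_of_chart hsm ((extChartAt I x₀).map_target ht) ?_
  rw [(extChartAt I x₀).right_inv ht, geodesicDefect_eq_zero_iff ht, heq.deriv_eq,
    heq.deriv.deriv_eq, hc.self_of_nhds.deriv]
  have : deriv c =ᶠ[𝓝 t] w := by
    filter_upwards [huo.mem_nhds htu] with s hs using hdc hs
  rw [this.deriv_eq]
  exact hw.self_of_nhds.deriv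

theorem IsGeodesicAt.congr {γ γ' : ℝ → M} {t : ℝ} (h : IsGeodesicAt I γ t) (he : γ' =ᶠ[𝓝 t] γ) :
    IsGeodesicAt I γ' t := by
  refine ⟨h.1.congr_of_eventuallyEq he, fun x₀ hx z => ?_⟩
  rw [he.self_of_nhds] at hx ⊢
  have h1 : (fun s => extChartAt I x₀ (γ' s)) =ᶠ[𝓝 t] fun s => extChartAt I x₀ (γ s) := by
    filter_upwards [he] with s hs
    rw [hs]
  rw [h1.deriv_eq, h1.deriv.deriv_eq]
  exact h.2 x₀ hx z

/-- Affine reparametrizations of geodesics are geodesics. -/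
theorem IsGeodesicAt.comp_affine {γ : ℝ → M} {a b t : ℝ} (h : ∀ᶠ s in 𝓝 (a * t + b), IsGeodesicAt I γ s) :
    IsGeodesicAt I (fun s => γ (a * s + b)) t := by
  set x₀ := γ (a * t + b)
  set c := fun s => extChartAt I x₀ (γ s)
  have hx : γ (a * t + b) ∈ (extChartAt I x₀).source := mem_extChartAt_source _
  have hcont : Tendsto (fun s => a * s + b) (𝓝 t) (𝓝 (a * t + b)) :=
    Continuous.tendsto (by fun_prop) t
  have hin : ∀ᶠ s in 𝓝 (a * t + b), γ s ∈ (extChartAt I x₀).source :=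
    h.self_of_nhds.continuousAt ((isOpen_extChartAt_source x₀).mem_nhds hx)
  have haff : ∀ s, HasDerivAt (fun s => a * s + b) a s := fun s => by
    simpa using ((hasDerivAt_id s).const_mul a).add_const b
  have h1 : IsGeodesicAt I (fun s => (extChartAt I x₀).symm (c (a * s + b))) t := by
    refine isGeodesicAt_of_hasDerivAt (w := fun s => a • deriv c (a * s + b)) ?_ ?_
      ((extChartAt I x₀).map_source hx)
    · filter_upwards [hcont.eventually h, hcont.eventually hin] with s hs hs'
      exact (hs.hasDerivAt hs').1.scomp s (haff s)
    · filter_upwards [hcont.eventually h, hcont.eventually hin] with s hs hs'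
      rw [geodesicAccel_smul, sq, mul_smul]
      exact ((hs.hasDerivAt hs').2.scomp s (haff s)).const_smul a
  refine h1.congr ?_
  filter_upwards [hcont.eventually hin] with s hs
  exact ((extChartAt I x₀).left_inv hs).symm

variable (I) in
/-- The velocity of a curve, as a vector of the model space. -/
def velocity (γ : ℝ → M) (t : ℝ) : E := mfderiv 𝓘(ℝ, ℝ) I γ t (1 : ℝ)

theorem deriv_extChartAt_comp {γ : ℝ → M} {t : ℝ} (h : MDifferentiableAt 𝓘(ℝ, ℝ) I γ t) {x₀ : M}
    (hx : γ t ∈ (extChartAt I x₀).source) :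
    deriv (fun s => extChartAt I x₀ (γ s)) t = chartDeriv I x₀ (γ t) (velocity I γ t) := by
  have h1 := ((mdifferentiableAt_extChartAt' (I := I) hx).hasMFDerivAt.comp t h.hasMFDerivAt).mfderiv
  rw [mfderiv_eq_fderiv] at h1
  have h2 := congr($h1 (1 : ℝ))
  rw [← fderiv_apply_one_eq_deriv]
  exact h2

theorem velocity_comp_affine {γ : ℝ → M} {a b t : ℝ}
    (h : MDifferentiableAt 𝓘(ℝ, ℝ) I γ (a * t + b)) :
    velocity I (fun s => γ (a * s + b)) t = a • velocity I γ (a * t + b) := by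
  have haff : HasMFDerivAt 𝓘(ℝ, ℝ) 𝓘(ℝ, ℝ) (fun s : ℝ => a * s + b) t
      ((1 : ℝ →L[ℝ] ℝ).smulRight a) := by
    have : HasDerivAt (fun s => a * s + b) a t := by
      simpa using ((hasDerivAt_id t).const_mul a).add_const b
    exact this.hasFDerivAt.hasMFDerivAt
  have h1 := (h.hasMFDerivAt.comp t haff).mfderiv
  have h2 := congr($h1 (1 : ℝ))
  have h3 : ((1 : ℝ →L[ℝ] ℝ).smulRight a) (1 : ℝ) = a • (1 : ℝ) := by simp
  let D : ℝ →L[ℝ] E := mfderiv 𝓘(ℝ, ℝ) I γ (a * t + b)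
  have h4 : velocity I (fun s => γ (a * s + b)) t = D (((1 : ℝ →L[ℝ] ℝ).smulRight a) (1 : ℝ)) := h2
  rw [h4, h3, map_smul]
  rfl

variable (I) in
/-- The squared speed of a curve. -/
def sqSpeed (γ : ℝ → M) (t : ℝ) : ℝ := metricAt I (γ t) (velocity I γ t) (velocity I γ t)

theorem sqSpeed_eq_chartMetric {γ : ℝ → M} {t : ℝ} (h : MDifferentiableAt 𝓘(ℝ, ℝ) I γ t) {x₀ : M}
    (hx : γ t ∈ (extChartAt I x₀).source) :
    sqSpeed I γ t = chartMetric I x₀ (extChartAt I x₀ (γ t))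
      (deriv (fun s => extChartAt I x₀ (γ s)) t) (deriv (fun s => extChartAt I x₀ (γ s)) t) := by
  rw [sqSpeed, metricAt_eq_chartMetric hx, deriv_extChartAt_comp h hx]

/-- Geodesics have constant speed. -/
theorem hasDerivAt_sqSpeed {γ : ℝ → M} {t : ℝ} (h : ∀ᶠ s in 𝓝 t, IsGeodesicAt I γ s) :
    HasDerivAt (sqSpeed I γ) 0 t := by
  set x₀ := γ t with hx₀
  have hx : γ t ∈ (extChartAt I x₀).source := mem_extChartAt_source _
  have hin : ∀ᶠ s in 𝓝 t, γ s ∈ (extChartAt I x₀).source :=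
    h.self_of_nhds.continuousAt ((isOpen_extChartAt_source x₀).mem_nhds hx)
  have htar := (extChartAt I x₀).map_source hx
  have heq : sqSpeed I γ =ᶠ[𝓝 t] fun s => chartMetricL I x₀ (extChartAt I x₀ (γ s))
      (deriv (fun s => extChartAt I x₀ (γ s)) s) (deriv (fun s => extChartAt I x₀ (γ s)) s) := by
    filter_upwards [h, hin] with s hs hs'
    exact sqSpeed_eq_chartMetric (hs.1.mdifferentiableAt two_ne_zero) hs'
  obtain ⟨hc, hc'⟩ := h.self_of_nhds.hasDerivAt hx
  have hdef := (geodesicDefect_eq_zero_iff htar (deriv (fun s => extChartAt I x₀ (γ s)) t) _).2 rfl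
    (deriv (fun s => extChartAt I x₀ (γ s)) t)
  have hG : HasDerivAt (fun s => chartMetricL I x₀ (extChartAt I x₀ (γ s)))
      (fderiv ℝ (chartMetricL I x₀) (extChartAt I x₀ (γ t))
        (deriv (fun s => extChartAt I x₀ (γ s)) t)) t := by
    have := HasFDerivAt.comp_hasDerivAt (l := chartMetricL I x₀)
      (f := fun s => extChartAt I x₀ (γ s)) t
      (differentiableAt_chartMetricL htar).hasFDerivAt hc
    exact this
  refine HasDerivAt.congr_of_eventuallyEq ?_ heq
  convert! (hG.clm_apply hc').clm_apply hc' using 1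
  simp only [geodesicDefect] at hdef
  simp only [ContinuousLinearMap.add_apply]
  have hsym := fun v w => chartMetric_comm (I := I) x₀ (extChartAt I x₀ (γ t)) v w
  simp only [← chartMetricL_apply] at hsym
  rw [hsym (deriv (fun s => extChartAt I x₀ (γ s)) t)]
  linarith

theorem sqSpeed_eq {γ : ℝ → M} {a b : ℝ} (h : ∀ t ∈ Ioo a b, IsGeodesicAt I γ t) {s t : ℝ}
    (hs : s ∈ Ioo a b) (ht : t ∈ Ioo a b) : sqSpeed I γ s = sqSpeed I γ t := by
  have hd : ∀ u ∈ Ioo a b, HasDerivAt (sqSpeed I γ) 0 u := fun u hu =>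
    hasDerivAt_sqSpeed (by filter_upwards [isOpen_Ioo.mem_nhds hu] with v hv using h v hv)
  refine isOpen_Ioo.is_const_of_deriv_eq_zero isPreconnected_Ioo
    (fun u hu => (hd u hu).differentiableAt.differentiableWithinAt) (fun u hu => (hd u hu).deriv)
    hs ht

end Geodesic

/-! ### Integral solutions and derivatives -/

section IntegralSolution

universe u

variable {F : Type u} [NormedAddCommGroup F] [NormedSpace ℝ F] [CompleteSpace F]

theorem isIntegralSolution_iff {f : F → F} {Ω : Set F} (hf : ContinuousOn f Ω) {τ : ℝ} {y : F}
    {c : C(Icc (-1 : ℝ) 1, F)} (hc : ∀ s, c s ∈ Ω) :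
    IsIntegralSolution f τ y c ↔ ∀ s : Icc (-1 : ℝ) 1,
      c s = y + τ • ∫ t in (0 : ℝ)..s, f (IccExtend (by norm_num : (-1 : ℝ) ≤ 1) c t) := by
  have key : ∀ s : Icc (-1 : ℝ) 1, (c - constCurve y - τ • integrationOp (superposition f c)) s =
      c s - y - τ • ∫ t in (0 : ℝ)..s, f (IccExtend (by norm_num : (-1 : ℝ) ≤ 1) c t) := by
    intro s
    simp only [ContinuousMap.sub_apply, constCurve_apply, ContinuousMap.smul_apply,
      integrationOp_apply]
    congr 3
    funext t
    simp only [IccExtend, Function.comp, superposition_apply hf hc]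
  constructor
  · intro h s
    have := key s
    rw [IsIntegralSolution] at h
    rw [h, ContinuousMap.zero_apply, sub_sub, eq_comm, sub_eq_zero] at this
    exact this
  · intro h
    ext s
    rw [key s, ContinuousMap.zero_apply, sub_sub, sub_eq_zero]
    exact h s

theorem IsIntegralSolution.hasDerivAt {f : F → F} {Ω : Set F} (hf : ContinuousOn f Ω) {τ : ℝ}
    {y : F} {c : C(Icc (-1 : ℝ) 1, F)} (hc : ∀ s, c s ∈ Ω) (h : IsIntegralSolution f τ y c) :
    c ⟨0, by norm_num⟩ = y ∧ ∀ s ∈ Ioo (-1 : ℝ) 1,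
      HasDerivAt (IccExtend (by norm_num : (-1 : ℝ) ≤ 1) c)
        (τ • f (IccExtend (by norm_num : (-1 : ℝ) ≤ 1) c s)) s := by
  rw [isIntegralSolution_iff hf hc] at h
  refine ⟨by simpa using h ⟨0, by norm_num⟩, fun s hs => ?_⟩
  have hcont : Continuous fun t => f (IccExtend (by norm_num : (-1 : ℝ) ≤ 1) c t) :=
    hf.comp_continuous c.continuous.Icc_extend' fun t => hc _
  have h1 := ((intervalIntegral.integral_hasDerivAt_right (hcont.intervalIntegrable 0 s)
    (hcont.stronglyMeasurableAtFilter _ _) hcont.continuousAt).const_smul τ).const_add y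
  refine h1.congr_of_eventuallyEq ?_
  filter_upwards [Icc_mem_nhds hs.1 hs.2] with t ht
  rw [IccExtend_of_mem _ _ ht]
  exact h ⟨t, ht⟩

theorem isIntegralSolution_of_hasDerivAt {f : F → F} {Ω : Set F} (hf : ContinuousOn f Ω) {τ : ℝ}
    {d : ℝ → F} (hd : ∀ s ∈ Icc (-1 : ℝ) 1, HasDerivAt d (τ • f (d s)) s)
    (hΩ : ∀ s ∈ Icc (-1 : ℝ) 1, d s ∈ Ω) {c : C(Icc (-1 : ℝ) 1, F)} (hc : ∀ s, c s = d s) :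
    IsIntegralSolution f τ (d 0) c := by
  have hcΩ : ∀ s, c s ∈ Ω := fun s => by rw [hc]; exact hΩ s s.2
  rw [isIntegralSolution_iff hf hcΩ]
  intro s
  have hsub : uIcc 0 (s : ℝ) ⊆ Icc (-1) 1 :=
    uIcc_subset_Icc (by norm_num) s.2
  have hcont : Continuous fun t => f (IccExtend (by norm_num : (-1 : ℝ) ≤ 1) c t) :=
    hf.comp_continuous c.continuous.Icc_extend' fun t => hcΩ _
  have h1 := intervalIntegral.integral_eq_sub_of_hasDerivAt (f := d)
    (f' := fun t => τ • f (IccExtend (by norm_num : (-1 : ℝ) ≤ 1) c t)) (a := 0) (b := s) (fun t ht => by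
      have := hd t (hsub ht)
      rw [IccExtend_of_mem _ _ (hsub ht), hc]
      exact this) ((hcont.const_smul τ).intervalIntegrable _ _)
  rw [intervalIntegral.integral_smul] at h1
  rw [h1, hc]
  abel

end IntegralSolution

/-! ### Short geodesics in a chart -/

section ShortGeodesics

set_option linter.unusedSectionVars false

/-- A second order equation with homogeneous right-hand side has a unique short solution on
`[-1, 1]` with small initial velocity, depending smoothly on the initial data. -/
theorem exists_short_solutions {E : Type*} [NormedAddCommGroup E] [NormedSpace ℝ E]
    [CompleteSpace E] {a : E × E → E} {Ω : Set E} (hΩ : IsOpen Ω)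
    (ha : ContDiffOn ℝ ∞ a (Ω ×ˢ univ))
    (hhom : ∀ (y u : E) (r : ℝ), a (y, r • u) = r ^ 2 • a (y, u)) {y₀ : E} (hy₀ : y₀ ∈ Ω) :
    ∃ (P : Set (E × E)) (σ : E × E → ℝ → E) (δ : ℝ), IsOpen P ∧ (y₀, 0) ∈ P ∧ 0 < δ ∧
      (∀ s ∈ Icc (-1 : ℝ) 1, ContDiffOn ℝ ∞ (fun z => σ z s) P) ∧
      (∀ z ∈ P, ∃ om : ℝ → E, σ z 0 = z.1 ∧ om 0 = z.2 ∧ ∀ s ∈ Ioo (-1 : ℝ) 1, σ z s ∈ Ω ∧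
        HasDerivAt (σ z) (om s) s ∧ HasDerivAt om (a (σ z s, om s)) s) ∧
      (∀ z ∈ P, ∀ κ om : ℝ → E, κ 0 = z.1 → om 0 = z.2 → (∀ s ∈ Icc (-1 : ℝ) 1, κ s ∈ Ω ∧
        HasDerivAt κ (om s) s ∧ HasDerivAt om (a (κ s, om s)) s ∧ dist (κ s) y₀ < δ ∧ ‖om s‖ < δ) →
        ∀ s ∈ Icc (-1 : ℝ) 1, κ s = σ z s) ∧
      (HasFDerivAt (fun z => σ z (1 / 2)) (ContinuousLinearMap.fst ℝ E E +
        (1 / 2 : ℝ) • ContinuousLinearMap.snd ℝ E E) (y₀, 0)) := by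
  let f : E × E → E × E := fun p => (p.2, a p)
  have hO : IsOpen (Ω ×ˢ (univ : Set E)) := hΩ.prod isOpen_univ
  have hf : ContDiffOn ℝ ((⊤ : ℕ∞) : WithTop ℕ∞) f (Ω ×ˢ univ) := contDiffOn_snd.prodMk ha
  obtain ⟨O, c, δ, hOo, hO0, hδ, hcs, hsol, huniq⟩ := exists_localFlow (n := ⊤) le_top hO hf
    (y₀ := (y₀, (0 : E))) ⟨hy₀, mem_univ _⟩
  obtain ⟨τ, hτ, hτ1, hτO⟩ : ∃ τ : ℝ, 0 < τ ∧ τ ≤ 1 ∧ (τ, (y₀, (0 : E))) ∈ O := by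
    have h1 : Tendsto (fun τ : ℝ => (τ, (y₀, (0 : E)))) (𝓝[>] 0) (𝓝 (0, (y₀, 0))) :=
      (Continuous.tendsto (by fun_prop) _).mono_left nhdsWithin_le_nhds
    have h2 := (h1.eventually (hOo.mem_nhds hO0)).and (Ioo_mem_nhdsGT (zero_lt_one' ℝ))
    obtain ⟨τ, h3, h4⟩ := h2.exists
    exact ⟨τ, h4.1, h4.2.le, h3⟩
  let ι : E × E → ℝ × (E × E) := fun z => (τ, (z.1, τ⁻¹ • z.2))
  have hι : ContDiff ℝ ∞ ι := by fun_prop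
  let P : Set (E × E) := ι ⁻¹' O
  have hP : IsOpen P := hOo.preimage hι.continuous
  let σ : E × E → ℝ → E := fun z s => (IccExtend (by norm_num : (-1 : ℝ) ≤ 1) (c (ι z)) s).1
  have hP0 : (y₀, (0 : E)) ∈ P := by
    change (τ, (y₀, τ⁻¹ • (0 : E))) ∈ O
    rwa [smul_zero]
  have hsm : ∀ s ∈ Icc (-1 : ℝ) 1, ContDiffOn ℝ ∞ (fun z => σ z s) P := by
    intro s hs
    let ev : C(Icc (-1 : ℝ) 1, E × E) →L[ℝ] E :=
      (ContinuousLinearMap.fst ℝ E E).comp (ContinuousMap.evalCLM ℝ ⟨s, hs⟩)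
    have h1 : ContDiffOn ℝ ∞ (fun z => ev (c (ι z))) P :=
      ev.contDiff.comp_contDiffOn (hcs.comp hι.contDiffOn fun z hz => hz)
    refine h1.congr fun z _ => ?_
    simp only [σ, IccExtend_of_mem _ _ hs]
    rfl
  have hex : ∀ z ∈ P, ∃ om : ℝ → E, σ z 0 = z.1 ∧ om 0 = z.2 ∧ ∀ s ∈ Ioo (-1 : ℝ) 1, σ z s ∈ Ω ∧
      HasDerivAt (σ z) (om s) s ∧ HasDerivAt om (a (σ z s, om s)) s ∧ dist (σ z s) y₀ < δ ∧
        ‖om s‖ < τ * δ := by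
    intro z hz
    obtain ⟨h1, h2⟩ := hsol _ hz
    obtain ⟨h3, h4⟩ := h2.hasDerivAt hf.continuousOn (fun s => (h1 s).1)
    set C := IccExtend (by norm_num : (-1 : ℝ) ≤ 1) (c (ι z)) with hC
    have hC0 : C 0 = (z.1, τ⁻¹ • z.2) := by
      rw [hC, IccExtend_of_mem _ _ (by norm_num : (0 : ℝ) ∈ Icc (-1 : ℝ) 1)]
      exact h3
    refine ⟨fun s => τ • (C s).2, by simp [σ, ← hC, hC0], by simp [hC0, hτ.ne'], fun s hs => ?_⟩
    have h5 := h4 s hs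
    have hbd := (h1 (projIcc (-1) 1 (by norm_num) s)).2
    have hCs : C s = c (ι z) (projIcc (-1) 1 (by norm_num) s) := rfl
    rw [← hCs, Prod.dist_eq, max_lt_iff] at hbd
    refine ⟨(h1 _).1.1, h5.fst, ?_, hbd.1, ?_⟩
    · have h6 := (show HasDerivAt (fun s => (C s).2) (τ • f (C s)).2 s from h5.snd).const_smul τ
      rw [hhom, sq, mul_smul]
      exact h6
    · rw [norm_smul, Real.norm_of_nonneg hτ.le]
      have := hbd.2
      rw [dist_zero_right] at this
      exact mul_lt_mul_of_pos_left this hτ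
  have hun : ∀ z ∈ P, ∀ κ om : ℝ → E, κ 0 = z.1 → om 0 = z.2 → (∀ s ∈ Icc (-1 : ℝ) 1, κ s ∈ Ω ∧
      HasDerivAt κ (om s) s ∧ HasDerivAt om (a (κ s, om s)) s ∧ dist (κ s) y₀ < δ ∧ ‖om s‖ < τ * δ) →
      ∀ s ∈ Icc (-1 : ℝ) 1, κ s = σ z s := by
    intro z hz κ om hκ0 hom0 h s hs
    let d : ℝ → E × E := fun s => (κ s, τ⁻¹ • om s)
    have hd : ∀ s ∈ Icc (-1 : ℝ) 1, HasDerivAt d (τ • f (d s)) s := by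
      intro s hs
      obtain ⟨-, h1, h2, -⟩ := h s hs
      have h3 := h1.prodMk (h2.const_smul τ⁻¹)
      convert! h3 using 1
      simp only [f, d, Prod.smul_mk, hhom, smul_smul, mul_inv_cancel₀ hτ.ne', one_smul]
      rw [sq, ← mul_assoc, mul_inv_cancel₀ hτ.ne', one_mul]
    let e : C(Icc (-1 : ℝ) 1, E × E) := ⟨fun s => d s, by
      rw [continuous_iff_continuousAt]
      exact fun s => (hd s s.2).continuousAt.comp continuous_subtype_val.continuousAt⟩
    have he : IsIntegralSolution f τ (d 0) e := isIntegralSolution_of_hasDerivAt hf.continuousOn hd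
      (fun s hs => ⟨(h s hs).1, mem_univ _⟩) (fun s => rfl)
    have hd0 : d 0 = (ι z).2 := by simp [d, ι, hκ0, hom0]
    rw [hd0] at he
    have h4 := huniq _ hz e (fun s => by
      obtain ⟨-, -, -, h1, h2⟩ := h s s.2
      rw [Prod.dist_eq, max_lt_iff]
      refine ⟨h1, ?_⟩
      rw [dist_zero_right]
      change ‖τ⁻¹ • om s‖ < δ
      rw [norm_smul, norm_inv, Real.norm_of_nonneg hτ.le, inv_mul_lt_iff₀ hτ]
      exact h2) he
    have h5 := congr($h4 ⟨s, hs⟩)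
    simp only [σ, IccExtend_of_mem _ _ hs]
    rw [← h5]
    rfl
  refine ⟨P, σ, τ * δ, hP, hP0, by positivity, hsm, fun z hz => ?_, fun z hz κ om h1 h2 h => ?_, ?_⟩
  · obtain ⟨om, h1, h2, h3⟩ := hex z hz
    exact ⟨om, h1, h2, fun s hs => ⟨(h3 s hs).1, (h3 s hs).2.1, (h3 s hs).2.2.1⟩⟩
  · refine hun z hz κ om h1 h2 fun s hs => ?_
    obtain ⟨h3, h4, h5, h6, h7⟩ := h s hs
    exact ⟨h3, h4, h5, h6.trans_le (mul_le_of_le_one_left hδ.le hτ1), h7⟩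
  · have hhalf : (1 / 2 : ℝ) ∈ Icc (-1 : ℝ) 1 := by norm_num
    have hD := ((hsm _ hhalf).contDiffAt (hP.mem_nhds hP0)).differentiableAt (by simp) |>.hasFDerivAt
    set D := fderiv ℝ (fun z => σ z (1 / 2)) (y₀, 0)
    have hDfst : ∀ h : E, D (h, 0) = h := by
      intro h
      have h1 : HasDerivAt (fun r : ℝ => ((y₀ + r • h, 0) : E × E)) (h, 0) 0 := by
        have := (((hasDerivAt_id (0 : ℝ)).smul_const h).const_add y₀).prodMk
          (hasDerivAt_const (0 : ℝ) (0 : E))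
        simpa using this
      have h2 := HasFDerivAt.comp_hasDerivAt (l := fun z => σ z (1 / 2)) (f' := (h, (0 : E))) (0 : ℝ)
        (by simpa using hD) h1
      have h3 : (fun z => σ z (1 / 2)) ∘ (fun r : ℝ => ((y₀ + r • h, 0) : E × E)) =ᶠ[𝓝 0]
          fun r => y₀ + r • h := by
        have hc : ContinuousAt (fun r : ℝ => ((y₀ + r • h, 0) : E × E)) 0 := h1.continuousAt
        have hc' : ContinuousAt (fun r : ℝ => y₀ + r • h) 0 := by fun_prop
        filter_upwards [hc.eventually (hP.mem_nhds (by simpa using hP0)),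
          hc'.eventually (hΩ.mem_nhds (by simpa using hy₀)),
          hc'.eventually (Metric.ball_mem_nhds _ hδ)] with r hr hr' hr''
        refine (hun _ hr (fun _ => y₀ + r • h) (fun _ => 0) rfl rfl (fun s _ => ?_) _ hhalf).symm
        have ha0 : a (y₀ + r • h, 0) = 0 := by
          have := hhom (y₀ + r • h) 0 0
          simpa using this
        refine ⟨hr', hasDerivAt_const _ _, ?_, by simpa using hr'', by simpa using by positivity⟩
        rw [ha0]
        exact hasDerivAt_const _ _
      have h4 : HasDerivAt (fun r : ℝ => y₀ + r • h) h 0 := by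
        simpa using ((hasDerivAt_id (0 : ℝ)).smul_const h).const_add y₀
      exact (h2.congr_of_eventuallyEq h3.symm).unique h4
    have hDsnd : ∀ v : E, D (0, v) = (1 / 2 : ℝ) • v := by
      have hsmall : ∀ v : E, (y₀, v) ∈ P → D (0, v) = (1 / 2 : ℝ) • v := by
        intro v hv
        obtain ⟨om, h1, h2, h3⟩ := hex _ hv
        have h4 : HasDerivAt (fun r : ℝ => ((y₀, r • v) : E × E)) (0, v) 0 := by
          have := (hasDerivAt_const (0 : ℝ) y₀).prodMk ((hasDerivAt_id (0 : ℝ)).smul_const v)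
          simpa using this
        have h5 := HasFDerivAt.comp_hasDerivAt (l := fun z => σ z (1 / 2)) (f' := ((0 : E), v))
          (0 : ℝ) (by simpa using hD) h4
        have h6 : (fun z => σ z (1 / 2)) ∘ (fun r : ℝ => ((y₀, r • v) : E × E)) =ᶠ[𝓝 0]
            fun r => σ (y₀, v) (r * (1 / 2)) := by
          filter_upwards [h4.continuousAt.eventually (hP.mem_nhds (by simpa using hP0)),
            Ioo_mem_nhds (by norm_num : (-1 : ℝ) < 0) (by norm_num : (0 : ℝ) < 1)] with r hr hr'
          refine (hun _ hr (fun s => σ (y₀, v) (r * s)) (fun s => r • om (r * s)) (by simpa using h1)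
            (by simp [h2]) (fun s hs => ?_) _ hhalf).symm
          have hrs : r * s ∈ Ioo (-1 : ℝ) 1 := by
            rw [mem_Ioo, ← abs_lt, abs_mul]
            calc |r| * |s| ≤ |r| * 1 := by gcongr; exact abs_le.2 hs
              _ < 1 := by rw [mul_one]; exact abs_lt.2 hr'
          obtain ⟨g1, g2, g3, g4, g5⟩ := h3 _ hrs
          have hm : HasDerivAt (fun s : ℝ => r * s) r s := by
            simpa using (hasDerivAt_id s).const_mul r
          refine ⟨g1, g2.scomp s hm, ?_, g4, ?_⟩
          · rw [hhom, sq, mul_smul]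
            exact (g3.scomp s hm).const_smul r
          · rw [norm_smul]
            refine lt_of_le_of_lt ?_ g5
            exact mul_le_of_le_one_left (norm_nonneg _) (abs_lt.2 hr').le
        have h7 : HasDerivAt (fun r : ℝ => σ (y₀, v) (r * (1 / 2))) ((1 / 2 : ℝ) • v) 0 := by
          have hm : HasDerivAt (fun r : ℝ => r * (1 / 2)) (1 / 2) 0 := by
            simpa using (hasDerivAt_id (0 : ℝ)).mul_const (1 / 2)
          have := (h3 (0 * (1 / 2)) (by norm_num)).2.1.scomp (0 : ℝ) hm
          rw [zero_mul, h2] at this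
          exact this
        exact (h5.congr_of_eventuallyEq h6.symm).unique h7
      intro v
      have hc : Tendsto (fun r : ℝ => ((y₀, r • v) : E × E)) (𝓝[>] 0) (𝓝 (y₀, 0)) := by
        have : Continuous (fun r : ℝ => ((y₀, r • v) : E × E)) := by fun_prop
        have := this.tendsto 0
        rw [zero_smul] at this
        exact this.mono_left nhdsWithin_le_nhds
      obtain ⟨r, hr, hr0⟩ := ((hc.eventually (hP.mem_nhds hP0)).and self_mem_nhdsWithin).exists
      have h1 := hsmall _ hr
      have h2 : ((0 : E), r • v) = r • ((0 : E), v) := by simp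
      rw [h2, map_smul, smul_comm] at h1
      exact smul_right_injective E (ne_of_gt hr0) h1
    convert! hD using 1
    ext v
    · simp [hDfst]
    · simp [hDsnd]

end ShortGeodesics

/-! ### Short geodesics, uniformly -/

section GeodesicsOnManifold

set_option linter.unusedSectionVars false

variable {E : Type*} [NormedAddCommGroup E] [NormedSpace ℝ E] [FiniteDimensional ℝ E]
  {H : Type*} [TopologicalSpace H] {I : ModelWithCorners ℝ E H} [I.Boundaryless]
  {M : Type*} [EMetricSpace M] [ChartedSpace H M] [IsManifold I ∞ M]
  [RiemannianBundle (fun x : M => TangentSpace I x)]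
  [IsContMDiffRiemannianBundle I ∞ E (fun x : M => TangentSpace I x)]

theorem isContinuousRiemannianBundle_of_contMDiff :
    IsContinuousRiemannianBundle E (fun x : M => TangentSpace I x) := by
  obtain ⟨g, hg, h⟩ := IsContMDiffRiemannianBundle.exists_contMDiff (IB := I) (n := ∞) (F := E)
    (E := fun x : M => TangentSpace I x)
  exact ⟨g, hg.continuous, h⟩

attribute [local instance] isContinuousRiemannianBundle_of_contMDiff

variable (I) in
/-- The Riemannian norm at `p` of a vector of the model space. -/
def tnorm (p : M) (a : E) : ℝ := ‖(show TangentSpace I p from a)‖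

theorem tnorm_nonneg (p : M) (a : E) : 0 ≤ tnorm I p a := norm_nonneg _

theorem tnorm_smul (p : M) (r : ℝ) (a : E) : tnorm I p (r • a) = |r| * tnorm I p a := by
  have := norm_smul r (show TangentSpace I p from a)
  rwa [Real.norm_eq_abs] at this

theorem tnorm_neg (p : M) (a : E) : tnorm I p (-a) = tnorm I p a :=
  norm_neg (show TangentSpace I p from a)

theorem tnorm_sub_le (p : M) (a b : E) : tnorm I p (a - b) ≤ tnorm I p a + tnorm I p b :=
  norm_sub_le (show TangentSpace I p from a) (show TangentSpace I p from b)

theorem tnorm_eq_zero {p : M} {a : E} : tnorm I p a = 0 ↔ a = 0 :=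
  norm_eq_zero (a := (show TangentSpace I p from a))

theorem tnorm_zero (p : M) : tnorm I p (0 : E) = 0 := tnorm_eq_zero.2 rfl

theorem tnorm_sq (p : M) (a : E) : tnorm I p a ^ 2 = metricAt I p a a := (metricAt_self p a).symm

theorem abs_metricAt_le (p : M) (a b : E) : |metricAt I p a b| ≤ tnorm I p a * tnorm I p b :=
  abs_real_inner_le_norm (show TangentSpace I p from a) (show TangentSpace I p from b)

theorem sqSpeed_eq_sq (γ : ℝ → M) (t : ℝ) : sqSpeed I γ t = tnorm I (γ t) (velocity I γ t) ^ 2 :=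
  (tnorm_sq _ _).symm

variable (I) in
theorem exists_norm_chartDeriv_le (x : M) :
    ∃ C : ℝ, 0 < C ∧ ∀ᶠ y in 𝓝 x, ∀ v : E, ‖chartDeriv I x y v‖ ≤ C * tnorm I y v := by
  obtain ⟨C, h⟩ := exists_norm_mfderiv_extChartAt_le I x
  refine ⟨C + 1, by positivity, ?_⟩
  filter_upwards [h] with y hy v
  refine (hy v).trans ?_
  have := tnorm_nonneg (I := I) y v
  change C * tnorm I y v ≤ _
  nlinarith

variable (I) in
theorem exists_tnorm_chartSymmDeriv_le (x : M) :
    ∃ C : ℝ, 0 < C ∧ ∀ᶠ y in 𝓝 (extChartAt I x x), ∀ v : E,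
      tnorm I ((extChartAt I x).symm y) (chartSymmDeriv I x y v) ≤ C * ‖v‖ := by
  obtain ⟨C, h⟩ := exists_norm_mfderiv_extChartAt_symm_le I x
  refine ⟨C + 1, by positivity, ?_⟩
  filter_upwards [h] with y hy v
  refine (hy v).trans ?_
  have := norm_nonneg v
  nlinarith

variable (I) in
theorem exists_tnorm_le_norm_chartDeriv (x : M) :
    ∃ C : ℝ, 0 < C ∧ ∀ᶠ p in 𝓝 x, ∀ v : E, tnorm I p v ≤ C * ‖chartDeriv I x p v‖ := by
  obtain ⟨C, hC, h⟩ := exists_tnorm_chartSymmDeriv_le I x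
  refine ⟨C, hC, ?_⟩
  filter_upwards [continuousAt_extChartAt (I := I) x |>.eventually h,
    extChartAt_source_mem_nhds (I := I) x] with p hp hps v
  have := hp (chartDeriv I x p v)
  rwa [chartSymmDeriv_chartDeriv hps, (extChartAt I x).left_inv hps] at this

theorem IsGeodesicAt.mdifferentiableAt {γ : ℝ → M} {t : ℝ} (h : IsGeodesicAt I γ t) :
    MDifferentiableAt 𝓘(ℝ, ℝ) I γ t := h.1.mdifferentiableAt (by simp)

variable [IsRiemannianManifold I M]

theorem edist_le_of_isGeodesicAt {γ : ℝ → M} {a b : ℝ} (h : ∀ s ∈ Ioo a b, IsGeodesicAt I γ s)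
    {s t : ℝ} (hs : s ∈ Ioo a b) (ht : t ∈ Ioo a b) :
    edist (γ s) (γ t) ≤ ENNReal.ofReal (tnorm I (γ s) (velocity I γ s) * |t - s|) := by
  wlog hst : s ≤ t generalizing s t with H
  · have := H ht hs (le_of_not_ge hst)
    have h1 := sqSpeed_eq h hs ht
    rw [sqSpeed_eq_sq, sqSpeed_eq_sq, sq_eq_sq₀ (tnorm_nonneg _ _) (tnorm_nonneg _ _)] at h1
    rwa [edist_comm, h1, abs_sub_comm]
  have hsub : Icc s t ⊆ Ioo a b := fun u hu => ⟨hs.1.trans_le hu.1, hu.2.trans_lt ht.2⟩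
  have : IsManifold I 1 M := .of_le (n := ∞) (by simp)
  have h1 := edist_le_of_norm_mfderivWithin_le I (γ := γ) hst
    (C := ⟨tnorm I (γ s) (velocity I γ s), tnorm_nonneg _ _⟩)
    (fun u hu => ((h u (hsub hu)).1.of_le (by norm_num)).contMDiffWithinAt) (fun u hu => by
      have h1 := sqSpeed_eq h (hsub ⟨hu.1.le, hu.2.le⟩) hs
      rw [sqSpeed_eq_sq, sqSpeed_eq_sq, sq_eq_sq₀ (tnorm_nonneg _ _) (tnorm_nonneg _ _)] at h1
      exact h1.le)
  refine h1.trans ?_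
  rw [ENNReal.ofReal_mul (tnorm_nonneg _ _), abs_of_nonneg (by linarith)]
  rw [ENNReal.ofReal_eq_coe_nnreal (tnorm_nonneg _ _)]
  exact le_rfl

variable (I) in
/-- Near `x₀`, the short geodesics are given in the chart by a smooth solution map `σ`. -/
theorem exists_local_geodesics (x₀ : M) :
    ∃ W ∈ 𝓝 x₀, ∃ (ρ : ℝ) (P : Set (E × E)) (σ : E × E → ℝ → E), 0 < ρ ∧
      W ⊆ (extChartAt I x₀).source ∧ IsOpen P ∧ (extChartAt I x₀ x₀, 0) ∈ P ∧
      (∀ s ∈ Icc (-1 : ℝ) 1, ContDiffOn ℝ ∞ (fun z => σ z s) P) ∧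
      (∀ z ∈ P, ∀ s ∈ Ioo (-1 : ℝ) 1, σ z s ∈ (extChartAt I x₀).target) ∧
      HasFDerivAt (fun z => σ z (1 / 2)) (ContinuousLinearMap.fst ℝ E E +
        (1 / 2 : ℝ) • ContinuousLinearMap.snd ℝ E E) (extChartAt I x₀ x₀, 0) ∧
      ∀ p ∈ W, ∀ v : E, tnorm I p v < ρ → (extChartAt I x₀ p, chartDeriv I x₀ p v) ∈ P ∧
        (∃ γ : ℝ → M, γ 0 = p ∧ velocity I γ 0 = v ∧ ∀ s ∈ Ioo (-1 : ℝ) 1, IsGeodesicAt I γ s) ∧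
        ∀ γ : ℝ → M, γ 0 = p → velocity I γ 0 = v → (∀ s ∈ Ioo (-2 : ℝ) 2, IsGeodesicAt I γ s) →
          ∀ s ∈ Icc (-1 : ℝ) 1,
            γ s = (extChartAt I x₀).symm (σ (extChartAt I x₀ p, chartDeriv I x₀ p v) s) := by
  obtain ⟨P, σ, δ, hPo, hP0, hδ, hsm, hex, hun, hD⟩ := exists_short_solutions (isOpen_target x₀)
    (contDiffOn_geodesicAccel (I := I) x₀) (fun y u r => geodesicAccel_smul x₀ y u r)
    (mem_extChartAt_target x₀)
  obtain ⟨C, hC, hCd⟩ := exists_norm_chartDeriv_le I x₀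
  have hχ := continuousAt_extChartAt (I := I) x₀
  obtain ⟨R, hR, hRsub⟩ := EMetric.mem_nhds_iff.1 (inter_mem hCd (inter_mem
    (extChartAt_source_mem_nhds (I := I) x₀) (hχ.preimage_mem_nhds (Metric.ball_mem_nhds _ hδ))))
  obtain ⟨ε, hε, hεsub⟩ := Metric.isOpen_iff.1 hPo _ hP0
  obtain ⟨R', hR'0, hR'⟩ := ENNReal.lt_iff_exists_nnreal_btwn.1 (ENNReal.half_pos hR.ne')
  have hR'pos : (0 : ℝ) < R' := by exact_mod_cast hR'0
  set ρ := min (R' : ℝ) (min (δ / C) (ε / C)) with hρdef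
  have hρ : 0 < ρ := by positivity
  have hρδ : C * ρ ≤ δ := by
    rw [← le_div_iff₀' hC]
    exact (min_le_right _ _).trans (min_le_left _ _)
  have hρε : C * ρ ≤ ε := by
    rw [← le_div_iff₀' hC]
    exact (min_le_right _ _).trans (min_le_right _ _)
  refine ⟨_, inter_mem (Metric.eball_mem_nhds x₀ (ENNReal.half_pos hR.ne'))
    (hχ.preimage_mem_nhds (Metric.ball_mem_nhds _ hε)), ρ, P, σ, hρ, ?_, hPo, hP0, hsm, ?_, hD, ?_⟩
  · intro p hp
    exact (hRsub (Metric.eball_subset_eball ENNReal.half_le_self hp.1)).2.1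
  · intro z hz s hs
    obtain ⟨om, -, -, h⟩ := hex z hz
    exact (h s hs).1
  intro p hp v hv
  have hpR := hRsub (Metric.eball_subset_eball ENNReal.half_le_self hp.1)
  have hps : p ∈ (extChartAt I x₀).source := hpR.2.1
  have hlt : ∀ q ∈ Metric.eball x₀ R, ∀ w : E, tnorm I q w < ρ → ‖chartDeriv I x₀ q w‖ < C * ρ :=
    fun q hq w hw => ((hRsub hq).1 w).trans_lt (mul_lt_mul_of_pos_left hw hC)
  have hzP : (extChartAt I x₀ p, chartDeriv I x₀ p v) ∈ P := by
    refine hεsub ?_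
    rw [Metric.mem_ball, Prod.dist_eq, max_lt_iff, dist_zero_right]
    exact ⟨hp.2, (hlt p (Metric.eball_subset_eball ENNReal.half_le_self hp.1) v hv).trans_le hρε⟩
  refine ⟨hzP, ?_, ?_⟩
  · obtain ⟨om, h0, hom0, h⟩ := hex _ hzP
    set z := (extChartAt I x₀ p, chartDeriv I x₀ p v) with hz
    have hg : ∀ s ∈ Ioo (-1 : ℝ) 1, IsGeodesicAt I (fun s => (extChartAt I x₀).symm (σ z s)) s := by
      intro s hs
      have hn := isOpen_Ioo.mem_nhds hs
      exact isGeodesicAt_of_hasDerivAt (by filter_upwards [hn] with u hu using (h u hu).2.1)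
        (by filter_upwards [hn] with u hu using (h u hu).2.2) (h s hs).1
    have h01 : (0 : ℝ) ∈ Ioo (-1 : ℝ) 1 := by norm_num
    have hγ0 : (extChartAt I x₀).symm (σ z 0) = p := by
      rw [h0, hz, (extChartAt I x₀).left_inv hps]
    refine ⟨_, hγ0, ?_, hg⟩
    have h1 := deriv_extChartAt_comp (hg 0 h01).mdifferentiableAt (x₀ := x₀)
      (by rw [hγ0]; exact hps)
    have h2 : (fun s => extChartAt I x₀ ((extChartAt I x₀).symm (σ z s))) =ᶠ[𝓝 0] σ z := by
      filter_upwards [isOpen_Ioo.mem_nhds h01] with s hs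
      exact (extChartAt I x₀).right_inv (h s hs).1
    rw [h2.deriv_eq, (h 0 h01).2.1.deriv, hom0, hγ0] at h1
    have h3 := congr(chartSymmDeriv I x₀ (extChartAt I x₀ p) $h1)
    rw [chartSymmDeriv_chartDeriv hps, chartSymmDeriv_chartDeriv hps] at h3
    exact h3.symm
  · intro γ hγ0 hγv hg
    have h02 : (0 : ℝ) ∈ Ioo (-2 : ℝ) 2 := by norm_num
    have hsub : ∀ s ∈ Icc (-1 : ℝ) 1, s ∈ Ioo (-2 : ℝ) 2 := fun s hs =>
      ⟨by linarith [hs.1], by linarith [hs.2]⟩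
    have hin : ∀ s ∈ Icc (-1 : ℝ) 1, γ s ∈ Metric.eball x₀ R := by
      intro s hs
      have h1 := edist_le_of_isGeodesicAt hg h02 (hsub s hs)
      rw [sub_zero] at h1
      have h2 : edist (γ 0) (γ s) ≤ R' := by
        refine h1.trans ?_
        rw [← ENNReal.ofReal_coe_nnreal]
        refine ENNReal.ofReal_le_ofReal ?_
        rw [hγ0, hγv]
        calc tnorm I p v * |s| ≤ tnorm I p v * 1 := by
              gcongr
              · exact tnorm_nonneg _ _
              · exact abs_le.2 hs
          _ ≤ R' := by rw [mul_one]; exact hv.le.trans (min_le_left _ _)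
      rw [Metric.mem_eball]
      calc edist (γ s) x₀ ≤ edist (γ s) (γ 0) + edist (γ 0) x₀ := edist_triangle _ _ _
        _ < R / 2 + R / 2 := by
            refine ENNReal.add_lt_add ?_ ?_
            · rw [edist_comm]
              exact h2.trans_lt hR'
            · rw [hγ0]; exact hp.1
        _ = R := ENNReal.add_halves _
    intro s hs
    have hder0 : deriv (fun s => extChartAt I x₀ (γ s)) 0 = chartDeriv I x₀ p v := by
      rw [deriv_extChartAt_comp (hg 0 h02).mdifferentiableAt (by rw [hγ0]; exact hps), hγ0, hγv]
    have := hun _ hzP (fun s => extChartAt I x₀ (γ s)) (deriv fun s => extChartAt I x₀ (γ s))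
      (by rw [hγ0]) hder0 (fun u hu => by
        have hgu := hg u (hsub u hu)
        have hRu := hRsub (hin u hu)
        have hd := hgu.hasDerivAt hRu.2.1
        refine ⟨(extChartAt I x₀).map_source hRu.2.1, hd.1, hd.2, hRu.2.2, ?_⟩
        rw [deriv_extChartAt_comp hgu.mdifferentiableAt hRu.2.1]
        refine (hlt _ (hin u hu) _ ?_).trans_le hρδ
        have h1 := sqSpeed_eq hg (hsub u hu) h02
        rw [sqSpeed_eq_sq, sqSpeed_eq_sq, sq_eq_sq₀ (tnorm_nonneg _ _) (tnorm_nonneg _ _), hγ0,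
          hγv] at h1
        rw [h1]
        exact hv) s hs
    rw [← this]
    exact ((extChartAt I x₀).left_inv (hRsub (hin s hs)).2.1).symm

variable (I M) in
/-- On a compact manifold, short geodesics exist and are unique for a uniform time. -/
theorem exists_uniform_geodesics [CompactSpace M] : ∃ ρ : ℝ, 0 < ρ ∧ ∀ (p : M) (v : E),
    tnorm I p v < ρ →
      (∃ γ : ℝ → M, γ 0 = p ∧ velocity I γ 0 = v ∧ ∀ s ∈ Ioo (-1 : ℝ) 1, IsGeodesicAt I γ s) ∧
      ∀ γ γ' : ℝ → M, γ 0 = p → velocity I γ 0 = v → (∀ s ∈ Ioo (-2 : ℝ) 2, IsGeodesicAt I γ s) →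
        γ' 0 = p → velocity I γ' 0 = v → (∀ s ∈ Ioo (-2 : ℝ) 2, IsGeodesicAt I γ' s) →
          ∀ s ∈ Icc (-1 : ℝ) 1, γ s = γ' s := by
  choose W hW ρ P σ hρ _ _ _ _ _ _ h using exists_local_geodesics (I := I) (M := M)
  obtain ⟨t, ht⟩ := CompactSpace.elim_nhds_subcover W hW
  rcases isEmpty_or_nonempty M with hM | ⟨⟨x₀⟩⟩
  · exact ⟨1, one_pos, fun p => (IsEmpty.false p).elim⟩
  have htne : t.Nonempty := by
    have : x₀ ∈ ⋃ x ∈ t, W x := ht ▸ mem_univ x₀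
    simp only [mem_iUnion] at this
    obtain ⟨x, hx, -⟩ := this
    exact ⟨x, hx⟩
  refine ⟨t.inf' htne ρ, (Finset.lt_inf'_iff _).2 fun x _ => hρ x, fun p v hv => ?_⟩
  have : p ∈ ⋃ x ∈ t, W x := ht ▸ mem_univ p
  simp only [mem_iUnion] at this
  obtain ⟨x, hx, hpx⟩ := this
  obtain ⟨-, h1, h2⟩ := h x p hpx v (hv.trans_le (Finset.inf'_le _ hx))
  refine ⟨h1, fun γ γ' a b c a' b' c' s hs => ?_⟩
  rw [h2 γ a b c s hs, h2 γ' a' b' c' s hs]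

end GeodesicsOnManifold

/-! ### Completeness and the exponential map -/

section Exponential

set_option linter.unusedSectionVars false

variable {E : Type*} [NormedAddCommGroup E] [NormedSpace ℝ E] [FiniteDimensional ℝ E]
  {H : Type*} [TopologicalSpace H] {I : ModelWithCorners ℝ E H} [I.Boundaryless]
  {M : Type*} [EMetricSpace M] [ChartedSpace H M] [IsManifold I ∞ M]
  [RiemannianBundle (fun x : M => TangentSpace I x)]
  [IsContMDiffRiemannianBundle I ∞ E (fun x : M => TangentSpace I x)]
  [IsRiemannianManifold I M]

attribute [local instance] isContinuousRiemannianBundle_of_contMDiff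

theorem IsGeodesicAt.comp_affine_of_Ioo {γ : ℝ → M} {a b c d : ℝ}
    (h : ∀ s ∈ Ioo c d, IsGeodesicAt I γ s) {t : ℝ} (ht : a * t + b ∈ Ioo c d) :
    IsGeodesicAt I (fun s => γ (a * s + b)) t :=
  IsGeodesicAt.comp_affine (by filter_upwards [isOpen_Ioo.mem_nhds ht] with s hs using h s hs)

/-- A uniform existence and uniqueness statement for short geodesics. -/
def UniformGeodesics (I : ModelWithCorners ℝ E H) (M : Type*) [EMetricSpace M] [ChartedSpace H M]
    [RiemannianBundle (fun x : M => TangentSpace I x)] (ρ : ℝ) : Prop :=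
  0 < ρ ∧ ∀ (p : M) (v : E), tnorm I p v < ρ →
      (∃ γ : ℝ → M, γ 0 = p ∧ velocity I γ 0 = v ∧ ∀ s ∈ Ioo (-1 : ℝ) 1, IsGeodesicAt I γ s) ∧
      ∀ γ γ' : ℝ → M, γ 0 = p → velocity I γ 0 = v → (∀ s ∈ Ioo (-2 : ℝ) 2, IsGeodesicAt I γ s) →
        γ' 0 = p → velocity I γ' 0 = v → (∀ s ∈ Ioo (-2 : ℝ) 2, IsGeodesicAt I γ' s) →
          ∀ s ∈ Icc (-1 : ℝ) 1, γ s = γ' s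

/-- Geodesics with the same short initial velocity agree on `|s| ≤ 1/8`, if they are defined for
`|s| < 1/4`. -/
theorem UniformGeodesics.unique {ρ : ℝ} (h : UniformGeodesics I M ρ) {p : M} {v : E}
    (hv : tnorm I p v < ρ) {γ γ' : ℝ → M} (h0 : γ 0 = p) (hγv : velocity I γ 0 = v)
    (hγ : ∀ s ∈ Ioo (-(1 / 4) : ℝ) (1 / 4), IsGeodesicAt I γ s) (h0' : γ' 0 = p)
    (hγv' : velocity I γ' 0 = v) (hγ' : ∀ s ∈ Ioo (-(1 / 4) : ℝ) (1 / 4), IsGeodesicAt I γ' s)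
    {s : ℝ} (hs : s ∈ Icc (-(1 / 8) : ℝ) (1 / 8)) : γ s = γ' s := by
  have key : ∀ δ : ℝ → M, δ 0 = p → velocity I δ 0 = v →
      (∀ s ∈ Ioo (-(1 / 4) : ℝ) (1 / 4), IsGeodesicAt I δ s) →
      δ ((1 / 8) * 0 + 0) = p ∧ velocity I (fun s => δ ((1 / 8) * s + 0)) 0 = (1 / 8 : ℝ) • v ∧
      ∀ s ∈ Ioo (-2 : ℝ) 2, IsGeodesicAt I (fun s => δ ((1 / 8) * s + 0)) s := by
    intro δ h0 hv hδ
    refine ⟨by simpa using h0, ?_, fun s hs => IsGeodesicAt.comp_affine_of_Ioo hδ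
      ⟨by linarith [hs.1], by linarith [hs.2]⟩⟩
    rw [velocity_comp_affine]
    · norm_num [hv]
    · exact (hδ _ (by norm_num)).mdifferentiableAt
  obtain ⟨a, b, c⟩ := key γ h0 hγv hγ
  obtain ⟨a', b', c'⟩ := key γ' h0' hγv' hγ'
  have hv' : tnorm I p ((1 / 8 : ℝ) • v) < ρ := by
    rw [tnorm_smul, abs_of_pos (by norm_num)]
    have := tnorm_nonneg (I := I) p v
    linarith
  have := (h.2 p _ hv').2 _ _ a b c a' b' c' (8 * s) ⟨by linarith [hs.1], by linarith [hs.2]⟩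
  have h8 : (1 / 8 : ℝ) * (8 * s) + 0 = s := by ring
  rwa [h8] at this

/-- Existence of geodesic rays. -/
theorem UniformGeodesics.exists_ray {ρ : ℝ} (h : UniformGeodesics I M ρ) {p : M} {v : E}
    (hv : tnorm I p v < ρ) : ∃ γ : ℝ → M, γ 0 = p ∧ velocity I γ 0 = v ∧
      ∀ s, -1 < s → IsGeodesicAt I γ s := by
  have hseg : ∀ (p : M) (v : E), ∃ γ : ℝ → M, tnorm I p v < ρ → γ 0 = p ∧ velocity I γ 0 = v ∧
      ∀ s ∈ Ioo (-1 : ℝ) 1, IsGeodesicAt I γ s := by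
    intro p v
    by_cases hv : tnorm I p v < ρ
    · obtain ⟨γ, hγ⟩ := (h.2 p v hv).1
      exact ⟨γ, fun _ => hγ⟩
    · exact ⟨fun _ => p, fun h => (hv h).elim⟩
  choose seg hseg using hseg
  let st : ℕ → M × E := fun n => Nat.rec (p, v)
    (fun _ q => (seg q.1 q.2 (1 / 2), velocity I (seg q.1 q.2) (1 / 2))) n
  have hst : ∀ n, st (n + 1) =
      (seg (st n).1 (st n).2 (1 / 2), velocity I (seg (st n).1 (st n).2) (1 / 2)) := fun n => rfl
  have hsp : ∀ n, tnorm I (st n).1 (st n).2 < ρ := by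
    intro n
    induction n with
    | zero => exact hv
    | succ n ih =>
      obtain ⟨h0, h1, h2⟩ := hseg _ _ ih
      have h3 := sqSpeed_eq h2 (by norm_num : (0 : ℝ) ∈ Ioo (-1 : ℝ) 1)
        (by norm_num : (1 / 2 : ℝ) ∈ Ioo (-1 : ℝ) 1)
      rw [sqSpeed_eq_sq, sqSpeed_eq_sq, sq_eq_sq₀ (tnorm_nonneg _ _) (tnorm_nonneg _ _), h0, h1]
        at h3
      rw [hst]
      exact h3 ▸ ih
  let sg : ℕ → ℝ → M := fun n => seg (st n).1 (st n).2
  have hov : ∀ n, ∀ t ∈ Icc (-(1 / 8) : ℝ) (1 / 8), sg n (t + 1 / 2) = sg (n + 1) t := by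
    intro n t ht
    obtain ⟨h0, h1, h2⟩ := hseg _ _ (hsp n)
    obtain ⟨h0', h1', h2'⟩ := hseg _ _ (hsp (n + 1))
    have := h.unique (hsp (n + 1)) (γ := fun t => sg n (1 * t + 1 / 2)) (γ' := sg (n + 1)) (by
        simp [hst, sg]) (by
        rw [velocity_comp_affine]
        · simp [hst, sg]
        · exact (h2 _ (by norm_num)).mdifferentiableAt) (fun s hs =>
        IsGeodesicAt.comp_affine_of_Ioo h2 ⟨by linarith [hs.1], by linarith [hs.2]⟩)
        h0' h1' (fun s hs => h2' s ⟨by linarith [hs.1], by linarith [hs.2]⟩) ht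
    rwa [one_mul] at this
  let γ : ℝ → M := fun t => sg ⌊2 * t⌋₊ (t - ⌊2 * t⌋₊ / 2)
  have hγn : ∀ (n : ℕ) (t : ℝ), (n : ℝ) / 2 - 1 / 8 ≤ t → t < (n : ℝ) / 2 + 1 / 2 →
      γ t = sg n (t - n / 2) := by
    intro n t h1 h2
    by_cases h3 : (n : ℝ) / 2 ≤ t
    · have : ⌊2 * t⌋₊ = n := by
        rw [Nat.floor_eq_iff (by have : (0 : ℝ) ≤ n := n.cast_nonneg; linarith)]
        exact ⟨by linarith, by linarith⟩
      simp only [γ, this]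
    · push Not at h3
      rcases n with _ | n
      · have : ⌊2 * t⌋₊ = 0 := Nat.floor_eq_zero.2 (by push_cast at h2; linarith)
        simp only [γ, this]
      · push_cast at h1 h2 h3 ⊢
        have : ⌊2 * t⌋₊ = n := by
          rw [Nat.floor_eq_iff (by have : (0 : ℝ) ≤ n := n.cast_nonneg; linarith)]
          exact ⟨by linarith, by linarith⟩
        simp only [γ, this]
        rw [← hov n _ ⟨by linarith, by linarith⟩]
        congr 1
        ring
  have hneg : ∀ t : ℝ, t < 1 / 2 → γ t = sg 0 t := by
    intro t ht
    have : ⌊2 * t⌋₊ = 0 := Nat.floor_eq_zero.2 (by linarith)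
    simp [γ, this]
  obtain ⟨h0, h1, h2⟩ := hseg _ _ (hsp 0)
  have hev0 : γ =ᶠ[𝓝 0] sg 0 := by
    filter_upwards [Iio_mem_nhds (by norm_num : (0 : ℝ) < 1 / 2)] with t ht using hneg t ht
  refine ⟨γ, ?_, ?_, fun s hs => ?_⟩
  · rw [hneg 0 (by norm_num)]
    exact h0
  · rw [velocity, hev0.mfderiv_eq]
    exact h1
  by_cases hs0 : s < 1 / 2
  · refine (h2 s ⟨hs, by linarith⟩).congr ?_
    filter_upwards [Iio_mem_nhds hs0] with t ht using hneg t ht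
  · push Not at hs0
    set n := ⌊2 * s⌋₊
    have hn1 : (n : ℝ) ≤ 2 * s := Nat.floor_le (by linarith)
    have hn2 : 2 * s < n + 1 := Nat.lt_floor_add_one _
    obtain ⟨h0, h1, h2⟩ := hseg _ _ (hsp n)
    have h3 := IsGeodesicAt.comp_affine_of_Ioo (a := 1) (b := -(n / 2 : ℝ)) h2 (t := s)
      ⟨by linarith, by linarith⟩
    refine h3.congr ?_
    filter_upwards [Ioo_mem_nhds (by linarith : (n : ℝ) / 2 - 1 / 8 < s)
      (by linarith : s < (n : ℝ) / 2 + 1 / 2)] with t ht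
    rw [hγn n t ht.1.le ht.2, one_mul, sub_eq_add_neg]

/-- Complete geodesics. -/
theorem UniformGeodesics.exists_geodesic {ρ : ℝ} (h : UniformGeodesics I M ρ) {p : M} {v : E}
    (hv : tnorm I p v < ρ) : ∃ γ : ℝ → M, γ 0 = p ∧ velocity I γ 0 = v ∧ IsGeodesic I γ := by
  obtain ⟨γ, h0, h1, h2⟩ := h.exists_ray hv
  obtain ⟨γ', h0', h1', h2'⟩ := h.exists_ray (v := -v) (by rwa [tnorm_neg])
  have hrev : ∀ s : ℝ, s < 1 → IsGeodesicAt I (fun s => γ' (-1 * s + 0)) s := fun s hs =>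
    IsGeodesicAt.comp_affine (by
      filter_upwards [Ioi_mem_nhds (by linarith : -1 < -1 * s + 0)] with t ht using h2' t ht)
  have hag : ∀ s ∈ Icc (-(1 / 8) : ℝ) (1 / 8), γ s = γ' (-1 * s + 0) := by
    intro s hs
    refine h.unique hv h0 h1 (fun s hs => h2 s (by linarith [hs.1])) (γ' := fun s => γ' (-1 * s + 0))
      (by simpa using h0') ?_ (fun s hs => hrev s (by linarith [hs.2])) hs
    rw [velocity_comp_affine]
    · simp [h1']
    · exact (h2' _ (by norm_num)).mdifferentiableAt
  have hpos : ∀ t : ℝ, -(1 / 8) ≤ t → (if 0 ≤ t then γ t else γ' (-1 * t + 0)) = γ t := by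
    intro t ht
    split_ifs with h3
    · rfl
    · exact (hag t ⟨ht, by linarith⟩).symm
  refine ⟨fun t => if 0 ≤ t then γ t else γ' (-1 * t + 0), by simpa using h0, ?_, ?_⟩
  · have he : (fun t => if 0 ≤ t then γ t else γ' (-1 * t + 0)) =ᶠ[𝓝 0] γ := by
      filter_upwards [Ioi_mem_nhds (by norm_num : (-(1 / 8) : ℝ) < 0)] with t ht
      exact hpos t (le_of_lt ht)
    rw [velocity, he.mfderiv_eq]
    exact h1
  · rw [isGeodesic_iff]
    intro t
    by_cases ht : -(1 / 8) < t
    · refine (h2 t (by linarith)).congr ?_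
      filter_upwards [Ioi_mem_nhds ht] with s hs using hpos s (le_of_lt hs)
    · refine (hrev t (by linarith)).congr ?_
      filter_upwards [Iio_mem_nhds (by linarith : t < 0)] with s hs
      exact if_neg (not_le.2 hs)

theorem tangentMap_eq_iff {γ : ℝ → M} {p : M} {v : E} :
    tangentMap 𝓘(ℝ, ℝ) I γ (⟨0, (1 : ℝ)⟩ : TangentBundle 𝓘(ℝ, ℝ) ℝ)
        = (⟨p, v⟩ : TangentBundle I M) ↔ γ 0 = p ∧ velocity I γ 0 = v := by
  constructor
  · intro h
    injection h with h1 h2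
    exact ⟨h1, h2⟩
  · rintro ⟨rfl, rfl⟩
    rfl

/-- The exponential map is the time one map of geodesics with a short initial velocity. -/
theorem UniformGeodesics.expMap_eq {ρ : ℝ} (h : UniformGeodesics I M ρ) {p : M} {v : E}
    (hv : tnorm I p v < ρ) :
    ∃ γ : ℝ → M, γ 0 = p ∧ velocity I γ 0 = v ∧ IsGeodesic I γ ∧ expMap I p v = γ 1 := by
  obtain ⟨γ, h0, h1, h2⟩ := h.exists_geodesic hv
  have hex : ∃ γ : ℝ → M, IsGeodesic I γ ∧
      tangentMap 𝓘(ℝ, ℝ) I γ (⟨0, (1 : ℝ)⟩ : TangentBundle 𝓘(ℝ, ℝ) ℝ)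
        = (⟨p, v⟩ : TangentBundle I M) := ⟨γ, h2, tangentMap_eq_iff.2 ⟨h0, h1⟩⟩
  have hsp := hex.choose_spec
  rw [tangentMap_eq_iff] at hsp
  refine ⟨hex.choose, hsp.2.1, hsp.2.2, hsp.1, ?_⟩
  rw [expMap, dif_pos hex]

variable (I) in
/-- Near `x₀`, the exponential map is smooth in the chart at `x₀`. -/
theorem exists_expMap_eq [CompactSpace M] (x₀ : M) :
    ∃ W ∈ 𝓝 x₀, ∃ (ρ : ℝ) (P : Set (E × E)) (e : E × E → E), 0 < ρ ∧
      W ⊆ (extChartAt I x₀).source ∧ IsOpen P ∧ (extChartAt I x₀ x₀, 0) ∈ P ∧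
      ContDiffOn ℝ ∞ e P ∧ (∀ z ∈ P, e z ∈ (extChartAt I x₀).target) ∧
      HasFDerivAt e (ContinuousLinearMap.fst ℝ E E + ContinuousLinearMap.snd ℝ E E)
        (extChartAt I x₀ x₀, 0) ∧
      ∀ p ∈ W, ∀ v : E, tnorm I p v < ρ → (extChartAt I x₀ p, chartDeriv I x₀ p v) ∈ P ∧
        expMap I p v = (extChartAt I x₀).symm (e (extChartAt I x₀ p, chartDeriv I x₀ p v)) := by
  obtain ⟨ρ₀, hρ₀⟩ := exists_uniform_geodesics I M
  have hU : UniformGeodesics I M ρ₀ := hρ₀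
  obtain ⟨W, hW, ρ, P, σ, hρ, hWs, hP, hP0, hsm, htar, hD, hg⟩ := exists_local_geodesics I x₀
  have hlin : ContDiff ℝ ∞ (fun z : E × E => (z.1, (2 : ℝ) • z.2)) := by fun_prop
  have hhalf : (1 / 2 : ℝ) ∈ Icc (-1 : ℝ) 1 := by norm_num
  refine ⟨W, hW, min (ρ / 2) ρ₀, (fun z : E × E => (z.1, (2 : ℝ) • z.2)) ⁻¹' P,
    fun z => σ (z.1, (2 : ℝ) • z.2) (1 / 2), lt_min (by positivity) hU.1, hWs,
    hP.preimage hlin.continuous, by simpa using hP0,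
    (hsm _ hhalf).comp hlin.contDiffOn fun z hz => hz, fun z hz => htar _ hz _ (by norm_num), ?_, ?_⟩
  · have h1 : HasFDerivAt (fun z : E × E => (z.1, (2 : ℝ) • z.2))
        ((ContinuousLinearMap.fst ℝ E E).prod ((2 : ℝ) • ContinuousLinearMap.snd ℝ E E))
        (extChartAt I x₀ x₀, (0 : E)) :=
      hasFDerivAt_fst.prodMk (hasFDerivAt_snd.const_smul (2 : ℝ))
    have h2 := HasFDerivAt.comp (g := fun z => σ z (1 / 2)) (extChartAt I x₀ x₀, (0 : E))
      (by simpa using hD) h1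
    refine h2.congr_fderiv ?_
    ext v <;> simp
  · intro p hp v hv
    have hv1 : tnorm I p ((2 : ℝ) • v) < ρ := by
      rw [tnorm_smul, abs_of_pos two_pos]
      linarith [hv.trans_le (min_le_left _ _)]
    obtain ⟨γ, h0, h1, h2, h3⟩ := hU.expMap_eq (hv.trans_le (min_le_right _ _))
    obtain ⟨h4, -, h5⟩ := hg p hp _ hv1
    rw [map_smul] at h4
    refine ⟨h4, ?_⟩
    rw [isGeodesic_iff] at h2
    have h6 := h5 (fun s => γ (2 * s + 0)) (by simpa using h0) (by
      rw [velocity_comp_affine]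
      · simp [h1]
      · exact (h2 _).mdifferentiableAt) (fun s _ => IsGeodesicAt.comp_affine
        (Eventually.of_forall h2)) (1 / 2) hhalf
    rw [h3]
    norm_num at h6
    simpa using h6

end Exponential

/-! ### Exponential charts -/

/-- The local inverse of `(y, v) ↦ (y, e (y, v))`, where `e (y, v) = y + v + …`. -/
theorem exists_fibrewise_inverse {E : Type*} [NormedAddCommGroup E] [NormedSpace ℝ E]
    [CompleteSpace E] {e : E × E → E} {P : Set (E × E)} {y₀ : E} (hP : IsOpen P)
    (hP0 : (y₀, 0) ∈ P) (he : ContDiffOn ℝ ∞ e P) (he0 : e (y₀, 0) = y₀)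
    (hD : HasFDerivAt e (ContinuousLinearMap.fst ℝ E E + ContinuousLinearMap.snd ℝ E E) (y₀, 0)) :
    ∃ (Q T : Set (E × E)) (L : E × E → E), IsOpen Q ∧ (y₀, 0) ∈ Q ∧ Q ⊆ P ∧ IsOpen T ∧
      (y₀, y₀) ∈ T ∧ ContDiffOn ℝ ∞ L T ∧ (∀ z ∈ Q, (z.1, e z) ∈ T ∧ L (z.1, e z) = z.2) ∧
      (∀ q ∈ T, (q.1, L q) ∈ Q ∧ e (q.1, L q) = q.2) ∧
      HasFDerivAt L (ContinuousLinearMap.snd ℝ E E - ContinuousLinearMap.fst ℝ E E) (y₀, y₀) := by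
  let Φ : E × E → E × E := fun z => (z.1, e z)
  have hΦ : ContDiffOn ℝ ∞ Φ P := contDiffOn_fst.prodMk he
  let A : (E × E) ≃L[ℝ] (E × E) := ContinuousLinearEquiv.equivOfInverse
    ((ContinuousLinearMap.fst ℝ E E).prod
      (ContinuousLinearMap.fst ℝ E E + ContinuousLinearMap.snd ℝ E E))
    ((ContinuousLinearMap.fst ℝ E E).prod
      (ContinuousLinearMap.snd ℝ E E - ContinuousLinearMap.fst ℝ E E))
    (fun z => by simp) (fun z => by simp)
  have hΦD : HasFDerivAt Φ (A : E × E →L[ℝ] E × E) (y₀, 0) := hasFDerivAt_fst.prodMk hD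
  have hΦat := hΦ.contDiffAt (hP.mem_nhds hP0)
  let Ψ := hΦat.toOpenPartialHomeomorph Φ hΦD (by simp)
  have hΨ : ∀ z, Ψ z = Φ z := fun z => rfl
  have hΨ0 : (y₀, (0 : E)) ∈ Ψ.source := hΦat.mem_toOpenPartialHomeomorph_source hΦD (by simp)
  have hinv : ∀ᶠ z in 𝓝 (y₀, (0 : E)), fderiv ℝ Φ z ∈
      range ((↑) : ((E × E) ≃L[ℝ] (E × E)) → (E × E →L[ℝ] E × E)) := by
    have hc : ContinuousAt (fderiv ℝ Φ) (y₀, 0) :=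
      (hΦat.fderiv_right (m := 0) (by simp)).continuousAt
    refine hc.eventually ?_
    rw [hΦD.fderiv]
    exact ContinuousLinearEquiv.nhds A
  obtain ⟨Q, hQ, hQo, hQ0⟩ := eventually_nhds_iff.1
    (hinv.and ((hP.eventually_mem hP0).and
      (Ψ.open_source.eventually_mem hΨ0)))
  have hfst : ∀ q ∈ Ψ.target, (Ψ.symm q).1 = q.1 := fun q hq => by
    have := congr(($(Ψ.right_inv hq)).1)
    exact this
  have hsnd : ∀ q ∈ Ψ.target, e (Ψ.symm q) = q.2 := fun q hq => by
    have := congr(($(Ψ.right_inv hq)).2)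
    exact this
  have hsymm0 : Ψ.symm (y₀, y₀) = (y₀, 0) := by
    have := Ψ.left_inv hΨ0
    rwa [hΨ, show Φ (y₀, 0) = (y₀, y₀) by simp [Φ, he0]] at this
  have htar0 : (y₀, y₀) ∈ Ψ.target := by
    have := Ψ.map_source hΨ0
    rwa [hΨ, show Φ (y₀, 0) = (y₀, y₀) by simp [Φ, he0]] at this
  refine ⟨Q, Ψ.target ∩ Ψ.symm ⁻¹' Q, fun q => (Ψ.symm q).2, hQo, hQ0, fun z hz => (hQ z hz).2.1,
    Ψ.symm.isOpen_inter_preimage hQo, ⟨htar0, by rw [mem_preimage, hsymm0]; exact hQ0⟩, ?_, ?_, ?_,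
    ?_⟩
  · rintro q ⟨hq, hqQ⟩
    obtain ⟨B, hB⟩ := (hQ _ hqQ).1
    have hat : ContDiffAt ℝ ∞ Φ (Ψ.symm q) := hΦ.contDiffAt (hP.mem_nhds (hQ _ hqQ).2.1)
    have hder : HasFDerivAt Φ (B : E × E →L[ℝ] E × E) (Ψ.symm q) := by
      rw [hB]
      exact (hat.differentiableAt (by simp)).hasFDerivAt
    exact (contDiff_snd.contDiffAt.comp q (Ψ.contDiffAt_symm hq hder hat)).contDiffWithinAt
  · intro z hz
    have hs := (hQ z hz).2.2
    have h1 : Ψ.symm (z.1, e z) = z := Ψ.left_inv hs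
    refine ⟨⟨Ψ.map_source hs, ?_⟩, ?_⟩
    · rw [mem_preimage, h1]; exact hz
    · exact congrArg Prod.snd h1
  · rintro q ⟨hq, hqQ⟩
    have h1 : (q.1, (Ψ.symm q).2) = Ψ.symm q := Prod.ext (hfst q hq).symm rfl
    rw [h1]
    exact ⟨hqQ, hsnd q hq⟩
  · have h1 : HasFDerivAt Ψ.symm (A.symm : E × E →L[ℝ] E × E) (y₀, y₀) :=
      Ψ.hasFDerivAt_symm htar0 (by rw [hsymm0]; exact hΦD)
    exact h1.snd

section ExpChart

set_option linter.unusedSectionVars false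

variable {E : Type*} [NormedAddCommGroup E] [NormedSpace ℝ E] [FiniteDimensional ℝ E]
  {H : Type*} [TopologicalSpace H] {I : ModelWithCorners ℝ E H} [I.Boundaryless]
  {M : Type*} [EMetricSpace M] [ChartedSpace H M] [IsManifold I ∞ M]
  [RiemannianBundle (fun x : M => TangentSpace I x)]
  [IsContMDiffRiemannianBundle I ∞ E (fun x : M => TangentSpace I x)]
  [IsRiemannianManifold I M]

attribute [local instance] isContinuousRiemannianBundle_of_contMDiff

theorem continuous_tnorm (p : M) : Continuous (tnorm I p) :=
  continuous_norm (E := TangentSpace I p)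

theorem UniformGeodesics.edist_expMap_le {ρ : ℝ} (h : UniformGeodesics I M ρ) {p : M} {v : E}
    (hv : tnorm I p v < ρ) : edist (expMap I p v) p ≤ ENNReal.ofReal (tnorm I p v) := by
  obtain ⟨γ, h0, h1, h2, h3⟩ := h.expMap_eq hv
  rw [isGeodesic_iff] at h2
  have := edist_le_of_isGeodesicAt (a := -2) (b := 2) (fun s _ => h2 s)
    (by norm_num : (0 : ℝ) ∈ Ioo (-2 : ℝ) 2) (by norm_num : (1 : ℝ) ∈ Ioo (-2 : ℝ) 2)
  rw [h0, h1] at this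
  rw [h3, edist_comm]
  simpa using this

variable (I) in
/-- The coordinate expression of a vector field in the chart at `x₀`. -/
def coordField (X : (x : M) → TangentSpace I x) (x₀ : M) (y : E) : E :=
  chartDeriv I x₀ ((extChartAt I x₀).symm y) (X ((extChartAt I x₀).symm y))

variable (I) in
/-- `ξ`, defined on the open set `N`, is the inverse of the exponential map at `p` on the ball of
radius `r`, and its radial part is transverse to the vector field `X`. -/
structure IsExpChart (X : (x : M) → TangentSpace I x) (p : M) (r c C : ℝ) (N : Set M)
    (ξ : M → E) : Prop where
  isOpen : IsOpen N
  contMDiffAt_expMap : ∀ v : E, tnorm I p v < r → ContMDiffAt 𝓘(ℝ, E) I ∞ (expMap I p) v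
  expMap_mem : ∀ v : E, tnorm I p v < r → expMap I p v ∈ N
  apply_expMap : ∀ v : E, tnorm I p v < r → ξ (expMap I p v) = v
  contMDiffAt : ∀ x ∈ N, ContMDiffAt I 𝓘(ℝ, E) ∞ ξ x
  tnorm_lt : ∀ x ∈ N, tnorm I p (ξ x) < r
  expMap_apply : ∀ x ∈ N, expMap I p (ξ x) = x
  mem_of_edist_lt : ∀ x, edist x p < ENNReal.ofReal c → x ∈ N
  tnorm_le : ∀ x ∈ N, tnorm I p (ξ x) ≤ C * (edist x p).toReal
  edist_le : ∀ x ∈ N, edist x p ≤ ENNReal.ofReal (tnorm I p (ξ x))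
  le_metricAt : ∀ x ∈ N, c ≤ metricAt I p (mfderiv I 𝓘(ℝ, E) ξ x (X x)) (X p)

theorem IsExpChart.restrict {X : (x : M) → TangentSpace I x} {p : M} {r c C : ℝ} {N : Set M}
    {ξ : M → E} (h : IsExpChart I X p r c C N ξ) {r' c' C' : ℝ} (hr : r' ≤ r)
    (hc : c' ≤ c) (hC : C ≤ C') (hC' : 0 < C') (hcr : C' * c' < r') :
    IsExpChart I X p r' c' C' (N ∩ (fun x => tnorm I p (ξ x)) ⁻¹' Iio r') ξ where
  isOpen := by
    refine ContinuousOn.isOpen_inter_preimage (fun x hx => ?_) h.isOpen isOpen_Iio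
    exact ((continuous_tnorm p).continuousAt.comp
      (h.contMDiffAt x hx).continuousAt).continuousWithinAt
  contMDiffAt_expMap v hv := h.contMDiffAt_expMap v (hv.trans_le hr)
  expMap_mem v hv := ⟨h.expMap_mem v (hv.trans_le hr), by
    rw [mem_preimage, h.apply_expMap v (hv.trans_le hr)]; exact hv⟩
  apply_expMap v hv := h.apply_expMap v (hv.trans_le hr)
  contMDiffAt x hx := h.contMDiffAt x hx.1
  tnorm_lt x hx := hx.2
  expMap_apply x hx := h.expMap_apply x hx.1
  mem_of_edist_lt x hx := by
    have h1 := h.mem_of_edist_lt x (hx.trans_le (ENNReal.ofReal_le_ofReal hc))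
    refine ⟨h1, ?_⟩
    have hcpos : 0 < c' := by
      by_contra hneg
      rw [ENNReal.ofReal_of_nonpos (not_lt.1 hneg)] at hx
      exact not_lt_bot hx
    have h2 : (edist x p).toReal < c' := by
      rw [← ENNReal.toReal_ofReal hcpos.le]
      exact (ENNReal.toReal_lt_toReal hx.ne_top ENNReal.ofReal_ne_top).2 hx
    calc tnorm I p (ξ x) ≤ C * (edist x p).toReal := h.tnorm_le x h1
      _ ≤ C' * (edist x p).toReal := by gcongr
      _ ≤ C' * c' := by gcongr
      _ < r' := hcr
  tnorm_le x hx := (h.tnorm_le x hx.1).trans (by gcongr)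
  edist_le x hx := h.edist_le x hx.1
  le_metricAt x hx := hc.trans (h.le_metricAt x hx.1)

variable (I) in
theorem exists_local_expChart [CompactSpace M] (X : (x : M) → TangentSpace I x)
    (hX₀ : ∀ p, X p ≠ 0) (x₀ : M) (hX : ContinuousOn (coordField I X x₀) (extChartAt I x₀).target) :
    ∃ W ∈ 𝓝 x₀, ∃ r c C : ℝ, 0 < r ∧ 0 < c ∧ 0 < C ∧
      ∀ p ∈ W, ∃ (N : Set M) (ξ : M → E), IsExpChart I X p r c C N ξ := by
  obtain ⟨ρ₀, hρ₀⟩ := exists_uniform_geodesics I M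
  have hU : UniformGeodesics I M ρ₀ := hρ₀
  obtain ⟨W₀, hW₀, ρ, P, e, hρ, hWs, hP, hP0, hsm, htar, hD, hg⟩ := exists_expMap_eq I x₀
  set y₀ := extChartAt I x₀ x₀ with hy₀
  have hx₀s : x₀ ∈ (extChartAt I x₀).source := mem_extChartAt_source x₀
  have hexp0 : ∀ p ∈ W₀, e (extChartAt I x₀ p, 0) = extChartAt I x₀ p := by
    intro p hp
    obtain ⟨h1, h2⟩ := hg p hp 0 (by rw [tnorm_zero]; exact hρ)
    have h3 := hU.edist_expMap_le (p := p) (v := 0) (by rw [tnorm_zero]; exact hU.1)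
    rw [tnorm_zero, ENNReal.ofReal_zero, nonpos_iff_eq_zero, edist_eq_zero] at h3
    rw [map_zero] at h1 h2
    rw [h3] at h2
    have h4 := congrArg (extChartAt I x₀) h2
    rw [(extChartAt I x₀).right_inv (htar _ h1)] at h4
    exact h4.symm
  obtain ⟨Q, T, L, hQ, hQ0, hQP, hT, hT0, hL, hQT, hTQ, hLD⟩ := exists_fibrewise_inverse hP hP0 hsm
    (hexp0 x₀ (mem_of_mem_nhds hW₀)) hD
  have hLat : ContDiffAt ℝ ∞ L (y₀, y₀) := hL.contDiffAt (hT.mem_nhds hT0)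
  -- constants
  obtain ⟨K, B, hB, hKB⟩ := (hLat.of_le (by simp : (1 : WithTop ℕ∞) ≤ (∞ : WithTop ℕ∞))).exists_lipschitzOnWith
  obtain ⟨C₁, hC₁, hchart⟩ := exists_norm_chartDeriv_le I x₀
  obtain ⟨C₂, hC₂, hchart'⟩ := exists_tnorm_le_norm_chartDeriv I x₀
  obtain ⟨C₃, W₃, hW₃, hbil⟩ := exists_edist_extChartAt_le I x₀
  have hy₀t : y₀ ∈ (extChartAt I x₀).target := mem_extChartAt_target x₀
  let F : E × E → ℝ := fun q => chartMetricL I x₀ q.1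
    (fderiv ℝ L q (0, coordField I X x₀ q.2)) (coordField I X x₀ q.1)
  have hF0 : 0 < F (y₀, y₀) := by
    have h1 : coordField I X x₀ y₀ ≠ 0 := by
      intro h0
      have h2 := chartSymmDeriv_chartDeriv (I := I)
        ((extChartAt I x₀).map_target hy₀t) (X ((extChartAt I x₀).symm y₀))
      rw [show chartDeriv I x₀ ((extChartAt I x₀).symm y₀) (X ((extChartAt I x₀).symm y₀)) = 0
        from h0, map_zero] at h2
      exact hX₀ _ h2.symm
    have h2 := chartMetric_pos hy₀t h1
    simpa [F, hLD.fderiv, chartMetricL_apply] using h2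
  have hFc : ContinuousAt F (y₀, y₀) := by
    have h1 : ContinuousAt (coordField I X x₀) y₀ :=
      hX.continuousAt ((isOpen_target x₀).mem_nhds hy₀t)
    have h2 : ContinuousAt (fderiv ℝ L) (y₀, y₀) :=
      (hLat.fderiv_right (m := 0) (by simp)).continuousAt
    have h3 : ContinuousAt (chartMetricL I x₀) y₀ := (differentiableAt_chartMetricL hy₀t).continuousAt
    have h1' : ContinuousAt (fun q : E × E => coordField I X x₀ q.2) (y₀, y₀) :=
      ContinuousAt.comp (g := coordField I X x₀) (f := Prod.snd) h1 continuousAt_snd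
    have h1'' : ContinuousAt (fun q : E × E => coordField I X x₀ q.1) (y₀, y₀) :=
      ContinuousAt.comp (g := coordField I X x₀) (f := Prod.fst) h1 continuousAt_fst
    have h3' : ContinuousAt (fun q : E × E => chartMetricL I x₀ q.1) (y₀, y₀) :=
      ContinuousAt.comp (g := chartMetricL I x₀) (f := Prod.fst) h3 continuousAt_fst
    exact (h3'.clm_apply (h2.clm_apply (continuousAt_const.prodMk h1'))).clm_apply h1''
  have hFev : ∀ᶠ q in 𝓝 (y₀, y₀), F (y₀, y₀) / 2 < F q := hFc.eventually_const_lt (by linarith)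
  -- a good neighbourhood
  have hχ := continuousAt_extChartAt (I := I) x₀
  have hpair : ∀ᶠ q in 𝓝 (x₀, x₀), (extChartAt I x₀ q.1, extChartAt I x₀ q.2) ∈ B ∧
      F (y₀, y₀) / 2 < F (extChartAt I x₀ q.1, extChartAt I x₀ q.2) ∧
      (extChartAt I x₀ q.1, extChartAt I x₀ q.2) ∈ T := by
    have hc : ContinuousAt (fun q : M × M => (extChartAt I x₀ q.1, extChartAt I x₀ q.2)) (x₀, x₀) :=
      (ContinuousAt.comp (g := extChartAt I x₀) (f := Prod.fst) hχ continuousAt_fst).prodMk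
        (ContinuousAt.comp (g := extChartAt I x₀) (f := Prod.snd) hχ continuousAt_snd)
    exact hc.eventually ((show ∀ᶠ q in 𝓝 (y₀, y₀), q ∈ B from hB).and
      (hFev.and (hT.eventually_mem hT0)))
  rw [nhds_prod_eq] at hpair
  obtain ⟨W₁, hW₁, hW₁s⟩ := mem_prod_self_iff.1 hpair
  replace hpair : ∀ a ∈ W₁, ∀ b ∈ W₁, (extChartAt I x₀ a, extChartAt I x₀ b) ∈ B ∧
      F (y₀, y₀) / 2 < F (extChartAt I x₀ a, extChartAt I x₀ b) ∧
      (extChartAt I x₀ a, extChartAt I x₀ b) ∈ T := fun a ha b hb => hW₁s (mk_mem_prod ha hb)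
  obtain ⟨ε, hε, hεQ⟩ := Metric.isOpen_iff.1 hQ _ hQ0
  obtain ⟨R, hR, hRsub⟩ := EMetric.mem_nhds_iff.1 (inter_mem hW₀ (inter_mem hW₁ (inter_mem hchart
    (inter_mem hchart' (inter_mem hW₃ (hχ.preimage_mem_nhds (Metric.ball_mem_nhds _ hε)))))))
  obtain ⟨R', hR'0, hR'⟩ := ENNReal.lt_iff_exists_nnreal_btwn.1 (ENNReal.half_pos hR.ne')
  have hR'pos : (0 : ℝ) < R' := by exact_mod_cast hR'0
  set r := min (R' : ℝ) (min ρ (min ρ₀ (ε / C₁)))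
  have hr : 0 < r := lt_min hR'pos (lt_min hρ (lt_min hU.1 (by positivity)))
  have hrR : r ≤ R' := min_le_left _ _
  have hrρ : r ≤ ρ := (min_le_right _ _).trans (min_le_left _ _)
  have hrρ₀ : r ≤ ρ₀ := (min_le_right _ _).trans ((min_le_right _ _).trans (min_le_left _ _))
  have hrε : C₁ * r ≤ ε := by
    rw [← le_div_iff₀' hC₁]
    exact (min_le_right _ _).trans ((min_le_right _ _).trans (min_le_right _ _))
  set C : ℝ := C₂ * (K * C₃) + 1
  have hC : 0 < C := by positivity
  set c : ℝ := min (R' : ℝ) (min (F (y₀, y₀) / 2) (r / (2 * C)))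
  have hc : 0 < c := by positivity
  refine ⟨_, Metric.eball_mem_nhds x₀ (ENNReal.half_pos hR.ne'), r, c, C, hr, hc, hC, ?_⟩
  intro p hp
  have hpR : p ∈ Metric.eball x₀ R := Metric.eball_subset_eball ENNReal.half_le_self hp
  obtain ⟨hp0, hp1, hp2, hp3, hp4, hp5⟩ := hRsub hpR
  have hps := hWs hp0
  set y := extChartAt I x₀ p with hy
  have hyt : y ∈ (extChartAt I x₀).target := (extChartAt I x₀).map_source hps
  have hsy : (extChartAt I x₀).symm y = p := (extChartAt I x₀).left_inv hps
  set A := chartDeriv I x₀ p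
  set A' := chartSymmDeriv I x₀ y
  have hAA' : ∀ w, A (A' w) = w := fun w => by
    have := chartDeriv_chartSymmDeriv hyt w
    rwa [hsy] at this
  have hA'A : ∀ w, A' (A w) = w := chartSymmDeriv_chartDeriv hps
  have hnear : ∀ x, edist x p ≤ R' → x ∈ Metric.eball x₀ R := by
    intro x hx
    rw [Metric.mem_eball]
    calc edist x x₀ ≤ edist x p + edist p x₀ := edist_triangle _ _ _
      _ < R / 2 + R / 2 := ENNReal.add_lt_add (hx.trans_lt hR') hp
      _ = R := ENNReal.add_halves _
  have hvQ : ∀ v, tnorm I p v < r → (y, A v) ∈ Q := by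
    intro v hv
    refine hεQ ?_
    rw [Metric.mem_ball, Prod.dist_eq, max_lt_iff, dist_zero_right]
    exact ⟨hp5, ((hp2 v).trans_lt (mul_lt_mul_of_pos_left hv hC₁)).trans_le hrε⟩
  have hexp : ∀ v, tnorm I p v < r → expMap I p v = (extChartAt I x₀).symm (e (y, A v)) :=
    fun v hv => (hg p hp0 v (hv.trans_le hrρ)).2
  have hexps : ∀ v, tnorm I p v < r → expMap I p v ∈ (extChartAt I x₀).source ∧
      extChartAt I x₀ (expMap I p v) = e (y, A v) := by
    intro v hv
    have := htar _ (hQP (hvQ v hv))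
    rw [hexp v hv]
    exact ⟨(extChartAt I x₀).map_target this, (extChartAt I x₀).right_inv this⟩
  let ξ : M → E := fun x => A' (L (y, extChartAt I x₀ x))
  let N₀ : Set M := (extChartAt I x₀).source ∩ (fun x => (y, extChartAt I x₀ x)) ⁻¹' T
  have hN₀ : IsOpen N₀ := ContinuousOn.isOpen_inter_preimage
    (continuousOn_const.prodMk (continuousOn_extChartAt x₀)) (isOpen_extChartAt_source x₀) hT
  have hξ : ∀ x ∈ N₀, ContMDiffAt I 𝓘(ℝ, E) ∞ ξ x := by
    intro x hx
    have h1 : ContMDiffAt I 𝓘(ℝ, E) ∞ (extChartAt I x₀) x :=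
      (contMDiffOn_extChartAt (I := I) (n := ∞) (x := x₀)).contMDiffAt
        ((chartAt H x₀).open_source.mem_nhds (by simpa using hx.1))
    have h2 : ContDiffAt ℝ ∞ (fun z => A' (L (y, z))) (extChartAt I x₀ x) :=
      A'.contDiff.contDiffAt.comp _ ((hL.contDiffAt (hT.mem_nhds hx.2)).comp _
        (contDiffAt_const.prodMk contDiffAt_id))
    exact h2.contMDiffAt.comp x h1
  have hLy : L (y, y) = 0 := by
    have h1 : (y, (0 : E)) ∈ Q := by
      have := hvQ 0 (by rw [tnorm_zero]; exact hr)
      rwa [map_zero] at this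
    have h2 := (hQT _ h1).2
    rwa [hexp0 p hp0] at h2
  have htn : ∀ x ∈ Metric.eball x₀ R, tnorm I p (ξ x) ≤ C₂ * (K * C₃) * (edist x p).toReal := by
    intro x hx
    obtain ⟨hx0, hx1, hx2, hx3, hx4, hx5⟩ := hRsub hx
    have h1 := hp3 (ξ x)
    have h2 : A (ξ x) = L (y, extChartAt I x₀ x) := hAA' _
    have h3 : edist (L (y, extChartAt I x₀ x)) (L (y, y)) ≤ K * (C₃ * edist x p) := by
      refine (hKB (hpair _ hp1 _ hx1).1 (hpair _ hp1 _ hp1).1).trans ?_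
      gcongr
      rw [Prod.edist_eq, edist_self]
      simpa using hbil x hx4 p hp4
    have hne : edist x p ≠ ⊤ := by
      have h4 : edist x p < ⊤ := by
        calc edist x p ≤ edist x x₀ + edist p x₀ := edist_triangle_right _ _ _
          _ < ⊤ := ENNReal.add_lt_top.2 ⟨lt_of_lt_of_le hx le_top, lt_of_lt_of_le hpR le_top⟩
      exact h4.ne
    rw [hLy, edist_zero_right] at h3
    have h4 := ENNReal.toReal_mono (ENNReal.mul_ne_top ENNReal.coe_ne_top
      (ENNReal.mul_ne_top ENNReal.coe_ne_top hne)) h3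
    rw [toReal_enorm, ENNReal.toReal_mul, ENNReal.toReal_mul, ENNReal.coe_toReal,
      ENNReal.coe_toReal] at h4
    rw [← h2] at h4
    calc tnorm I p (ξ x) ≤ C₂ * ‖A (ξ x)‖ := h1
      _ ≤ C₂ * (K * (C₃ * (edist x p).toReal)) := by gcongr
      _ = _ := by ring
  have hexpξ : ∀ x ∈ N₀, tnorm I p (ξ x) < r → expMap I p (ξ x) = x := by
    intro x hx hxr
    rw [hexp _ hxr]
    simp only [ξ, hAA']
    rw [(hTQ _ hx.2).2]
    exact (extChartAt I x₀).left_inv hx.1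
  have hN : ∀ x, x ∈ N₀ → tnorm I p (ξ x) < r → edist x p ≤ ENNReal.ofReal (tnorm I p (ξ x)) := by
    intro x hx hxr
    have := hU.edist_expMap_le (hxr.trans_le hrρ₀)
    rwa [hexpξ x hx hxr] at this
  have hNR : ∀ x, x ∈ N₀ → tnorm I p (ξ x) < r → x ∈ Metric.eball x₀ R := by
    intro x hx hxr
    refine hnear x ((hN x hx hxr).trans ?_)
    rw [← ENNReal.ofReal_coe_nnreal]
    exact ENNReal.ofReal_le_ofReal (hxr.le.trans hrR)
  refine ⟨N₀ ∩ (fun x => tnorm I p (ξ x)) ⁻¹' Iio r, ξ, ?_, ?_, ?_, ?_, fun x hx => hξ x hx.1,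
    fun x hx => hx.2, fun x hx => hexpξ x hx.1 hx.2, ?_, ?_, fun x hx => hN x hx.1 hx.2, ?_⟩
  · exact ContinuousOn.isOpen_inter_preimage (fun x hx => ((continuous_tnorm p).continuousAt.comp
      (hξ x hx).continuousAt).continuousWithinAt) hN₀ isOpen_Iio
  · intro v hv
    have h1 : ContMDiffAt 𝓘(ℝ, E) I ∞ (extChartAt I x₀).symm (e (y, A v)) :=
      (contMDiffOn_extChartAt_symm (I := I) (n := ∞) x₀).contMDiffAt
        ((isOpen_target x₀).mem_nhds (htar _ (hQP (hvQ v hv))))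
    have h2 : ContDiffAt ℝ ∞ (fun w => e (y, A w)) v :=
      ContDiffAt.comp (g := e) (f := fun w => (y, A w)) v
        (hsm.contDiffAt (hP.mem_nhds (hQP (hvQ v hv))))
        (contDiffAt_const.prodMk A.contDiff.contDiffAt)
    refine (h1.comp (f := fun w => e (y, A w)) v h2.contMDiffAt).congr_of_eventuallyEq ?_
    filter_upwards [(isOpen_Iio.preimage (continuous_tnorm (I := I) p)).mem_nhds hv] with w hw
    exact hexp w hw
  · intro v hv
    have h1 := hexps v hv
    have h2 := hQT _ (hvQ v hv)
    have h3 : ξ (expMap I p v) = v := by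
      simp only [ξ, h1.2]
      rw [h2.2, hA'A]
    refine ⟨⟨h1.1, ?_⟩, ?_⟩
    · simp only [mem_preimage, h1.2]
      exact h2.1
    · rw [mem_preimage, h3]
      exact hv
  · intro v hv
    have h1 := hexps v hv
    have h2 := hQT _ (hvQ v hv)
    simp only [ξ, h1.2]
    rw [h2.2, hA'A]
  · intro x hx
    have hxR' : edist x p ≤ R' := by
      rw [← ENNReal.ofReal_coe_nnreal]
      exact hx.le.trans (ENNReal.ofReal_le_ofReal (min_le_left _ _))
    have hxR := hnear x hxR'
    obtain ⟨hx0, hx1, -⟩ := hRsub hxR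
    refine ⟨⟨hWs hx0, (hpair _ hp1 _ hx1).2.2⟩, ?_⟩
    have h1 : (edist x p).toReal ≤ c := ENNReal.toReal_le_of_le_ofReal hc.le hx.le
    calc tnorm I p (ξ x) ≤ C₂ * (K * C₃) * (edist x p).toReal := htn x hxR
      _ ≤ C * (r / (2 * C)) := by
          gcongr
          · simp [C]
          · exact h1.trans ((min_le_right _ _).trans (min_le_right _ _))
      _ = r / 2 := by field_simp
      _ < r := by linarith
  · intro x hx
    refine (htn x (hNR x hx.1 hx.2)).trans ?_
    gcongr
    simp [C]
  · intro x hx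
    have hxR := hNR x hx.1 hx.2
    obtain ⟨hx0, hx1, -⟩ := hRsub hxR
    have hd : mfderiv I 𝓘(ℝ, E) ξ x (X x) =
        A' (fderiv ℝ L (y, extChartAt I x₀ x) (0, chartDeriv I x₀ x (X x))) := by
      have h1 : HasFDerivAt (fun z => A' (L (y, z)))
          (A'.comp ((fderiv ℝ L (y, extChartAt I x₀ x)).comp
            ((0 : E →L[ℝ] E).prod (ContinuousLinearMap.id ℝ E)))) (extChartAt I x₀ x) := by
        have h2 := ((hL.contDiffAt (hT.mem_nhds hx.1.2)).differentiableAt (by simp)).hasFDerivAt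
        have h3 : HasFDerivAt (fun z : E => (y, z)) ((0 : E →L[ℝ] E).prod
          (ContinuousLinearMap.id ℝ E)) (extChartAt I x₀ x) :=
          (hasFDerivAt_const y _).prodMk (hasFDerivAt_id _)
        exact A'.hasFDerivAt.comp _ (HasFDerivAt.comp (g := L) _ h2 h3)
      have h4 := h1.hasMFDerivAt.comp x (mdifferentiableAt_extChartAt' (I := I) hx.1.1).hasMFDerivAt
      have h5 := congr($(h4.mfderiv) (X x))
      exact h5
    have h6 : c ≤ F (y, extChartAt I x₀ x) :=
      ((min_le_right _ _).trans (min_le_left _ _)).trans (hpair _ hp1 _ hx1).2.1.le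
    refine h6.trans (le_of_eq ?_)
    have h7 : coordField I X x₀ (extChartAt I x₀ x) = chartDeriv I x₀ x (X x) := by
      rw [coordField, (extChartAt I x₀).left_inv hx.1.1]
    have h8 : coordField I X x₀ y = A (X p) := by
      rw [coordField, hsy]
    rw [hd]
    simp only [F]
    rw [chartMetricL_apply, h7, h8]
    refine Eq.trans ?_ (metricAt_eq_chartMetric hps _ (X p)).symm
    rw [hAA']

variable (I) in
/-- On a compact manifold there are exponential charts of a uniform size at all points. -/
theorem exists_expChart [CompactSpace M] (X : (x : M) → TangentSpace I x)
    (hX₀ : ∀ p, X p ≠ 0)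
    (hX : ∀ x₀, ContinuousOn (coordField I X x₀) (extChartAt I x₀).target) :
    ∃ r c C : ℝ, 0 < r ∧ 0 < c ∧ 0 < C ∧
      ∀ p, ∃ (N : Set M) (ξ : M → E), IsExpChart I X p r c C N ξ := by
  choose W hW r c C hr hc hC h using fun x₀ => exists_local_expChart I X hX₀ x₀ (hX x₀)
  obtain ⟨t, ht⟩ := CompactSpace.elim_nhds_subcover W hW
  rcases isEmpty_or_nonempty M with hM | ⟨⟨x₀⟩⟩
  · exact ⟨1, 1, 1, one_pos, one_pos, one_pos, fun p => (IsEmpty.false p).elim⟩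
  have hcov : ∀ p, ∃ x ∈ t, p ∈ W x := by
    intro p
    have : p ∈ ⋃ x ∈ t, W x := ht ▸ mem_univ p
    simpa only [mem_iUnion, exists_prop] using this
  have htne : t.Nonempty := by
    obtain ⟨x, hx, -⟩ := hcov x₀
    exact ⟨x, hx⟩
  have hr' : 0 < t.inf' htne r := (Finset.lt_inf'_iff _).2 fun x _ => hr x
  have hc' : 0 < t.inf' htne c := (Finset.lt_inf'_iff _).2 fun x _ => hc x
  have hC' : 0 < t.sup' htne C := (Finset.lt_sup'_iff _).2 (by
    obtain ⟨x, hx⟩ := htne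
    exact ⟨x, hx, hC x⟩)
  refine ⟨t.inf' htne r, min (t.inf' htne c) (t.inf' htne r / (2 * t.sup' htne C)), t.sup' htne C,
    hr', by positivity, hC', fun p => ?_⟩
  obtain ⟨x, hx, hpx⟩ := hcov p
  obtain ⟨N, ξ, hN⟩ := h x p hpx
  refine ⟨_, ξ, hN.restrict (Finset.inf'_le _ hx)
    ((min_le_left _ _).trans (Finset.inf'_le _ hx)) (Finset.le_sup' _ hx) hC' ?_⟩
  calc t.sup' htne C * min (t.inf' htne c) (t.inf' htne r / (2 * t.sup' htne C))
      ≤ t.sup' htne C * (t.inf' htne r / (2 * t.sup' htne C)) := by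
        gcongr
        exact min_le_right _ _
    _ = t.inf' htne r / 2 := by field_simp
    _ < t.inf' htne r := by linarith

end ExpChart

/-! ### The flow of a `C¹` vector field -/

section FlowRegularity

set_option linter.unusedSectionVars false

variable {E : Type*} [NormedAddCommGroup E] [NormedSpace ℝ E] [FiniteDimensional ℝ E]
  {H : Type*} [TopologicalSpace H] {I : ModelWithCorners ℝ E H} [I.Boundaryless]
  {M : Type*} [EMetricSpace M] [ChartedSpace H M] [IsManifold I ∞ M]
  [RiemannianBundle (fun x : M => TangentSpace I x)]
  [IsContMDiffRiemannianBundle I ∞ E (fun x : M => TangentSpace I x)]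

attribute [local instance] isContinuousRiemannianBundle_of_contMDiff

variable (I) in
/-- `φ` is the flow of the `C¹` vector field `X`. -/
structure IsC1Flow (X : (x : M) → TangentSpace I x) (φ : Flow ℝ M) : Prop where
  contDiffOn : ∀ x₀ : M, ContDiffOn ℝ 1 (coordField I X x₀) (extChartAt I x₀).target
  isMIntegralCurve : ∀ p, IsMIntegralCurve (I := I) (fun t => φ t p) X

variable {X : (x : M) → TangentSpace I x} {φ : Flow ℝ M}

theorem IsC1Flow.reverse (h : IsC1Flow I X φ) :
    IsC1Flow I (fun x => -X x) φ.reverse where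
  contDiffOn x₀ := by
    refine (h.contDiffOn x₀).neg.congr fun y _ => ?_
    exact map_neg (chartDeriv I x₀ ((extChartAt I x₀).symm y)) (X ((extChartAt I x₀).symm y))
  isMIntegralCurve p t := by
    have h1 : HasMFDerivAt 𝓘(ℝ, ℝ) 𝓘(ℝ, ℝ) (fun s : ℝ => -s) t
        (-(1 : ℝ →L[ℝ] ℝ)) := (hasDerivAt_neg t).hasFDerivAt.hasMFDerivAt.congr_mfderiv (by
          ext; simp)
    have h2 := HasMFDerivAt.comp (g := fun t => φ t p) t (h.isMIntegralCurve p (-t)) h1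
    refine h2.congr_mfderiv ?_
    ext
    change (-(1 : ℝ)) • X (φ (-t) p) = (1 : ℝ) • (-X (φ (-t) p))
    rw [neg_smul, smul_neg]

theorem IsC1Flow.hasDerivAt_comp (h : IsC1Flow I X φ) {F : Type*} [NormedAddCommGroup F]
    [NormedSpace ℝ F] {g : M → F} {p : M} {s : ℝ} (hg : MDifferentiableAt I 𝓘(ℝ, F) g (φ s p)) :
    HasDerivAt (fun s => g (φ s p)) (mfderiv I 𝓘(ℝ, F) g (φ s p) (X (φ s p))) s := by
  have h1 := hg.hasMFDerivAt.comp s (h.isMIntegralCurve p s)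
  let D : ℝ →L[ℝ] F :=
    (mfderiv I 𝓘(ℝ, F) g (φ s p)).comp ((1 : ℝ →L[ℝ] ℝ).smulRight (X (φ s p)))
  have h2 : HasFDerivAt (fun s => g (φ s p)) D s := h1.hasFDerivAt
  have h3 : D 1 = mfderiv I 𝓘(ℝ, F) g (φ s p) (X (φ s p)) := by
    change mfderiv I 𝓘(ℝ, F) g (φ s p) ((1 : ℝ) • X (φ s p)) = _
    rw [one_smul]
  have h4 := h2.hasDerivAt
  rw [h3] at h4
  exact h4

/-- The flow is `C¹` for short times. -/
theorem IsC1Flow.contMDiffAt_zero (h : IsC1Flow I X φ) (x₀ : M) :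
    ContMDiffAt (𝓘(ℝ, ℝ).prod I) I 1 (fun q : ℝ × M => φ q.1 q.2) (0, x₀) := by
  set y₀ := extChartAt I x₀ x₀ with hy₀
  obtain ⟨O, c, δ, hO, hO0, hδ, hc, hsol, hun⟩ := exists_localFlow (n := 1) le_rfl
    (isOpen_target x₀) (h.contDiffOn x₀) (mem_extChartAt_target x₀)
  have hχ := continuousAt_extChartAt (I := I) x₀
  have hφc : Continuous (fun q : ℝ × M => φ q.1 q.2) := φ.continuous continuous_fst continuous_snd
  have hgood : ∀ᶠ q : ℝ × M in 𝓝 (0, x₀), φ q.1 q.2 ∈ (extChartAt I x₀).source ∧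
      extChartAt I x₀ (φ q.1 q.2) ∈ Metric.ball y₀ δ := by
    have h1 : Tendsto (fun q : ℝ × M => φ q.1 q.2) (𝓝 (0, x₀)) (𝓝 x₀) := by
      have := hφc.tendsto (0, x₀)
      rwa [Flow.map_zero_apply] at this
    exact h1.eventually <| ((isOpen_extChartAt_source x₀).eventually_mem (mem_extChartAt_source x₀)).and
      (hχ.eventually (Metric.ball_mem_nhds _ hδ))
  rw [nhds_prod_eq, Filter.eventually_prod_iff] at hgood
  obtain ⟨pa, hpa, pb, hpb, hgood⟩ := hgood
  obtain ⟨η, hη, hηpa⟩ := Metric.eventually_nhds_iff.1 hpa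
  have hev : ∀ᶠ q : ℝ × M in 𝓝 (0, x₀), φ q.1 q.2 =
      (extChartAt I x₀).symm (c (q.1, extChartAt I x₀ q.2) ⟨1, by norm_num⟩) := by
    have h1 : ∀ᶠ q : ℝ × M in 𝓝 (0, x₀), (q.1, extChartAt I x₀ q.2) ∈ O := by
      have : ContinuousAt (fun q : ℝ × M => (q.1, extChartAt I x₀ q.2)) (0, x₀) :=
        continuousAt_fst.prodMk
          (ContinuousAt.comp (g := extChartAt I x₀) (f := Prod.snd) hχ continuousAt_snd)
      exact this.eventually (hO.eventually_mem hO0)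
    have h2 : ∀ᶠ q : ℝ × M in 𝓝 (0, x₀), dist q.1 0 < η ∧ pb q.2 := by
      rw [nhds_prod_eq]
      exact (show ∀ᶠ t in 𝓝 (0 : ℝ), dist t 0 < η from Metric.ball_mem_nhds (0 : ℝ) hη).prod_mk hpb
    filter_upwards [h1, h2] with q hq hq'
    have hs : ∀ s ∈ Icc (-1 : ℝ) 1, φ (q.1 * s) q.2 ∈ (extChartAt I x₀).source ∧
        extChartAt I x₀ (φ (q.1 * s) q.2) ∈ Metric.ball y₀ δ := by
      intro s hs
      refine hgood (x := q.1 * s) (hηpa ?_) hq'.2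
      rw [dist_zero_right, norm_mul]
      calc ‖q.1‖ * ‖s‖ ≤ ‖q.1‖ * 1 := by gcongr; exact abs_le.2 hs
        _ < η := by rw [mul_one, ← dist_zero_right]; exact hq'.1
    have hd : ∀ s ∈ Icc (-1 : ℝ) 1, HasDerivAt (fun s => extChartAt I x₀ (φ (q.1 * s) q.2))
        (q.1 • coordField I X x₀ (extChartAt I x₀ (φ (q.1 * s) q.2))) s := by
      intro s hs'
      have h3 := h.hasDerivAt_comp (mdifferentiableAt_extChartAt' (I := I) (hs s hs').1)
      have h4 : HasDerivAt (fun s : ℝ => q.1 * s) q.1 s := by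
        simpa using (hasDerivAt_id s).const_mul q.1
      have h5 := h3.scomp s h4
      convert! h5 using 1
      rw [coordField, (extChartAt I x₀).left_inv (hs s hs').1]
      rfl
    let d : C(Icc (-1 : ℝ) 1, E) := ⟨fun s => extChartAt I x₀ (φ (q.1 * s) q.2), by
      rw [continuous_iff_continuousAt]
      exact fun s => ContinuousAt.comp (f := Subtype.val)
        (g := fun s => extChartAt I x₀ (φ (q.1 * s) q.2)) (hd s s.2).continuousAt
        continuous_subtype_val.continuousAt⟩
    have h6 := isIntegralSolution_of_hasDerivAt (h.contDiffOn x₀).continuousOn hd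
      (fun s hs' => (extChartAt I x₀).map_source (hs s hs').1) (c := d) (fun s => rfl)
    rw [mul_zero, Flow.map_zero_apply] at h6
    have h7 := hun _ hq d (fun s => (hs s s.2).2) h6
    have h8 : d ⟨1, by norm_num⟩ = extChartAt I x₀ (φ q.1 q.2) := by
      change extChartAt I x₀ (φ (q.1 * 1) q.2) = _
      rw [mul_one]
    have h9 := (hs 1 (by norm_num)).1
    rw [mul_one] at h9
    rw [← h7, h8, (extChartAt I x₀).left_inv h9]
  refine ContMDiffAt.congr_of_eventuallyEq ?_ hev
  have h1 : ContMDiffAt (𝓘(ℝ, ℝ).prod I) 𝓘(ℝ, ℝ × E) 1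
      (fun q : ℝ × M => (q.1, extChartAt I x₀ q.2)) (0, x₀) := by
    refine contMDiffAt_fst.prodMk_space ?_
    exact ContMDiffAt.comp (g := extChartAt I x₀) (f := Prod.snd) (0, x₀)
      (contMDiffAt_extChartAt (I := I) (n := 1)) contMDiffAt_snd
  let ev : C(Icc (-1 : ℝ) 1, E) →L[ℝ] E := ContinuousMap.evalCLM ℝ ⟨1, by norm_num⟩
  have h2 : ContDiffAt ℝ 1 (fun z => ev (c z)) (0, y₀) :=
    ev.contDiff.contDiffAt.comp _ (hc.contDiffAt (hO.mem_nhds hO0))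
  have h3 : ContMDiffAt 𝓘(ℝ, E) I 1 (extChartAt I x₀).symm (ev (c (0, y₀))) := by
    refine (contMDiffOn_extChartAt_symm (I := I) (n := 1) x₀).contMDiffAt
      ((isOpen_target x₀).mem_nhds ?_)
    exact ((hsol _ hO0).1 _).1
  exact h3.comp (f := fun q : ℝ × M => ev (c (q.1, extChartAt I x₀ q.2))) (0, x₀)
    (h2.contMDiffAt.comp (f := fun q : ℝ × M => (q.1, extChartAt I x₀ q.2)) (0, x₀) h1)

variable [CompactSpace M]

/-- The flow of a `C¹` vector field is `C¹`. -/
theorem IsC1Flow.contMDiff (h : IsC1Flow I X φ) :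
    ContMDiff (𝓘(ℝ, ℝ).prod I) I 1 (fun q : ℝ × M => φ q.1 q.2) := by
  have hev : ∀ᶠ t in 𝓝 (0 : ℝ), ∀ x ∈ (univ : Set M),
      ContMDiffAt (𝓘(ℝ, ℝ).prod I) I 1 (fun q : ℝ × M => φ q.1 q.2) (t, x) := by
    refine isCompact_univ.eventually_forall_of_forall_eventually
      (P := fun t x => ContMDiffAt (𝓘(ℝ, ℝ).prod I) I 1 (fun q : ℝ × M => φ q.1 q.2) (t, x))
      fun x _ => ?_
    exact (contMDiffAt_iff_contMDiffAt_nhds (by simp)).1 (h.contMDiffAt_zero x)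
  obtain ⟨η, hη, hη'⟩ := Metric.eventually_nhds_iff.1 hev
  rintro ⟨t, x⟩
  obtain ⟨n, hn⟩ := exists_nat_gt (|t| / η)
  have hn0 : (0 : ℝ) < n := lt_of_le_of_lt (by positivity) hn
  set u := t / n with hu
  have huη : dist u 0 < η := by
    rw [dist_zero_right, Real.norm_eq_abs, hu, abs_div, Nat.abs_cast, div_lt_iff₀ hn0]
    rwa [div_lt_iff₀ hη, mul_comm] at hn
  have hS : ∀ (k : ℕ) (x : M),
      ContMDiffAt (𝓘(ℝ, ℝ).prod I) I 1 (fun q : ℝ × M => φ q.1 q.2) (k * u, x) := by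
    intro k
    induction k with
    | zero => intro x; simpa using h.contMDiffAt_zero x
    | succ k ih =>
      intro x
      have h1 : ContMDiffAt (𝓘(ℝ, ℝ).prod I) (𝓘(ℝ, ℝ).prod I) 1
          (fun q : ℝ × M => (q.1 - u, q.2)) (((k + 1 : ℕ) : ℝ) * u, x) := by
        refine ContMDiffAt.prodMk ?_ contMDiffAt_snd
        exact contMDiffAt_fst.sub contMDiffAt_const
      have hk : (((k + 1 : ℕ) : ℝ) * u - u, x) = (k * u, x) := by
        rw [Prod.mk.injEq]
        exact ⟨by push_cast; ring, rfl⟩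
      have h2 : ContMDiffAt (𝓘(ℝ, ℝ).prod I) I 1
          (fun q : ℝ × M => φ (q.1 - u) q.2) (((k + 1 : ℕ) : ℝ) * u, x) :=
        ContMDiffAt.comp (g := fun q : ℝ × M => φ q.1 q.2) (f := fun q : ℝ × M => (q.1 - u, q.2))
          (((k + 1 : ℕ) : ℝ) * u, x) (by rw [hk]; exact ih x) h1
      have h3 : ContMDiffAt (𝓘(ℝ, ℝ).prod I) (𝓘(ℝ, ℝ).prod I) 1
          (fun q : ℝ × M => (u, φ (q.1 - u) q.2)) (((k + 1 : ℕ) : ℝ) * u, x) :=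
        contMDiffAt_const.prodMk h2
      have h4 := ContMDiffAt.comp (g := fun q : ℝ × M => φ q.1 q.2)
        (f := fun q : ℝ × M => (u, φ (q.1 - u) q.2)) (((k + 1 : ℕ) : ℝ) * u, x)
        (hη' huη _ (mem_univ _)) h3
      refine h4.congr_of_eventuallyEq (Eventually.of_forall fun q => ?_)
      simp only [Function.comp, ← Flow.map_add, add_sub_cancel]
  have := hS n x
  rwa [hu, mul_div_cancel₀ _ hn0.ne'] at this

variable [IsRiemannianManifold I M]

/-- The flow is locally Lipschitz. -/
theorem IsC1Flow.locLipAt (h : IsC1Flow I X φ) (q : ℝ × M) :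
    LocLipAt (fun q : ℝ × M => φ q.1 q.2) q := by
  obtain ⟨t₀, x₀⟩ := q
  set y₀ := extChartAt I x₀ x₀ with hy₀
  have h1 : ContMDiffAt 𝓘(ℝ, ℝ × E) I 1 (fun z : ℝ × E => φ z.1 ((extChartAt I x₀).symm z.2))
      (t₀, y₀) := by
    have h2 : ContMDiffAt 𝓘(ℝ, E) I 1 (extChartAt I x₀).symm y₀ :=
      (contMDiffOn_extChartAt_symm (I := I) (n := 1) x₀).contMDiffAt
        ((isOpen_target x₀).mem_nhds (mem_extChartAt_target x₀))
    have h3 : ContMDiffAt 𝓘(ℝ, ℝ × E) (𝓘(ℝ, ℝ).prod I) 1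
        (fun z : ℝ × E => (z.1, (extChartAt I x₀).symm z.2)) (t₀, y₀) := by
      refine ContMDiffAt.prodMk contDiff_fst.contMDiff.contMDiffAt ?_
      exact ContMDiffAt.comp (g := (extChartAt I x₀).symm) (f := Prod.snd) (t₀, y₀) h2
        contDiff_snd.contMDiff.contMDiffAt
    exact ContMDiffAt.comp (g := fun q : ℝ × M => φ q.1 q.2)
      (f := fun z : ℝ × E => (z.1, (extChartAt I x₀).symm z.2)) (t₀, y₀) (h.contMDiff _) h3
  have h2 : LocLipAt (fun q : ℝ × M => (q.1, extChartAt I x₀ q.2)) (t₀, x₀) :=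
    (LocLipAt.fst _).prodMk (LocLipAt.comp (g := extChartAt I x₀) (f := Prod.snd)
      (locLipAt_extChartAt I x₀) (LocLipAt.snd _))
  refine (LocLipAt.comp (f := fun q : ℝ × M => (q.1, extChartAt I x₀ q.2))
    (ContMDiffAt.locLipAt_of_normedSpace h1) h2).congr ?_
  have h3 : ∀ᶠ q : ℝ × M in 𝓝 (t₀, x₀), q.2 ∈ (extChartAt I x₀).source :=
    continuousAt_snd.eventually (extChartAt_source_mem_nhds (I := I) x₀)
  filter_upwards [h3] with q hq
  simp only [Function.comp, (extChartAt I x₀).left_inv hq]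

/-- The flow is Lipschitz at small scales, uniformly for `|t| ≤ 1`. -/
theorem IsC1Flow.exists_lipschitz (h : IsC1Flow I X φ) : ∃ V δ : ℝ, 1 ≤ V ∧ 0 < δ ∧
    (∀ (x : M) (t : ℝ), |t| < δ → edist (φ t x) x ≤ ENNReal.ofReal (V * |t|)) ∧
    (∀ (x y : M) (t s : ℝ), |t| ≤ 1 → s < δ → edist x y ≤ ENNReal.ofReal s →
      edist (φ t x) (φ t y) ≤ ENNReal.ofReal (V * s)) := by
  obtain ⟨C, δ, hδ, hC⟩ := (isCompact_Icc (a := (-1 : ℝ)) (b := 1)).prod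
    (isCompact_univ (X := M)) |>.exists_edist_le_of_locLipAt (f := fun q : ℝ × M => φ q.1 q.2)
    (fun q _ => h.locLipAt q)
  refine ⟨C + 1, δ, by simp, hδ, fun x t ht => ?_, fun x y t s ht hs hxy => ?_⟩
  · have h1 : edist ((0 : ℝ), x) (t, x) = ENNReal.ofReal |t| := by
      rw [Prod.edist_eq, edist_self, edist_dist, dist_zero_left]
      simp
    have h2 := hC (0, x) ⟨by norm_num, mem_univ _⟩ (t, x) (by
      rw [h1, ← ENNReal.ofReal_coe_nnreal]
      exact (ENNReal.ofReal_lt_ofReal_iff (by exact_mod_cast hδ)).2 ht)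
    rw [h1, Flow.map_zero_apply, edist_comm] at h2
    refine h2.trans ?_
    rw [ENNReal.ofReal_mul (by positivity), ENNReal.ofReal_add (by positivity) zero_le_one,
      ENNReal.ofReal_coe_nnreal]
    gcongr
    exact le_self_add
  · have h1 : edist (t, x) (t, y) = edist x y := by
      rw [Prod.edist_eq, edist_self]
      simp
    have h2 := hC (t, x) ⟨abs_le.1 ht, mem_univ _⟩ (t, y) (by
      rw [h1, ← ENNReal.ofReal_coe_nnreal]
      exact hxy.trans_lt ((ENNReal.ofReal_lt_ofReal_iff (by exact_mod_cast hδ)).2 hs))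
    rw [h1] at h2
    refine h2.trans ?_
    rw [ENNReal.ofReal_mul (by positivity), ENNReal.ofReal_add (by positivity) zero_le_one,
      ENNReal.ofReal_coe_nnreal]
    gcongr
    exact le_self_add

omit [CompactSpace M] [IsRiemannianManifold I M] in
/-- The norm of a continuous vector field is bounded. -/
theorem IsC1Flow.exists_tnorm_le [CompactSpace M] [IsRiemannianManifold I M]
    (h : IsC1Flow I X φ) : ∃ B : ℝ, 0 < B ∧ ∀ p, tnorm I p (X p) ≤ B := by
  have hloc : ∀ x₀ : M, ∃ W ∈ 𝓝 x₀, ∃ B : ℝ, ∀ p ∈ W, tnorm I p (X p) ≤ B := by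
    intro x₀
    obtain ⟨C, hC, h1⟩ := exists_tnorm_le_norm_chartDeriv I x₀
    have h2 : ContinuousAt (fun p => ‖coordField I X x₀ (extChartAt I x₀ p)‖) x₀ := by
      refine ContinuousAt.norm ?_
      exact ContinuousAt.comp (g := coordField I X x₀) (f := extChartAt I x₀)
        ((h.contDiffOn x₀).continuousOn.continuousAt
          ((isOpen_target x₀).mem_nhds (mem_extChartAt_target x₀))) (continuousAt_extChartAt x₀)
    refine ⟨_, inter_mem (inter_mem h1 (extChartAt_source_mem_nhds (I := I) x₀))
      (h2.eventually (gt_mem_nhds (lt_add_one _))), C *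
        (‖coordField I X x₀ (extChartAt I x₀ x₀)‖ + 1), fun p hp => ?_⟩
    obtain ⟨⟨hp1, hp2⟩, hp3⟩ := hp
    refine (hp1 (X p)).trans ?_
    refine mul_le_mul_of_nonneg_left ?_ hC.le
    have h3 : coordField I X x₀ (extChartAt I x₀ p) = chartDeriv I x₀ p (X p) := by
      rw [coordField, (extChartAt I x₀).left_inv hp2]
    rw [← h3]
    exact le_of_lt hp3
  choose W hW B hB using hloc
  obtain ⟨t, ht⟩ := CompactSpace.elim_nhds_subcover W hW
  refine ⟨∑ x ∈ t, |B x| + 1, by positivity, fun p => ?_⟩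
  have : p ∈ ⋃ x ∈ t, W x := ht ▸ mem_univ p
  simp only [mem_iUnion] at this
  obtain ⟨x, hx, hpx⟩ := this
  have h1 : |B x| ≤ ∑ x ∈ t, |B x| :=
    Finset.single_le_sum (f := fun x => |B x|) (fun _ _ => abs_nonneg _) hx
  have h2 := hB x p hpx
  have h3 := le_abs_self (B x)
  linarith

end FlowRegularity

/-! ### Orbits in exponential charts -/

section Radial

set_option linter.unusedSectionVars false

variable {E : Type*} [NormedAddCommGroup E] [NormedSpace ℝ E] [FiniteDimensional ℝ E]
  {H : Type*} [TopologicalSpace H] {I : ModelWithCorners ℝ E H} [I.Boundaryless]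
  {M : Type*} [EMetricSpace M] [ChartedSpace H M] [IsManifold I ∞ M]
  [RiemannianBundle (fun x : M => TangentSpace I x)]
  [IsContMDiffRiemannianBundle I ∞ E (fun x : M => TangentSpace I x)]

variable (I) in
/-- The scalar product with `b` at `p`, as a linear form. -/
def metricForm (p : M) (b : E) : E →L[ℝ] ℝ :=
  LinearMap.toContinuousLinearMap
    { toFun := fun a => metricAt I p a b
      map_add' := fun _ _ => inner_add_left _ _ _
      map_smul' := fun _ _ => inner_smul_left _ _ _ }

variable (I) in
/-- The component of `ξ` in the direction of `X` at `p`; it vanishes on the transverse disc. -/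
def radial (X : (x : M) → TangentSpace I x) (p : M) (ξ : M → E) (x : M) : ℝ :=
  metricAt I p (ξ x) (X p)

variable {X : (x : M) → TangentSpace I x} {φ : Flow ℝ M} {p : M} {r c C : ℝ} {N : Set M} {ξ : M → E}

theorem IsExpChart.contMDiffAt_radial (hN : IsExpChart I X p r c C N ξ) {x : M} (hx : x ∈ N) :
    ContMDiffAt I 𝓘(ℝ, ℝ) ∞ (radial I X p ξ) x :=
  (metricForm I p (X p)).contDiff.contDiffAt.contMDiffAt.comp x (hN.contMDiffAt x hx)

theorem IsC1Flow.exists_hasDerivAt_radial (h : IsC1Flow I X φ)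
    (hN : IsExpChart I X p r c C N ξ) {x : M} {s : ℝ} (hx : φ s x ∈ N) :
    ∃ d, c ≤ d ∧ HasDerivAt (fun s => radial I X p ξ (φ s x)) d s := by
  refine ⟨_, hN.le_metricAt _ hx, ?_⟩
  have h1 := h.hasDerivAt_comp ((hN.contMDiffAt _ hx).mdifferentiableAt (by simp))
  exact (metricForm I p (X p)).hasFDerivAt.comp_hasDerivAt s h1

/-- The radial component increases along orbits. -/
theorem IsC1Flow.mul_le_radial_sub (h : IsC1Flow I X φ)
    (hN : IsExpChart I X p r c C N ξ) {x : M} {a b : ℝ} (hab : a ≤ b)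
    (hx : ∀ s ∈ Icc a b, φ s x ∈ N) :
    c * (b - a) ≤ radial I X p ξ (φ b x) - radial I X p ξ (φ a x) := by
  rcases hab.eq_or_lt with rfl | hab
  · simp
  have hd : ∀ s, ∃ d, s ∈ Icc a b → c ≤ d ∧ HasDerivAt (fun s => radial I X p ξ (φ s x)) d s := by
    intro s
    by_cases hs : s ∈ Icc a b
    · obtain ⟨d, hd⟩ := h.exists_hasDerivAt_radial hN (hx s hs)
      exact ⟨d, fun _ => hd⟩
    · exact ⟨0, fun h => (hs h).elim⟩
  choose d hd using hd
  obtain ⟨s, hs, hs'⟩ := exists_hasDerivAt_eq_slope (fun s => radial I X p ξ (φ s x)) d hab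
    (fun s hs => (hd s hs).2.continuousAt.continuousWithinAt)
    (fun s hs => (hd s ⟨hs.1.le, hs.2.le⟩).2)
  have h1 := (hd s ⟨hs.1.le, hs.2.le⟩).1
  rw [hs', le_div_iff₀ (sub_pos.2 hab)] at h1
  exact h1

end Radial

/-! ### Combinatorial lemmas -/

section Combinatorics

/-- Maximal independent sets of finite graphs. -/
theorem Finset.exists_maximal_independent {α : Type*} [DecidableEq α] (Z : Finset α)
    {R : α → α → Prop} (hrefl : ∀ x, R x x) (hsymm : ∀ x y, R x y → R y x) :
    ∃ Q ⊆ Z, (∀ x ∈ Q, ∀ y ∈ Q, R x y → x = y) ∧ ∀ z ∈ Z, ∃ q ∈ Q, R z q := by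
  induction Z using Finset.induction_on with
  | empty => exact ⟨∅, by simp, by simp, by simp⟩
  | insert a s _ ih =>
    obtain ⟨Q, hQs, hQ, hQm⟩ := ih
    by_cases h : ∃ q ∈ Q, R a q
    · refine ⟨Q, hQs.trans (Finset.subset_insert _ _), hQ, fun z hz => ?_⟩
      rcases Finset.mem_insert.1 hz with rfl | hz
      exacts [h, hQm z hz]
    · push Not at h
      refine ⟨insert a Q, Finset.insert_subset_insert _ hQs, ?_, ?_⟩
      · intro x hx y hy hxy
        rcases Finset.mem_insert.1 hx with rfl | hx' <;>
        rcases Finset.mem_insert.1 hy with rfl | hy'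
        · rfl
        · exact (h y hy' hxy).elim
        · exact (h x hx' (hsymm _ _ hxy)).elim
        · exact hQ x hx' y hy' hxy
      · intro z hz
        rcases Finset.mem_insert.1 hz with rfl | hz
        · exact ⟨z, Finset.mem_insert_self _ _, hrefl z⟩
        · obtain ⟨q, hq, hzq⟩ := hQm z hz
          exact ⟨q, Finset.mem_insert_of_mem hq, hzq⟩

open Classical in
/-- Greedy choice of one of `K + 1` values at each vertex of a graph of degree at most `K`, when each
neighbour excludes at most one value. -/
theorem Finset.exists_greedy {α : Type*} (Q : Finset α) {K : ℕ} {nb : α → α → Prop}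
    (hnb : ∀ a ∈ Q, (Q.filter (nb a)).card ≤ K) {Conf : α → Fin (K + 1) → α → Fin (K + 1) → Prop}
    (hsymm : ∀ a k b l, Conf a k b l → Conf b l a k) (hconf : ∀ a k b l, Conf a k b l → nb a b)
    (huniq : ∀ a b l k k', Conf a k b l → Conf a k' b l → k = k') :
    ∃ f : α → Fin (K + 1), ∀ a ∈ Q, ∀ b ∈ Q, a ≠ b → ¬ Conf a (f a) b (f b) := by
  suffices H : ∀ s ⊆ Q, ∃ f : α → Fin (K + 1), ∀ a ∈ s, ∀ b ∈ s, a ≠ b → ¬ Conf a (f a) b (f b) from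
    H Q subset_rfl
  intro s
  induction s using Finset.induction_on with
  | empty => exact fun _ => ⟨fun _ => 0, by simp⟩
  | insert a s has ih =>
    intro hs
    obtain ⟨f, hf⟩ := ih ((Finset.subset_insert _ _).trans hs)
    have hcard : ((s.filter (nb a)).biUnion
        fun b => Finset.univ.filter fun k => Conf a k b (f b)).card ≤ K := by
      refine (Finset.card_biUnion_le_card_mul _ _ 1 fun b _ => ?_).trans ?_
      · refine Finset.card_le_one.2 fun k hk k' hk' => ?_
        exact huniq a b (f b) k k' (Finset.mem_filter.1 hk).2 (Finset.mem_filter.1 hk').2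
      · rw [mul_one]
        refine (Finset.card_le_card ?_).trans (hnb a (hs (Finset.mem_insert_self _ _)))
        exact Finset.filter_subset_filter _ ((Finset.subset_insert _ _).trans hs)
    obtain ⟨k, hk⟩ : ∃ k, k ∉ (s.filter (nb a)).biUnion
        fun b => Finset.univ.filter fun k => Conf a k b (f b) := by
      by_contra! h
      have h1 := Finset.card_le_card (fun k _ => h k : (Finset.univ : Finset (Fin (K + 1))) ⊆ _)
      rw [Finset.card_univ, Fintype.card_fin] at h1
      omega
    have hk' : ∀ b ∈ s, ¬ Conf a k b (f b) := by
      intro b hb hc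
      refine hk (Finset.mem_biUnion.2 ⟨b, Finset.mem_filter.2 ⟨hb, hconf _ _ _ _ hc⟩, ?_⟩)
      exact Finset.mem_filter.2 ⟨Finset.mem_univ _, hc⟩
    refine ⟨Function.update f a k, fun x hx y hy hxy => ?_⟩
    have hne : ∀ b ∈ s, b ≠ a := fun b hb h => has (h ▸ hb)
    rcases Finset.mem_insert.1 hx with rfl | hx' <;>
        rcases Finset.mem_insert.1 hy with rfl | hy'
    · exact (hxy rfl).elim
    · rw [Function.update_self, Function.update_of_ne (hne y hy')]
      exact hk' y hy'
    · rw [Function.update_self, Function.update_of_ne (hne x hx')]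
      exact fun h => hk' x hx' (hsymm _ _ _ _ h)
    · rw [Function.update_of_ne (hne x hx'), Function.update_of_ne (hne y hy')]
      exact hf x hx' y hy' hxy

end Combinatorics

theorem edist_triangle_ofReal {M : Type*} [PseudoEMetricSpace M] {x y z : M} {a b : ℝ} (ha : 0 ≤ a)
    (hb : 0 ≤ b) (hxy : edist x y ≤ ENNReal.ofReal a) (hyz : edist y z ≤ ENNReal.ofReal b) :
    edist x z ≤ ENNReal.ofReal (a + b) := by
  rw [ENNReal.ofReal_add ha hb]
  exact (edist_triangle _ _ _).trans (add_le_add hxy hyz)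

section Packing

/-- Separated sets of bounded diameter in a finite-dimensional space have boundedly many points. -/
theorem exists_card_le_of_separated (E : Type*) [NormedAddCommGroup E] [NormedSpace ℝ E]
    [FiniteDimensional ℝ E] (A : ℝ) {ε : ℝ} (hε : 0 < ε) :
    ∃ K : ℕ, ∀ {α : Type*} (Z : Finset α) (u : α → E), (∀ z ∈ Z, ‖u z‖ ≤ A) →
      (∀ z ∈ Z, ∀ w ∈ Z, z ≠ w → ε ≤ ‖u z - u w‖) → Z.card ≤ K := by
  have : ProperSpace E := FiniteDimensional.proper ℝ E
  obtain ⟨t, -, htf, ht⟩ := (isCompact_closedBall (0 : E) A).finite_cover_balls (half_pos hε)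
  refine ⟨htf.toFinset.card, fun {α} Z u hu hsep => ?_⟩
  have hex : ∀ z ∈ Z, ∃ y ∈ t, dist (u z) y < ε / 2 := by
    intro z hz
    have := ht (show u z ∈ Metric.closedBall 0 A by simpa using hu z hz)
    simpa using this
  choose! g hgt hg using hex
  refine Finset.card_le_card_of_injOn g (fun z hz => by simpa using hgt z hz) ?_
  intro z hz w hw hzw
  by_contra hne
  have h1 := hsep z hz w hw hne
  have h2 := dist_triangle_right (u z) (u w) (g z)
  have h3 := hg z hz
  have h4 := hg w hw
  rw [← hzw] at h4
  rw [← dist_eq_norm] at h1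
  linarith

attribute [local instance] isContinuousRiemannianBundle_of_contMDiff in
/-- In a compact Riemannian manifold, the number of `s`-separated points in a ball of radius `A s` is
bounded independently of `s`, for small `s`. -/
theorem exists_packing_bound {E : Type*} [NormedAddCommGroup E] [NormedSpace ℝ E]
    [FiniteDimensional ℝ E] {H : Type*} [TopologicalSpace H] (I : ModelWithCorners ℝ E H)
    [I.Boundaryless] {M : Type*} [EMetricSpace M] [ChartedSpace H M] [IsManifold I ∞ M]
    [RiemannianBundle (fun x : M => TangentSpace I x)]
    [IsContMDiffRiemannianBundle I ∞ E (fun x : M => TangentSpace I x)]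
    [IsRiemannianManifold I M] [CompactSpace M] (A : ℝ) :
    ∃ (K : ℕ) (δ : ℝ), 0 < δ ∧ ∀ s : ℝ, 0 < s → s < δ → ∀ (Z : Finset M) (u : M → M)
      (x : M), (∀ z ∈ Z, edist (u z) x ≤ ENNReal.ofReal (A * s)) →
      (∀ z ∈ Z, ∀ w ∈ Z, z ≠ w → ENNReal.ofReal s ≤ edist (u z) (u w)) → Z.card ≤ K := by
  have hloc : ∀ x₀ : M, ∃ W ∈ 𝓝 x₀, ∃ K : ℕ, ∀ s : ℝ, 0 < s → ∀ (Z : Finset M)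
      (u : M → M) (x : M), (∀ z ∈ Z, u z ∈ W) →
      (∀ z ∈ Z, edist (u z) x ≤ ENNReal.ofReal (A * s)) →
      (∀ z ∈ Z, ∀ w ∈ Z, z ≠ w → ENNReal.ofReal s ≤ edist (u z) (u w)) → Z.card ≤ K := by
    intro x₀
    obtain ⟨C₁, W₁, hW₁, h1⟩ := exists_edist_le_edist_extChartAt I x₀
    obtain ⟨C₂, W₂, hW₂, h2⟩ := exists_edist_extChartAt_le I x₀
    have hε : (0 : ℝ) < 1 / (C₁ + 1) := by positivity
    obtain ⟨K, hK⟩ := exists_card_le_of_separated E (C₂ * (2 * |A|)) hε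
    refine ⟨_, inter_mem hW₁ hW₂, K, fun s hs Z u x hZW hZx hsep => ?_⟩
    rcases Z.eq_empty_or_nonempty with rfl | ⟨z₀, hz₀⟩
    · simp
    refine hK Z (fun z => s⁻¹ • (extChartAt I x₀ (u z) - extChartAt I x₀ (u z₀))) ?_ ?_
    · intro z hz
      have h3 : edist (u z) (u z₀) ≤ ENNReal.ofReal (2 * |A| * s) := by
        have hle : ENNReal.ofReal (A * s) ≤ ENNReal.ofReal (|A| * s) :=
          ENNReal.ofReal_le_ofReal (by gcongr; exact le_abs_self A)
        have h4 := edist_triangle_ofReal (by positivity) (by positivity) ((hZx z hz).trans hle)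
          ((edist_comm _ _).trans_le ((hZx z₀ hz₀).trans hle))
        refine h4.trans (ENNReal.ofReal_le_ofReal (by linarith))
      have h4 := (h2 _ (hZW z hz).2 _ (hZW z₀ hz₀).2).trans (mul_le_mul_right h3 _)
      rw [edist_dist, ← ENNReal.ofReal_coe_nnreal, ← ENNReal.ofReal_mul (by positivity),
        ENNReal.ofReal_le_ofReal_iff (by positivity), dist_eq_norm] at h4
      rw [norm_smul, norm_inv, Real.norm_of_nonneg hs.le, inv_mul_le_iff₀ hs]
      linarith
    · intro z hz w hw hzw
      have h3 := (hsep z hz w hw hzw).trans (h1 _ (hZW z hz).1 _ (hZW w hw).1)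
      rw [edist_dist, ← ENNReal.ofReal_coe_nnreal, ← ENNReal.ofReal_mul (by positivity),
        ENNReal.ofReal_le_ofReal_iff (by positivity), dist_eq_norm] at h3
      rw [← smul_sub, sub_sub_sub_cancel_right, norm_smul, norm_inv, Real.norm_of_nonneg hs.le,
        inv_mul_eq_div, le_div_iff₀ hs, div_mul_eq_mul_div, one_mul, div_le_iff₀ (by positivity)]
      have := norm_nonneg (extChartAt I x₀ (u z) - extChartAt I x₀ (u w))
      linarith
  choose W hW K hK using hloc
  obtain ⟨t, ht⟩ := CompactSpace.elim_nhds_subcover (fun x => interior (W x))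
    fun x => interior_mem_nhds.2 (hW x)
  obtain ⟨δ, hδ, h⟩ := lebesgue_number_lemma_of_emetric (isCompact_univ (X := M))
    (c := fun x : t => interior (W x)) (fun _ => isOpen_interior)
    (by rw [iUnion_subtype, ht]; exact subset_rfl)
  obtain ⟨δ', hδ'0, hδ'⟩ := ENNReal.lt_iff_exists_nnreal_btwn.1 hδ
  have hδ'pos : (0 : ℝ) < δ' := by exact_mod_cast hδ'0
  refine ⟨t.sup K, δ' / (|A| + 1), by positivity, fun s hs hsδ Z u x hZx hsep => ?_⟩
  obtain ⟨i, hi⟩ := h x (mem_univ x)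
  refine (hK i s hs Z u x (fun z hz => interior_subset (hi ?_)) hZx hsep).trans
    (Finset.le_sup i.2)
  rw [Metric.mem_eball]
  refine (hZx z hz).trans_lt (lt_of_le_of_lt ?_ hδ')
  rw [← ENNReal.ofReal_coe_nnreal]
  refine ENNReal.ofReal_le_ofReal ?_
  rw [lt_div_iff₀ (by positivity)] at hsδ
  have := le_abs_self A
  nlinarith

end Packing

/-! ### Transverse discs -/

section Discs

set_option linter.unusedSectionVars false

variable {E : Type*} [NormedAddCommGroup E] [NormedSpace ℝ E] [FiniteDimensional ℝ E]
  {H : Type*} [TopologicalSpace H] {I : ModelWithCorners ℝ E H} [I.Boundaryless]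
  {M : Type*} [EMetricSpace M] [ChartedSpace H M] [IsManifold I ∞ M]
  [RiemannianBundle (fun x : M => TangentSpace I x)]
  [IsContMDiffRiemannianBundle I ∞ E (fun x : M => TangentSpace I x)]
  [IsRiemannianManifold I M]

variable {X : (x : M) → TangentSpace I x} {φ : Flow ℝ M} {p : M} {r c C b : ℝ} {N : Set M}
  {ξ : M → E}

theorem IsExpChart.mem_transverseDisc (h : IsExpChart I X p r c C N ξ) (hb : b < r) {x : M} :
    x ∈ transverseDisc I X p b ↔ x ∈ N ∧ radial I X p ξ x = 0 ∧ tnorm I p (ξ x) ≤ b := by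
  constructor
  · rintro ⟨v, hv, hvb, rfl⟩
    have hlt : tnorm I p v < r := hvb.trans_lt hb
    refine ⟨h.expMap_mem v hlt, ?_, ?_⟩
    · rw [radial, h.apply_expMap v hlt]
      exact hv
    · rw [h.apply_expMap v hlt]
      exact hvb
  · rintro ⟨hx, h0, hxb⟩
    exact ⟨ξ x, h0, hxb, h.expMap_apply x hx⟩

theorem IsExpChart.mem_transverseDiscBoundary (h : IsExpChart I X p r c C N ξ) (hb : b < r)
    {x : M} : x ∈ transverseDiscBoundary I X p b ↔
      x ∈ N ∧ radial I X p ξ x = 0 ∧ tnorm I p (ξ x) = b := by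
  constructor
  · rintro ⟨v, hv, hvb, rfl⟩
    have hlt : tnorm I p v < r := hvb.trans_lt hb
    refine ⟨h.expMap_mem v hlt, ?_, ?_⟩
    · rw [radial, h.apply_expMap v hlt]
      exact hv
    · rw [h.apply_expMap v hlt]
      exact hvb
  · rintro ⟨hx, h0, hxb⟩
    exact ⟨ξ x, h0, hxb, h.expMap_apply x hx⟩

theorem IsExpChart.edist_le_of_mem_transverseDisc (h : IsExpChart I X p r c C N ξ) (hb : b < r)
    {x : M} (hx : x ∈ transverseDisc I X p b) : edist x p ≤ ENNReal.ofReal b := by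
  obtain ⟨hxN, -, hxb⟩ := (h.mem_transverseDisc hb).1 hx
  exact (h.edist_le x hxN).trans (ENNReal.ofReal_le_ofReal hxb)

theorem transverseDisc_mono {b b' : ℝ} (h : b ≤ b') :
    transverseDisc I X p b ⊆ transverseDisc I X p b' :=
  fun _ ⟨v, hv, hvb, hx⟩ => ⟨v, hv, hvb.trans h, hx⟩

theorem IsExpChart.mfderiv_comp_mfderiv_expMap (h : IsExpChart I X p r c C N ξ) {v : E}
    (hv : tnorm I p v < r) (w : E) :
    mfderiv I 𝓘(ℝ, E) ξ (expMap I p v) (mfderiv 𝓘(ℝ, E) I (expMap I p) v w) = w := by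
  have h1 := ((h.contMDiffAt _ (h.expMap_mem v hv)).mdifferentiableAt (by simp)).hasMFDerivAt
  have h2 := ((h.contMDiffAt_expMap v hv).mdifferentiableAt (by simp)).hasMFDerivAt
  have h3 := h1.comp v h2
  have h4 : HasMFDerivAt 𝓘(ℝ, E) 𝓘(ℝ, E) (ξ ∘ expMap I p) v (ContinuousLinearMap.id ℝ E) := by
    refine (hasMFDerivAt_id v).congr_of_eventuallyEq ?_
    filter_upwards [(isOpen_Iio.preimage (continuous_tnorm (I := I) p)).mem_nhds hv] with z hz
    exact h.apply_expMap z hz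
  exact congr($(hasMFDerivAt_unique h3 h4) w)

theorem IsExpChart.isEmbeddedTransverseDisc (h : IsExpChart I X p r c C N ξ) (hb : b < r)
    (hc : 0 < c) : IsEmbeddedTransverseDisc I X p b where
  smooth v _ hv := h.contMDiffAt_expMap v (lt_of_le_of_lt hv hb)
  injective v w _ hv _ hw hvw := by
    have h1 := h.apply_expMap v (lt_of_le_of_lt hv hb)
    rw [hvw] at h1
    exact h1.symm.trans (h.apply_expMap w (lt_of_le_of_lt hw hb))
  immersion v w _ hv _ hw0 := by
    have h1 := h.mfderiv_comp_mfderiv_expMap (v := v) (lt_of_le_of_lt hv hb) w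
    rw [hw0, map_zero] at h1
    exact h1.symm
  transverse v w _ hv hw hwX := by
    have hlt : tnorm I p v < r := lt_of_le_of_lt hv hb
    have h1 := h.mfderiv_comp_mfderiv_expMap hlt w
    rw [hwX] at h1
    have h2 := h.le_metricAt _ (h.expMap_mem v hlt)
    rw [h1] at h2
    have h3 : metricAt I p w (X p) = 0 := hw
    linarith

end Discs

/-! ### Choice of the centers of the discs -/

section Centers

set_option linter.unusedSectionVars false

variable {E : Type*} [NormedAddCommGroup E] [NormedSpace ℝ E] [FiniteDimensional ℝ E]
  {H : Type*} [TopologicalSpace H] {I : ModelWithCorners ℝ E H} [I.Boundaryless]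
  {M : Type*} [EMetricSpace M] [ChartedSpace H M] [IsManifold I ∞ M]
  [RiemannianBundle (fun x : M => TangentSpace I x)]
  [IsContMDiffRiemannianBundle I ∞ E (fun x : M => TangentSpace I x)]
  [IsRiemannianManifold I M]

variable (I) in
/-- Exponential charts at all points together with uniform bounds for the flow `φ` of `X`. -/
structure FlowCharts (X : (x : M) → TangentSpace I x) (φ : Flow ℝ M) (r c C V B δ : ℝ)
    (N : M → Set M) (ξ : M → M → E) : Prop where
  isC1Flow : IsC1Flow I X φ
  expChart : ∀ p, IsExpChart I X p r c C (N p) (ξ p)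
  r_pos : 0 < r
  c_pos : 0 < c
  C_pos : 0 < C
  one_le_V : 1 ≤ V
  B_pos : 0 < B
  δ_pos : 0 < δ
  edist_flow_le : ∀ (x : M) (t : ℝ), |t| < δ → edist (φ t x) x ≤ ENNReal.ofReal (V * |t|)
  edist_flow_flow_le : ∀ (x y : M) (t s : ℝ), |t| ≤ 1 → s < δ → edist x y ≤ ENNReal.ofReal s →
    edist (φ t x) (φ t y) ≤ ENNReal.ofReal (V * s)
  tnorm_le : ∀ p, tnorm I p (X p) ≤ B

theorem IsC1Flow.exists_flowCharts [CompactSpace M] {X : (x : M) → TangentSpace I x}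
    {φ : Flow ℝ M} (h : IsC1Flow I X φ) (hX₀ : ∀ p, X p ≠ 0) :
    ∃ r c C V B δ N ξ, FlowCharts I X φ r c C V B δ N ξ := by
  obtain ⟨r, c, C, hr, hc, hC, hN⟩ := exists_expChart I X hX₀ fun x₀ => (h.contDiffOn x₀).continuousOn
  choose N ξ hN using hN
  obtain ⟨V, δ, hV, hδ, h1, h2⟩ := h.exists_lipschitz
  obtain ⟨B, hB, hXB⟩ := h.exists_tnorm_le
  exact ⟨r, c, C, V, B, δ, N, ξ, h, hN, hr, hc, hC, hV, hB, hδ, h1, h2, hXB⟩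

namespace FlowCharts

variable {X : (x : M) → TangentSpace I x} {φ : Flow ℝ M} {r c C V B δ : ℝ} {N : M → Set M}
  {ξ : M → M → E}

theorem V_pos (h : FlowCharts I X φ r c C V B δ N ξ) : 0 < V := one_pos.trans_le h.one_le_V

/-- Orbits of points near `p` stay in the chart at `p` for a short time. -/
theorem flow_mem (h : FlowCharts I X φ r c C V B δ N ξ) {p x : M} {s t : ℝ} (hs : 0 ≤ s)
    (hx : edist x p ≤ ENNReal.ofReal s) (ht : |t| < δ) (hst : V * |t| + s < c) :
    φ t x ∈ N p ∧ edist (φ t x) p ≤ ENNReal.ofReal (V * |t| + s) := by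
  have hV := h.V_pos
  have h1 := edist_triangle_ofReal (by positivity) hs (h.edist_flow_le x t ht) hx
  exact ⟨(h.expChart p).mem_of_edist_lt _
    (h1.trans_lt ((ENNReal.ofReal_lt_ofReal_iff h.c_pos).2 hst)), h1⟩

/-- An orbit that passes close to `p` hits a small disc around `p` after a short time. -/
theorem exists_hit (h : FlowCharts I X φ r c C V B δ N ξ) : ∃ s₀ A : ℝ, 0 < s₀ ∧ 0 < A ∧
    ∀ (p x : M) (s : ℝ), 0 ≤ s → s ≤ s₀ → edist x p ≤ ENNReal.ofReal s →
      ∃ t : ℝ, |t| ≤ A * s ∧ φ t x ∈ N p ∧ radial I X p (ξ p) (φ t x) = 0 ∧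
        tnorm I p (ξ p (φ t x)) ≤ A * s := by
  have hV := h.V_pos
  have hc := h.c_pos
  have hC := h.C_pos
  have hB := h.B_pos
  have hδ := h.δ_pos
  set A₀ : ℝ := C * B / c with hA₀
  have hA₀pos : 0 < A₀ := by positivity
  set s₀ := min (δ / (2 * A₀)) (c / (2 * (V * A₀ + 1))) with hs₀
  have hs₀pos : 0 < s₀ := by positivity
  refine ⟨s₀, A₀ + C * (V * A₀ + 1), hs₀pos, by positivity, fun p x s hs hss₀ hx => ?_⟩
  have h1 : A₀ * s < δ := by
    have : s ≤ δ / (2 * A₀) := hss₀.trans (min_le_left _ _)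
    rw [le_div_iff₀ (by positivity)] at this
    nlinarith
  have h2 : (V * A₀ + 1) * s < c := by
    have : s ≤ c / (2 * (V * A₀ + 1)) := hss₀.trans (min_le_right _ _)
    rw [le_div_iff₀ (by positivity)] at this
    nlinarith
  have hin : ∀ t : ℝ, |t| ≤ A₀ * s → φ t x ∈ N p ∧
      edist (φ t x) p ≤ ENNReal.ofReal ((V * A₀ + 1) * s) := by
    intro t ht
    have h3 : V * |t| ≤ V * (A₀ * s) := by gcongr
    obtain ⟨h4, h5⟩ := h.flow_mem hs hx (ht.trans_lt h1) (by nlinarith)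
    exact ⟨h4, h5.trans (ENNReal.ofReal_le_ofReal (by nlinarith))⟩
  have htn : ∀ t : ℝ, |t| ≤ A₀ * s → tnorm I p (ξ p (φ t x)) ≤ C * ((V * A₀ + 1) * s) := by
    intro t ht
    obtain ⟨h3, h4⟩ := hin t ht
    refine ((h.expChart p).tnorm_le _ h3).trans ?_
    gcongr
    exact ENNReal.toReal_le_of_le_ofReal (by positivity) h4
  have h0 : |radial I X p (ξ p) (φ 0 x)| ≤ c * (A₀ * s) := by
    have h3 : φ 0 x ∈ N p := (hin 0 (by rw [abs_zero]; positivity)).1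
    rw [Flow.map_zero_apply] at h3 ⊢
    refine (abs_metricAt_le p _ _).trans ?_
    have h4 : tnorm I p (ξ p x) ≤ C * s := by
      refine ((h.expChart p).tnorm_le _ h3).trans ?_
      gcongr
      exact ENNReal.toReal_le_of_le_ofReal hs hx
    calc tnorm I p (ξ p x) * tnorm I p (X p) ≤ C * s * B := by
          gcongr
          · exact tnorm_nonneg _ _
          · exact h.tnorm_le p
      _ = c * (A₀ * s) := by rw [hA₀]; field_simp
  set τ := A₀ * s with hτ
  have hτ0 : 0 ≤ τ := by positivity
  have habs : ∀ t ∈ Icc (-τ) τ, |t| ≤ τ := fun t ht => abs_le.2 ht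
  have hup := h.isC1Flow.mul_le_radial_sub (h.expChart p) (x := x) hτ0
    (fun t ht => (hin t (habs t ⟨by linarith [ht.1], ht.2⟩)).1)
  have hdown := h.isC1Flow.mul_le_radial_sub (h.expChart p) (x := x) (a := -τ) (b := 0) (by linarith)
    (fun t ht => (hin t (habs t ⟨ht.1, by linarith [ht.2]⟩)).1)
  rw [abs_le] at h0
  have hcont : ContinuousOn (fun t => radial I X p (ξ p) (φ t x)) (Icc (-τ) τ) := fun t ht => by
    obtain ⟨d, -, hd⟩ := h.isC1Flow.exists_hasDerivAt_radial (h.expChart p)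
      (hin t (habs t ht)).1
    exact hd.continuousAt.continuousWithinAt
  obtain ⟨t, ht, ht0⟩ := intermediate_value_Icc (by linarith) hcont
    (show (0 : ℝ) ∈ Icc _ _ from ⟨by nlinarith, by nlinarith⟩)
  have := htn t (habs t ht)
  refine ⟨t, (habs t ht).trans ?_, (hin t (habs t ht)).1, ht0, this.trans ?_⟩
  · have : 0 ≤ C * (V * A₀ + 1) * s := by positivity
    nlinarith
  · nlinarith

/-- There are no short periodic orbits. -/
theorem flow_ne (h : FlowCharts I X φ r c C V B δ N ξ) {t : ℝ} (ht0 : 0 < t) (htδ : t < δ)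
    (htc : V * t < c) (x : M) : φ t x ≠ x := by
  intro heq
  have hV := h.V_pos
  have h1 := h.isC1Flow.mul_le_radial_sub (h.expChart x) (x := x) ht0.le (fun s hs =>
    (h.flow_mem (p := x) le_rfl (by simp) (by rw [abs_of_nonneg hs.1]; linarith [hs.2])
      (by rw [abs_of_nonneg hs.1]; nlinarith [hs.2])).1)
  rw [heq, Flow.map_zero_apply] at h1
  nlinarith [h.c_pos]

/-- The flow moves all points by a definite amount. -/
theorem exists_le_edist_flow [CompactSpace M] (h : FlowCharts I X φ r c C V B δ N ξ) {a b : ℝ}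
    (ha : 0 < a) (hbδ : b < δ) (hbc : V * b < c) :
    ∃ κ : ℝ, 0 < κ ∧ ∀ x, ∀ t ∈ Icc a b, ENNReal.ofReal κ ≤ edist (φ t x) x := by
  have hcomp : IsCompact (Icc a b ×ˢ (univ : Set M)) := isCompact_Icc.prod isCompact_univ
  have hcont : Continuous fun q : ℝ × M => edist (φ q.1 q.2) q.2 :=
    (φ.continuous continuous_fst continuous_snd).edist continuous_snd
  rcases (Icc a b ×ˢ (univ : Set M)).eq_empty_or_nonempty with he | hne
  · refine ⟨1, one_pos, fun x t ht => ?_⟩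
    have : (t, x) ∈ Icc a b ×ˢ (univ : Set M) := ⟨ht, mem_univ _⟩
    rw [he] at this
    exact this.elim
  obtain ⟨⟨t₀, x₀⟩, hq, hmin⟩ := hcomp.exists_isMinOn hne hcont.continuousOn
  have hV := h.V_pos
  have hpos : 0 < edist (φ t₀ x₀) x₀ := by
    rw [edist_pos]
    exact h.flow_ne (ha.trans_le hq.1.1) (hq.1.2.trans_lt hbδ)
      ((mul_le_mul_of_nonneg_left hq.1.2 hV.le).trans_lt hbc) x₀
  obtain ⟨κ, hκ0, hκ⟩ := ENNReal.lt_iff_exists_nnreal_btwn.1 hpos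
  refine ⟨κ, by exact_mod_cast hκ0, fun x t ht => ?_⟩
  rw [ENNReal.ofReal_coe_nnreal]
  exact hκ.le.trans (hmin (show (t, x) ∈ Icc a b ×ˢ (univ : Set M) from ⟨ht, mem_univ _⟩))

/-- There are disjoint small discs such that every orbit hits the discs of half their radius in every
time interval of a given length. -/
theorem exists_centers [CompactSpace M] (h : FlowCharts I X φ r c C V B δ N ξ) {T₀ b₀ : ℝ}
    (hT₀ : 0 < T₀) (hb₀ : 0 < b₀) :
    ∃ (n : ℕ) (p : Fin n → M) (b : ℝ), 0 < b ∧ b < b₀ ∧ b < r ∧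
      (Pairwise fun i j => Disjoint (transverseDisc I X (p i) b) (transverseDisc I X (p j) b)) ∧
      ∀ x, ∃ t ∈ Ioo 0 T₀, ∃ i, φ t x ∈ transverseDisc I X (p i) (b / 2) := by
  classical
  have hV := h.V_pos
  have hV1 := h.one_le_V
  have hδ := h.δ_pos
  obtain ⟨s₀, A, hs₀, hA, hhit⟩ := h.exists_hit
  -- the time scale
  set η := min (min (1 / 8) (T₀ / 10)) (min (δ / 2) (c / (2 * V))) with hη
  have hηpos : 0 < η := by have := h.c_pos; positivity
  have hη1 : η ≤ 1 / 8 := (min_le_left _ _).trans (min_le_left _ _)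
  have hηT : 10 * η ≤ T₀ := by
    have : η ≤ T₀ / 10 := (min_le_left _ _).trans (min_le_right _ _)
    linarith
  have hηδ : η < δ := by
    have : η ≤ δ / 2 := (min_le_right _ _).trans (min_le_left _ _)
    linarith
  have hηc : V * η < c := by
    have h1 : η ≤ c / (2 * V) := (min_le_right _ _).trans (min_le_right _ _)
    rw [le_div_iff₀ (by positivity)] at h1
    nlinarith [h.c_pos]
  -- the ratio of the spacing of the net to the radius
  set θ := 1 / (4 * A * V ^ 2) with hθ
  have hθpos : 0 < θ := by positivity
  obtain ⟨K, δ', hδ', hK⟩ := exists_packing_bound I (M := M) (4 * V ^ 2 / θ)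
  obtain ⟨κ, hκ, hκ'⟩ := h.exists_le_edist_flow (a := η / (K + 1)) (by positivity) hηδ hηc
  obtain ⟨b, hb, hbsmall⟩ : ∃ b : ℝ, 0 < b ∧ b < b₀ ∧ b < r ∧ b < η ∧ 2 * V * b < δ ∧
      2 * V * θ * b < δ ∧ 2 * V ^ 2 * θ * b < s₀ ∧ θ / (2 * V) * b < δ' ∧ 4 * b < κ := by
    have key : ∀ (m u : ℝ), 0 < u → ∀ᶠ b in 𝓝[>] (0 : ℝ), m * b < u := by
      intro m u hu
      have : Tendsto (fun b : ℝ => m * b) (𝓝[>] 0) (𝓝 0) := by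
        have h1 : Continuous fun b : ℝ => m * b := by fun_prop
        have := h1.tendsto 0
        rw [mul_zero] at this
        exact this.mono_left nhdsWithin_le_nhds
      exact this.eventually (gt_mem_nhds hu)
    have hev := (key 1 _ hb₀).and ((key 1 _ h.r_pos).and ((key 1 _ hηpos).and
      ((key (2 * V) _ hδ).and ((key (2 * V * θ) _ hδ).and ((key (2 * V ^ 2 * θ) _ hs₀).and
      ((key (θ / (2 * V)) _ hδ').and (key 4 _ hκ)))))))
    obtain ⟨b, hb', hb0⟩ := (hev.and self_mem_nhdsWithin).exists
    simp only [one_mul] at hb'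
    exact ⟨b, hb0, hb'⟩
  obtain ⟨hbb₀, hbr, hbη, hbδ, hθδ, hθs, hθδ', hbκ⟩ := hbsmall
  -- the net
  let R : M → M → Prop := fun x y => ∃ u : ℝ, |u| ≤ 2 * η ∧
    (edist x (φ u y) < ENNReal.ofReal (θ * b) ∨ edist y (φ u x) < ENNReal.ofReal (θ * b))
  have hθb : 0 < θ * b := by positivity
  obtain ⟨Z, -, hZ⟩ := isCompact_univ.elim_nhds_subcover (X := M)
    (fun x => Metric.eball x (ENNReal.ofReal (θ * b)))
    (fun x _ => Metric.eball_mem_nhds x (ENNReal.ofReal_pos.2 hθb))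
  obtain ⟨Q, hQZ, hQ, hQm⟩ := Z.exists_maximal_independent (R := R)
    (fun x => ⟨0, by rw [abs_zero]; positivity, Or.inl (by simpa using hθb)⟩)
    (fun x y ⟨u, hu, hxy⟩ => ⟨u, hu, hxy.symm⟩)
  have hnet : ∀ x, ∃ q ∈ Q, ∃ u : ℝ, |u| ≤ 2 * η ∧
      edist (φ u x) q ≤ ENNReal.ofReal (2 * V * θ * b) := by
    intro x
    have hx := hZ (mem_univ x)
    simp only [mem_iUnion] at hx
    obtain ⟨z, hz, hxz⟩ := hx
    obtain ⟨q, hq, u, hu, hzq⟩ := hQm z hz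
    have hθbδ : θ * b < δ := by nlinarith
    have hmove : ∀ u : ℝ, |u| ≤ 2 * η → edist (φ u x) (φ u z) ≤ ENNReal.ofReal (V * (θ * b)) :=
      fun u hu => h.edist_flow_flow_le x z u _ (by linarith) hθbδ (le_of_lt hxz)
    rcases hzq with hzq | hzq
    · have h1 := h.edist_flow_flow_le z (φ u q) (-u) _ (by rw [abs_neg]; linarith) hθbδ hzq.le
      rw [← Flow.map_add, neg_add_cancel, Flow.map_zero_apply] at h1
      refine ⟨q, hq, -u, by rwa [abs_neg], ?_⟩
      refine (edist_triangle_ofReal (by positivity) (by positivity)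
        (hmove (-u) (by rwa [abs_neg])) h1).trans (ENNReal.ofReal_le_ofReal (le_of_eq (by ring)))
    · refine ⟨q, hq, u, hu, ?_⟩
      refine (edist_triangle_ofReal (by positivity) (by positivity) (hmove u hu)
        (((edist_comm _ _).trans_le hzq.le).trans (ENNReal.ofReal_le_ofReal
          (show θ * b ≤ V * (θ * b) by nlinarith)))).trans
        (ENNReal.ofReal_le_ofReal (le_of_eq (by ring)))
  -- heights
  let ht : Fin (K + 1) → ℝ := fun k => (k : ℕ) * (η / (K + 1))
  have hK1 : (0 : ℝ) < K + 1 := by positivity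
  have ht0 : ∀ k, 0 ≤ ht k := fun k => by positivity
  have htη : ∀ k, ht k ≤ η := by
    intro k
    have : ((k : ℕ) : ℝ) ≤ K + 1 := by exact_mod_cast k.2.le
    calc ht k ≤ (K + 1) * (η / (K + 1)) := by
          change ((k : ℕ) : ℝ) * _ ≤ _
          gcongr
      _ = η := by field_simp
  let Conf : M → Fin (K + 1) → M → Fin (K + 1) → Prop := fun a k q l =>
    ¬ Disjoint (transverseDisc I X (φ (ht k) a) b) (transverseDisc I X (φ (ht l) q) b)
  have hConf : ∀ a k q l, Conf a k q l → ∃ y, edist y (φ (ht k) a) ≤ ENNReal.ofReal b ∧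
      edist y (φ (ht l) q) ≤ ENNReal.ofReal b := by
    intro a k q l hc
    obtain ⟨y, hy1, hy2⟩ := not_disjoint_iff.1 hc
    exact ⟨y, (h.expChart _).edist_le_of_mem_transverseDisc hbr hy1,
      (h.expChart _).edist_le_of_mem_transverseDisc hbr hy2⟩
  let nb : M → M → Prop := fun a q => ∃ u : ℝ, |u| ≤ η ∧
    edist (φ u q) a ≤ ENNReal.ofReal (2 * V * b)
  have hnb : ∀ a k q l, Conf a k q l → nb a q := by
    intro a k q l hc
    obtain ⟨y, hy1, hy2⟩ := hConf a k q l hc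
    have h1 := edist_triangle_ofReal hb.le hb.le ((edist_comm _ _).trans_le hy2) hy1
    have h2 := h.edist_flow_flow_le _ _ (-ht k) _
      (by rw [abs_neg, abs_of_nonneg (ht0 k)]; linarith [htη k]) (by nlinarith) h1
    rw [← Flow.map_add, ← Flow.map_add, neg_add_cancel, Flow.map_zero_apply] at h2
    refine ⟨-ht k + ht l, abs_le.2 ⟨?_, ?_⟩, h2.trans (ENNReal.ofReal_le_ofReal
      (le_of_eq (by ring)))⟩
    · linarith [htη k, ht0 l]
    · linarith [htη l, ht0 k]
  have hcard : ∀ a ∈ Q, (Q.filter (nb a)).card ≤ K := by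
    intro a _
    have hex : ∀ q, ∃ u : ℝ, nb a q → |u| ≤ η ∧ edist (φ u q) a ≤ ENNReal.ofReal (2 * V * b) := by
      intro q
      by_cases hq : nb a q
      · obtain ⟨u, hu⟩ := hq
        exact ⟨u, fun _ => hu⟩
      · exact ⟨0, fun h => (hq h).elim⟩
    choose u hu using hex
    refine hK (θ / (2 * V) * b) (by positivity) hθδ' _ (fun q => φ (u q) q) a ?_ ?_
    · intro q hq
      refine (hu q (Finset.mem_filter.1 hq).2).2.trans (ENNReal.ofReal_le_ofReal (le_of_eq ?_))
      field_simp
      ring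
    · intro q hq q' hq' hne
      by_contra! hlt
      obtain ⟨hqQ, hqn⟩ := Finset.mem_filter.1 hq
      obtain ⟨hqQ', hqn'⟩ := Finset.mem_filter.1 hq'
      refine hne (hQ q hqQ q' hqQ' ⟨-u q + u q', ?_, Or.inl ?_⟩)
      · have h1 := abs_le.1 (hu q hqn).1
        have h2 := abs_le.1 (hu q' hqn').1
        exact abs_le.2 ⟨by linarith, by linarith⟩
      · have hsδ : θ / (2 * V) * b < δ := by
          refine lt_of_le_of_lt ?_ hθδ
          have h1 : θ / (2 * V) ≤ 2 * V * θ := by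
            rw [div_le_iff₀ (by positivity)]
            nlinarith [mul_pos hθpos hV]
          nlinarith
        have h1 := h.edist_flow_flow_le _ _ (-u q) _
          (by rw [abs_neg]; linarith [(hu q hqn).1]) hsδ hlt.le
        rw [← Flow.map_add, ← Flow.map_add, neg_add_cancel, Flow.map_zero_apply] at h1
        refine h1.trans_lt ((ENNReal.ofReal_lt_ofReal_iff hθb).2 ?_)
        have : V * (θ / (2 * V) * b) = θ * b / 2 := by field_simp
        linarith
  have huniq' : ∀ a k k', ∀ q l, Conf a k q l → Conf a k' q l → ¬ k < k' := by
    intro a k k' q l h1 h2 hlt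
    obtain ⟨y, hy1, hy2⟩ := hConf a k q l h1
    obtain ⟨y', hy1', hy2'⟩ := hConf a k' q l h2
    have h3 := edist_triangle_ofReal hb.le hb.le ((edist_comm _ _).trans_le hy2) hy1
    have h4 := edist_triangle_ofReal hb.le hb.le ((edist_comm _ _).trans_le hy1') hy2'
    have h5 := edist_triangle_ofReal (by positivity) (by positivity) h4 h3
    have hkk : ((k : ℕ) : ℝ) + 1 ≤ ((k' : ℕ) : ℝ) := by exact_mod_cast hlt
    have h6 : η / (K + 1) ≤ ht k' - ht k := by
      have : ht k' - ht k = (((k' : ℕ) : ℝ) - ((k : ℕ) : ℝ)) * (η / (K + 1)) := by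
        simp only [ht]; ring
      rw [this]
      have : 0 < η / (K + 1) := by positivity
      nlinarith
    have h7 := hκ' (φ (ht k) a) (ht k' - ht k) ⟨h6, by linarith [htη k', ht0 k]⟩
    rw [← Flow.map_add, sub_add_cancel] at h7
    have h8 := h7.trans h5
    rw [ENNReal.ofReal_le_ofReal_iff (by positivity)] at h8
    linarith
  obtain ⟨f, hf⟩ := Q.exists_greedy (nb := nb) hcard (Conf := Conf)
    (fun a k q l hc hd => hc hd.symm) hnb
    (fun a q l k k' h1 h2 => by
      rcases lt_trichotomy k k' with hlt | heq | hlt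
      · exact (huniq' a k k' q l h1 h2 hlt).elim
      · exact heq
      · exact (huniq' a k' k q l h2 h1 hlt).elim)
  let e := Q.equivFin
  refine ⟨Q.card, fun i => φ (ht (f (e.symm i))) (e.symm i), b, hb, hbb₀, hbr, ?_, ?_⟩
  · intro i j hij
    have := hf (e.symm i) (e.symm i).2 (e.symm j) (e.symm j).2
      (fun heq => hij (e.symm.injective (Subtype.ext heq)))
    exact not_not.1 this
  · intro x
    obtain ⟨q, hq, u, hu, hxq⟩ := hnet (φ (5 * η) x)
    set k := f q
    have h1 := h.edist_flow_flow_le _ _ (ht k) _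
      (by rw [abs_of_nonneg (ht0 k)]; linarith [htη k]) hθδ hxq
    obtain ⟨t, ht1, ht2, ht3, ht4⟩ := hhit (φ (ht k) q) _ _ (by positivity)
      (show V * (2 * V * θ * b) ≤ s₀ by nlinarith) h1
    have hAb : A * (V * (2 * V * θ * b)) = b / 2 := by
      rw [hθ]; field_simp; norm_num
    rw [hAb] at ht1 ht4
    rw [← Flow.map_add, ← Flow.map_add, ← Flow.map_add] at ht2 ht3 ht4
    have hu' := abs_le.1 hu
    have ht1' := abs_le.1 ht1
    have hk0 := ht0 k
    have hk1 := htη k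
    refine ⟨t + ht k + u + 5 * η, ⟨by linarith, by linarith⟩, e ⟨q, hq⟩, ?_⟩
    simp only [Equiv.symm_apply_apply]
    exact ((h.expChart _).mem_transverseDisc (by linarith)).2 ⟨ht2, ht3, ht4⟩

end FlowCharts

end Centers

/-! ### Sections with return times bounded above and below -/

section UniformSection

/-- A section whose return times lie between `κ` and `T`. -/
structure IsUniformSection {M : Type*} [TopologicalSpace M] (φ : Flow ℝ M) (Λ : Set M) (κ T : ℝ) :
    Prop where
  κ_pos : 0 < κ
  le_of_mem : ∀ x ∈ Λ, ∀ t, 0 < t → φ t x ∈ Λ → κ ≤ t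
  exists_hit : ∀ x, ∃ t ∈ Ioo 0 T, φ t x ∈ Λ

namespace IsUniformSection

variable {M : Type*} [TopologicalSpace M] {φ : Flow ℝ M} {Λ : Set M} {κ T : ℝ}

theorem reverse (h : IsUniformSection φ Λ κ T) : IsUniformSection φ.reverse Λ κ T where
  κ_pos := h.κ_pos
  le_of_mem x hx t ht hxt := by
    refine h.le_of_mem _ hxt t ht ?_
    rw [Flow.reverse_apply, ← Flow.map_add]
    simpa using hx
  exists_hit x := by
    obtain ⟨t, ht, hxt⟩ := h.exists_hit (φ (-T) x)
    refine ⟨T - t, ⟨by linarith [ht.2], by linarith [ht.1]⟩, ?_⟩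
    rw [← Flow.map_add] at hxt
    rw [Flow.reverse_apply]
    convert hxt using 2
    ring

theorem exists_isLeast (h : IsUniformSection φ Λ κ T) (x : M) (a : ℝ) :
    ∃ t, IsLeast {t | a < t ∧ φ t x ∈ Λ} t ∧ t < a + T := by
  obtain ⟨t₀, ht₀, hxt₀⟩ := h.exists_hit (φ a x)
  rw [← Flow.map_add] at hxt₀
  set S := {t | a < t ∧ φ t x ∈ Λ} with hS
  have hne : S.Nonempty := ⟨t₀ + a, by linarith [ht₀.1], hxt₀⟩
  have hbdd : BddBelow S := ⟨a, fun t ht => ht.1.le⟩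
  obtain ⟨t, htS, htlt⟩ := exists_lt_of_csInf_lt hne (lt_add_of_pos_right (sInf S) h.κ_pos)
  have hmin : ∀ s ∈ S, t ≤ s := by
    intro s hs
    by_contra! hlt
    have h1 := h.le_of_mem _ hs.2 (t - s) (by linarith) (by
      rw [← Flow.map_add, sub_add_cancel]; exact htS.2)
    have h2 := csInf_le hbdd hs
    linarith
  exact ⟨t, ⟨htS, hmin⟩, (hmin _ ⟨by linarith [ht₀.1], hxt₀⟩).trans_lt (by linarith [ht₀.2])⟩

theorem isLeast_roofFunction (h : IsUniformSection φ Λ κ T) (x : M) :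
    IsLeast {t | 0 < t ∧ φ t x ∈ Λ} (roofFunction φ Λ x) := by
  obtain ⟨t, ht, -⟩ := h.exists_isLeast x 0
  rw [roofFunction, ht.csInf_eq]
  exact ht

theorem roofFunction_pos (h : IsUniformSection φ Λ κ T) (x : M) : 0 < roofFunction φ Λ x :=
  (h.isLeast_roofFunction x).1.1

theorem roofFunction_lt (h : IsUniformSection φ Λ κ T) (x : M) : roofFunction φ Λ x < T := by
  obtain ⟨t, ht, hT⟩ := h.exists_isLeast x 0
  rw [(h.isLeast_roofFunction x).unique ht]
  linarith

theorem poincareMap_mem (h : IsUniformSection φ Λ κ T) (x : M) : poincareMap φ Λ x ∈ Λ :=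
  (h.isLeast_roofFunction x).1.2

theorem le_roofFunction (h : IsUniformSection φ Λ κ T) {x : M} (hx : x ∈ Λ) :
    κ ≤ roofFunction φ Λ x :=
  h.le_of_mem x hx _ (h.roofFunction_pos x) (h.poincareMap_mem x)

/-- The hitting times of an orbit can be enumerated. -/
theorem exists_enumeration (h : IsUniformSection φ Λ κ T) (x : M) :
    ∃ τ : ℕ → ℝ, StrictMono τ ∧ Tendsto τ atTop atTop ∧ range τ = {t : ℝ | 0 < t ∧ φ t x ∈ Λ} := by
  choose nx hnx hnxT using h.exists_isLeast x
  let τ : ℕ → ℝ := fun n => Nat.rec (nx 0) (fun _ t => nx t) n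
  have hτ0 : τ 0 = nx 0 := rfl
  have hτs : ∀ n, τ (n + 1) = nx (τ n) := fun n => rfl
  have hmem : ∀ n, φ (τ n) x ∈ Λ := by
    intro n
    cases n with
    | zero => exact (hnx 0).1.2
    | succ n => exact (hnx (τ n)).1.2
  have hlt : ∀ n, τ n < τ (n + 1) := fun n => (hnx (τ n)).1.1
  have hmono : StrictMono τ := strictMono_nat_of_lt_succ hlt
  have hpos : ∀ n, 0 < τ n := fun n => (hnx 0).1.1.trans_le (hmono.monotone (Nat.zero_le n))
  have hgap : ∀ n, τ n + κ ≤ τ (n + 1) := by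
    intro n
    have := h.le_of_mem _ (hmem n) (τ (n + 1) - τ n) (sub_pos.2 (hlt n)) (by
      rw [← Flow.map_add, sub_add_cancel]; exact hmem (n + 1))
    linarith
  have hlin : ∀ n : ℕ, n * κ ≤ τ n := by
    intro n
    induction n with
    | zero => simpa using (hpos 0).le
    | succ n ih => push_cast; linarith [hgap n]
  have htend : Tendsto τ atTop atTop :=
    tendsto_atTop_mono hlin (tendsto_natCast_atTop_atTop.atTop_mul_const h.κ_pos)
  refine ⟨τ, hmono, htend, Subset.antisymm ?_ ?_⟩
  · rintro _ ⟨n, rfl⟩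
    exact ⟨hpos n, hmem n⟩
  · rintro t ⟨ht, hxt⟩
    have hex : ∃ n, t ≤ τ n := (htend.eventually_ge_atTop t).exists
    obtain ⟨m, hm, hmin⟩ : ∃ m, t ≤ τ m ∧ ∀ k < m, ¬ t ≤ τ k := by
      classical exact ⟨Nat.find hex, Nat.find_spec hex, fun k hk => Nat.find_min hex hk⟩
    refine ⟨m, le_antisymm ?_ hm⟩
    rcases m with _ | n
    · exact (hnx 0).2 ⟨ht, hxt⟩
    · exact (hnx (τ n)).2 ⟨not_le.1 (hmin n n.lt_succ_self), hxt⟩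

theorem isPoincareSection [MeasurableSpace M] (h : IsUniformSection φ Λ κ T)
    (hΛ : MeasurableSet Λ) : IsPoincareSection φ Λ where
  measurableSet := hΛ
  forward := h.exists_enumeration
  backward x := by
    obtain ⟨τ, hτ, htend, hr⟩ := h.reverse.exists_enumeration x
    refine ⟨fun n => -τ n, hτ.neg, tendsto_neg_atTop_atBot.comp htend, ?_⟩
    ext t
    have h1 := Set.ext_iff.1 hr (-t)
    simp only [mem_range, mem_setOf_eq, Flow.reverse_apply, neg_neg, neg_pos] at h1 ⊢
    rw [← h1]
    exact exists_congr fun n => neg_eq_iff_eq_neg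

/-- The iterates of the Poincaré map are given by the flow, at times of at most linear growth. -/
theorem exists_iterate_poincareMap (h : IsUniformSection φ Λ κ T) (x : M) (n : ℕ) :
    ∃ t, 0 ≤ t ∧ t ≤ n * T ∧ (poincareMap φ Λ)^[n] x = φ t x := by
  induction n with
  | zero => exact ⟨0, le_rfl, by simp, by simp⟩
  | succ n ih =>
    obtain ⟨t, ht0, htn, ht⟩ := ih
    refine ⟨roofFunction φ Λ (φ t x) + t, ?_, ?_, ?_⟩
    · linarith [h.roofFunction_pos (φ t x)]
    · push_cast
      linarith [h.roofFunction_lt (φ t x)]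
    · rw [Function.iterate_succ_apply', ht, poincareMap, ← Flow.map_add]

theorem iterate_poincareMap_mem (h : IsUniformSection φ Λ κ T) (x : M) {n : ℕ} (hn : 1 ≤ n) :
    (poincareMap φ Λ)^[n] x ∈ Λ := by
  obtain ⟨m, rfl⟩ := Nat.exists_eq_add_of_le' hn
  rw [Function.iterate_succ_apply']
  exact h.poincareMap_mem _

theorem roofSupLT (h : IsUniformSection φ Λ κ T) {a : ℝ} (ha : T < a) : RoofSupLT φ Λ a :=
  ⟨T, ha, fun x _ => (h.roofFunction_lt x).le⟩

theorem le_sInf_roofFunction (h : IsUniformSection φ Λ κ T) (hne : Λ.Nonempty) :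
    κ ≤ sInf (roofFunction φ Λ '' Λ) := by
  refine le_csInf (hne.image _) ?_
  rintro _ ⟨x, hx, rfl⟩
  exact h.le_roofFunction hx

theorem measurable_roofFunction [T2Space M] [MeasurableSpace M] [BorelSpace M]
    (h : IsUniformSection φ Λ κ T) (hΛ : IsCompact Λ) : Measurable (roofFunction φ Λ) := by
  refine measurable_of_Iic fun a => ?_
  have heq : roofFunction φ Λ ⁻¹' Iic a =
      ⋃ n : ℕ, (fun q : ℝ × M => φ (-q.1) q.2) '' (Icc (1 / ((n : ℝ) + 1)) a ×ˢ Λ) := by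
    ext x
    simp only [mem_preimage, mem_Iic, mem_iUnion, mem_image, Prod.exists, mem_prod]
    constructor
    · intro hx
      obtain ⟨n, hn⟩ := exists_nat_one_div_lt (h.roofFunction_pos x)
      refine ⟨n, roofFunction φ Λ x, poincareMap φ Λ x, ⟨⟨hn.le, hx⟩, h.poincareMap_mem x⟩, ?_⟩
      rw [poincareMap, ← Flow.map_add, neg_add_cancel, Flow.map_zero_apply]
    · rintro ⟨n, t, y, ⟨⟨hnt, hta⟩, hy⟩, rfl⟩
      have h1 : 0 < t := lt_of_lt_of_le (by positivity) hnt
      refine ((h.isLeast_roofFunction _).2 ⟨h1, ?_⟩).trans hta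
      rw [← Flow.map_add, add_neg_cancel, Flow.map_zero_apply]
      exact hy
  rw [heq]
  refine MeasurableSet.iUnion fun n => IsCompact.measurableSet ?_
  exact (isCompact_Icc.prod hΛ).image
    (φ.continuous continuous_fst.neg continuous_snd)

theorem measurable_poincareMap [T2Space M] [SecondCountableTopology M] [MeasurableSpace M]
    [BorelSpace M] (h : IsUniformSection φ Λ κ T) (hΛ : IsCompact Λ) :
    Measurable (poincareMap φ Λ) := by
  have h1 : Measurable fun q : ℝ × M => φ q.1 q.2 :=
    (φ.continuous continuous_fst continuous_snd).measurable
  exact h1.comp ((h.measurable_roofFunction hΛ).prodMk measurable_id)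

section Measure

variable [T2Space M] [SecondCountableTopology M] [MeasurableSpace M] [BorelSpace M]
  {μ : Measure M} [IsProbabilityMeasure μ]

/-- Flow tubes over a section have positive measure. -/
theorem measure_flowTube_ne_zero (h : IsUniformSection φ Λ κ T)
    (hμ : ∀ t, MeasurePreserving (φ t) μ μ) {ε : ℝ} (hε : 0 < ε) : μ (flowTube φ ε Λ) ≠ 0 := by
  intro h0
  have hcov : (univ : Set M) ⊆ ⋃ k : ℕ, φ (-(k * (ε / 2))) ⁻¹' flowTube φ ε Λ := by
    intro x _
    obtain ⟨t, ht, hxt⟩ := h.reverse.exists_hit x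
    rw [Flow.reverse_apply] at hxt
    have hε2 : 0 < ε / 2 := by positivity
    have hdpos : 0 < t / (ε / 2) := div_pos ht.1 hε2
    set m := ⌈t / (ε / 2)⌉₊ with hm
    have hm1 : 1 ≤ m := Nat.one_le_iff_ne_zero.2 (Nat.ceil_pos.2 hdpos).ne'
    have h1 : t / (ε / 2) ≤ m := Nat.le_ceil _
    have h2 : (m : ℝ) < t / (ε / 2) + 1 := Nat.ceil_lt_add_one hdpos.le
    rw [div_le_iff₀ hε2] at h1
    have h2' : ((m : ℝ) - 1) * (ε / 2) < t := by
      rw [← lt_div_iff₀ hε2]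
      linarith
    refine mem_iUnion.2 ⟨m - 1, ?_⟩
    rw [mem_preimage, flowTube]
    refine mem_iUnion₂.2 ⟨t - (m - 1 : ℕ) * (ε / 2), ?_, φ (-t) x, hxt, ?_⟩
    · push_cast [hm1]
      exact ⟨by linarith, by nlinarith⟩
    · rw [← Flow.map_add]
      congr 1
      ring
  have h1 : μ univ ≤ 0 := by
    refine (measure_mono hcov).trans ((measure_iUnion_le _).trans ?_)
    simp [fun t => (hμ t).quasiMeasurePreserving.preimage_null h0]
  simp at h1

theorem isProbabilityMeasure_inducedMeasure (h : IsUniformSection φ Λ κ T)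
    (hμ : ∀ t, MeasurePreserving (φ t) μ μ) (hΛ : IsCompact Λ) (hne : Λ.Nonempty) :
    IsProbabilityMeasure (inducedMeasure φ μ Λ) := by
  have h1 := h.le_sInf_roofFunction hne
  have := ProbabilityTheory.cond_isProbabilityMeasure (μ := μ)
    (h.measure_flowTube_ne_zero hμ (ε := sInf (roofFunction φ Λ '' Λ) / 2)
      (by linarith [h.κ_pos]))
  exact Measure.isProbabilityMeasure_map (h.reverse.measurable_poincareMap hΛ).aemeasurable

/-- A property which passes from `x` to `φ⁻ᵗ(x)` and holds almost everywhere also holds almost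
everywhere for the induced measure. -/
theorem ae_inducedMeasure (h : IsUniformSection φ Λ κ T) (hΛ : IsCompact Λ) {G : Set M}
    (hG : MeasurableSet G) (hae : ∀ᵐ x ∂μ, x ∈ G)
    (hinv : ∀ x ∈ G, ∀ t, 0 ≤ t → t ≤ T → φ (-t) x ∈ G) :
    ∀ᵐ x ∂(inducedMeasure φ μ Λ), x ∈ G := by
  have hm : Measurable (poincareMapInv φ Λ) := h.reverse.measurable_poincareMap hΛ
  rw [inducedMeasure]
  refine (ae_map_iff (p := fun x => x ∈ G) hm.aemeasurable hG).2 ?_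
  refine ProbabilityTheory.cond_absolutelyContinuous.ae_le (hae.mono fun x hx => ?_)
  exact hinv x hx _ (h.reverse.roofFunction_pos x).le (h.reverse.roofFunction_lt x).le

end Measure

end IsUniformSection

end UniformSection

/-! ### Unions of small transverse discs -/

section DiscUnion

set_option linter.unusedSectionVars false

variable {E : Type*} [NormedAddCommGroup E] [NormedSpace ℝ E] [FiniteDimensional ℝ E]
  {H : Type*} [TopologicalSpace H] {I : ModelWithCorners ℝ E H} [I.Boundaryless]
  {M : Type*} [EMetricSpace M] [ChartedSpace H M] [IsManifold I ∞ M]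
  [RiemannianBundle (fun x : M => TangentSpace I x)]
  [IsContMDiffRiemannianBundle I ∞ E (fun x : M => TangentSpace I x)]
  [IsRiemannianManifold I M]

attribute [local instance] isContinuousRiemannianBundle_of_contMDiff

theorem isCompact_setOf_tnorm_le (p : M) (b : ℝ) : IsCompact {v : E | tnorm I p v ≤ b} := by
  have hfin : FiniteDimensional ℝ (TangentSpace I p) := inferInstanceAs (FiniteDimensional ℝ E)
  have : ProperSpace (TangentSpace I p) := FiniteDimensional.proper ℝ _
  have h := isCompact_closedBall (0 : TangentSpace I p) b
  have heq : Metric.closedBall (0 : TangentSpace I p) b = {v : E | tnorm I p v ≤ b} := by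
    ext v
    simp only [Metric.mem_closedBall, dist_zero_right]
    rfl
  rw [heq] at h
  exact h

theorem exists_tnorm_le_norm (p : M) : ∃ C : ℝ, 0 < C ∧ ∀ v : E, tnorm I p v ≤ C * ‖v‖ := by
  obtain ⟨C, hC, h⟩ := exists_tnorm_le_norm_chartDeriv I p
  refine ⟨C * (‖chartDeriv I p p‖ + 1), by positivity, fun v => ?_⟩
  refine (h.self_of_nhds v).trans ?_
  rw [mul_assoc]
  gcongr
  refine ((chartDeriv I p p).le_opNorm v).trans ?_
  gcongr
  linarith

theorem abs_tnorm_sub_le (p : M) (v w : E) : |tnorm I p v - tnorm I p w| ≤ tnorm I p (v - w) :=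
  abs_norm_sub_norm_le (show TangentSpace I p from v) (show TangentSpace I p from w)

variable {X : (x : M) → TangentSpace I x} {φ : Flow ℝ M} {r c C V B δ : ℝ} {N : M → Set M}
  {ξ : M → M → E}

namespace FlowCharts

theorem isCompact_transverseDisc (h : FlowCharts I X φ r c C V B δ N ξ) (p : M) {b : ℝ}
    (hb : b < r) : IsCompact (transverseDisc I X p b) := by
  have heq : transverseDisc I X p b =
      expMap I p '' ({v : E | tnorm I p v ≤ b} ∩ {v : E | metricForm I p (X p) v = 0}) := by
    ext y
    constructor
    · rintro ⟨v, hv, hvb, rfl⟩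
      exact ⟨v, ⟨hvb, hv⟩, rfl⟩
    · rintro ⟨v, ⟨hvb, hv⟩, rfl⟩
      exact ⟨v, hv, hvb, rfl⟩
  rw [heq]
  refine ((isCompact_setOf_tnorm_le p b).inter_right
    (isClosed_singleton.preimage (metricForm I p (X p)).continuous)).image_of_continuousOn ?_
  intro v hv
  exact ((h.expChart p).contMDiffAt_expMap v
    (lt_of_le_of_lt hv.1 hb)).continuousAt.continuousWithinAt

theorem isCompact_discUnion (h : FlowCharts I X φ r c C V B δ N ξ) {n : ℕ} (p : Fin n → M) {b : ℝ}
    (hb : b < r) : IsCompact (discUnion I X p b) :=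
  isCompact_iUnion fun i => h.isCompact_transverseDisc (p i) hb

/-- The return times of a union of small disjoint discs are bounded below, uniformly in the
radius. -/
theorem exists_isUniformSection (h : FlowCharts I X φ r c C V B δ N ξ) {n : ℕ} {p : Fin n → M}
    {b T : ℝ} (hb : 0 < b) (hbr : b < r) (hbc : b < c)
    (hdisj : Pairwise fun i j =>
      Disjoint (transverseDisc I X (p i) b) (transverseDisc I X (p j) b))
    (hhit : ∀ x, ∃ t ∈ Ioo 0 T, ∃ i, φ t x ∈ transverseDisc I X (p i) (b / 2)) :
    ∃ κ, ∀ ρ ∈ Icc (b / 2) b, IsUniformSection φ (discUnion I X p ρ) κ T := by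
  have hV := h.V_pos
  have hδ := h.δ_pos
  have hsep : ∀ i j, ∃ s : ℝ≥0, 0 < s ∧ (i ≠ j → ∀ x ∈ transverseDisc I X (p i) b,
      ∀ y ∈ transverseDisc I X (p j) b, (s : ℝ≥0∞) < edist x y) := by
    intro i j
    by_cases hij : i = j
    · exact ⟨1, one_pos, fun h => (h hij).elim⟩
    · obtain ⟨s, hs, h1⟩ := Metric.exists_pos_forall_lt_edist
        (h.isCompact_transverseDisc (p i) hbr)
        (h.isCompact_transverseDisc (p j) hbr).isClosed (hdisj hij)
      exact ⟨s, hs, fun _ => h1⟩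
  choose s hs hsd using hsep
  obtain ⟨κ, hκ, hκδ, hκc, hκs⟩ : ∃ κ : ℝ, 0 < κ ∧ κ < δ ∧ V * κ + b < c ∧
      ∀ i j, V * κ < s i j := by
    have key : ∀ u : ℝ, 0 < u → ∀ᶠ κ in 𝓝[>] (0 : ℝ), V * κ < u := by
      intro u hu
      have : Tendsto (fun κ : ℝ => V * κ) (𝓝[>] 0) (𝓝 0) := by
        have h1 : Continuous fun κ : ℝ => V * κ := by fun_prop
        have := h1.tendsto 0
        rw [mul_zero] at this
        exact this.mono_left nhdsWithin_le_nhds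
      exact this.eventually (gt_mem_nhds hu)
    have hev : ∀ᶠ κ in 𝓝[>] (0 : ℝ), ∀ i j, V * κ < s i j := by
      rw [eventually_all]
      intro i
      rw [eventually_all]
      exact fun j => key _ (by exact_mod_cast hs i j)
    obtain ⟨κ, ⟨h1, h2, h3⟩, h4⟩ := (((key (V * δ) (by positivity)).and ((key (c - b)
      (by linarith)).and hev)).and self_mem_nhdsWithin).exists
    exact ⟨κ, h4, lt_of_mul_lt_mul_left h1 hV.le, by linarith, h3⟩
  refine ⟨κ, fun ρ hρ => ⟨hκ, fun x hx t ht hxt => ?_, fun x => ?_⟩⟩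
  · by_contra! hlt
    obtain ⟨i, hi⟩ := mem_iUnion.1 hx
    obtain ⟨j, hj⟩ := mem_iUnion.1 hxt
    replace hi := transverseDisc_mono hρ.2 hi
    replace hj := transverseDisc_mono hρ.2 hj
    have hVt : V * t < V * κ := mul_lt_mul_of_pos_left hlt hV
    by_cases hij : i = j
    · subst hij
      have h0 := (((h.expChart (p i)).mem_transverseDisc hbr).1 hi).2.1
      have h1 := (((h.expChart (p i)).mem_transverseDisc hbr).1 hj).2.1
      have hxp := (h.expChart (p i)).edist_le_of_mem_transverseDisc hbr hi
      have h2 := h.isC1Flow.mul_le_radial_sub (h.expChart (p i)) (x := x) ht.le (fun u hu => by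
        have hu' : |u| ≤ t := abs_le.2 ⟨by linarith [hu.1], hu.2⟩
        refine (h.flow_mem hb.le hxp (by linarith) ?_).1
        have : V * |u| ≤ V * t := by gcongr
        linarith)
      rw [Flow.map_zero_apply, h0, h1] at h2
      nlinarith [h.c_pos]
    · have h1 := hsd i j hij x hi _ hj
      have h2 := h.edist_flow_le x t (by rw [abs_of_pos ht]; linarith)
      rw [edist_comm, abs_of_pos ht] at h2
      have h3 := h1.trans_le h2
      rw [← ENNReal.ofReal_coe_nnreal, ENNReal.ofReal_lt_ofReal_iff (by positivity)] at h3
      linarith [hκs i j]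
  · obtain ⟨t, ht, i, hi⟩ := hhit x
    exact ⟨t, ht, mem_iUnion.2 ⟨i, transverseDisc_mono hρ.1 hi⟩⟩

end FlowCharts

end DiscUnion

/-! ### Generic radii -/

/-- The points of an interval of length `2 n + 2 m` which are `κ`-separated are covered by their images
under a function of at most linearly many integers. -/
theorem exists_range_of_separated {S : Set ℝ} {κ a : ℝ} (hκ : 0 < κ) (hS : S ⊆ Icc (-a) a)
    (hsep : ∀ s ∈ S, ∀ t ∈ S, s < t → κ ≤ t - s) :
    ∃ g : ℕ → ℝ, ∀ s ∈ S, ∃ k < ⌊4 * a / κ⌋₊ + 1, g k = s := by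
  have hex : ∀ k : ℕ, ∃ t, ∀ s ∈ S, ⌊2 * (s + a) / κ⌋₊ = k → t = s := by
    intro k
    by_cases hk : ∃ t ∈ S, ⌊2 * (t + a) / κ⌋₊ = k
    · obtain ⟨t, ht, hkt⟩ := hk
      refine ⟨t, fun s hs hks => ?_⟩
      have hdist : ∀ s ∈ S, ∀ t ∈ S, ⌊2 * (s + a) / κ⌋₊ = k → ⌊2 * (t + a) / κ⌋₊ = k → ¬ s < t := by
        intro s hs t ht hks hkt hlt
        have h1 := hsep s hs t ht hlt
        have h2 : (k : ℝ) ≤ 2 * (s + a) / κ := by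
          rw [← hks]
          refine Nat.floor_le (div_nonneg ?_ hκ.le)
          linarith [(hS hs).1]
        have h3 : 2 * (t + a) / κ < k + 1 := by
          rw [← hkt]
          exact Nat.lt_floor_add_one _
        rw [le_div_iff₀ hκ] at h2
        rw [div_lt_iff₀ hκ] at h3
        nlinarith
      rcases lt_trichotomy s t with hlt | heq | hlt
      · exact (hdist s hs t ht hks hkt hlt).elim
      · exact heq.symm
      · exact (hdist t ht s hs hkt hks hlt).elim
    · exact ⟨0, fun s hs hks => (hk ⟨s, hs, hks⟩).elim⟩
  choose g hg using hex
  refine ⟨g, fun s hs => ⟨_, ?_, hg _ s hs rfl⟩⟩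
  refine Nat.lt_succ_of_le (Nat.floor_le_floor ?_)
  exact div_le_div_of_nonneg_right (by linarith [(hS hs).2]) hκ.le

section GenericRadius

set_option linter.unusedSectionVars false

variable {E : Type*} [NormedAddCommGroup E] [NormedSpace ℝ E] [FiniteDimensional ℝ E]
  {H : Type*} [TopologicalSpace H] {I : ModelWithCorners ℝ E H} [I.Boundaryless]
  {M : Type*} [EMetricSpace M] [ChartedSpace H M] [IsManifold I ∞ M]
  [RiemannianBundle (fun x : M => TangentSpace I x)]
  [IsContMDiffRiemannianBundle I ∞ E (fun x : M => TangentSpace I x)]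
  [IsRiemannianManifold I M]

attribute [local instance] isContinuousRiemannianBundle_of_contMDiff

variable {X : (x : M) → TangentSpace I x} {φ : Flow ℝ M} {r c C V B δ : ℝ} {N : M → Set M}
  {ξ : M → M → E} {k : ℕ}

variable (I) in
/-- The pairs `(x, ρ)` such that the orbit of `x` hits one of the discs of radius `b`, at a time
`|t| ≤ n + m` and at a distance from its center which differs by at most `exp (-n / (m + 1))` from
`ρ`. -/
def closeHits (X : (x : M) → TangentSpace I x) (φ : Flow ℝ M) (ξ : M → M → E) (p : Fin k → M)
    (b : ℝ) (m n : ℕ) : Set (M × ℝ) :=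
  {q | ∃ t : ℝ, |t| ≤ n + m ∧ ∃ i, φ t q.1 ∈ transverseDisc I X (p i) b ∧
    |tnorm I (p i) (ξ (p i) (φ t q.1)) - q.2| ≤ Real.exp (-n / (m + 1))}

variable (I) in
/-- The pairs `(x, ρ)` such that the orbit of `x` does not come exponentially close to the boundaries
of the discs of radius `ρ`. -/
def goodRadii (X : (x : M) → TangentSpace I x) (φ : Flow ℝ M) (ξ : M → M → E) (p : Fin k → M)
    (b : ℝ) : Set (M × ℝ) :=
  {q | ∀ m : ℕ, ∀ᶠ n in atTop, q ∉ closeHits I X φ ξ p b m n}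

theorem goodRadii_flow {p : Fin k → M} {b ρ t : ℝ} {x : M} (hx : (x, ρ) ∈ goodRadii I X φ ξ p b)
    (ht : |t| ≤ 1) : (φ t x, ρ) ∈ goodRadii I X φ ξ p b := by
  intro m
  filter_upwards [hx (m + 1)] with n hn hbad
  obtain ⟨s, hs, i, h1, h2⟩ := hbad
  simp only [← Flow.map_add] at h1 h2
  refine hn ⟨s + t, ?_, i, h1, h2.trans ?_⟩
  · refine (abs_add_le _ _).trans ?_
    push_cast
    linarith
  · rw [Real.exp_le_exp, neg_div, neg_div, neg_le_neg_iff]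
    push_cast
    gcongr
    linarith

namespace FlowCharts

theorem continuousOn_tnorm (h : FlowCharts I X φ r c C V B δ N ξ) (p : M) :
    ContinuousOn (fun x => tnorm I p (ξ p x)) (N p) := fun x hx =>
  ((continuous_tnorm p).continuousAt.comp
    ((h.expChart p).contMDiffAt x hx).continuousAt).continuousWithinAt

theorem transverseDisc_subset (h : FlowCharts I X φ r c C V B δ N ξ) (p : M) {b : ℝ} (hb : b < r) :
    transverseDisc I X p b ⊆ N p := fun _ hx => (((h.expChart p).mem_transverseDisc hb).1 hx).1

theorem isCompact_closeHits (h : FlowCharts I X φ r c C V B δ N ξ) (p : Fin k → M) {b : ℝ}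
    (hb : b < r) (m n : ℕ) : IsCompact (closeHits I X φ ξ p b m n) := by
  set e := Real.exp (-n / (m + 1))
  have heq : closeHits I X φ ξ p b m n = ⋃ i,
      (fun z : ℝ × M × ℝ => (φ (-z.1) z.2.1, tnorm I (p i) (ξ (p i) z.2.1) + z.2.2)) ''
        (Icc (-(n + m : ℝ)) (n + m) ×ˢ transverseDisc I X (p i) b ×ˢ Icc (-e) e) := by
    ext ⟨x, ρ⟩
    simp only [closeHits, mem_setOf_eq, mem_iUnion, mem_image, Prod.exists, mem_prod, Prod.mk.injEq]
    constructor
    · rintro ⟨t, ht, i, h1, h2⟩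
      refine ⟨i, t, φ t x, ρ - tnorm I (p i) (ξ (p i) (φ t x)), ⟨abs_le.1 ht, h1, ?_⟩, ?_, by ring⟩
      · rw [abs_sub_comm] at h2
        exact abs_le.1 h2
      · rw [← Flow.map_add, neg_add_cancel, Flow.map_zero_apply]
    · rintro ⟨i, t, y, s, ⟨ht, hy, hs⟩, rfl, rfl⟩
      refine ⟨t, abs_le.2 ht, i, ?_⟩
      rw [← Flow.map_add, add_neg_cancel, Flow.map_zero_apply]
      refine ⟨hy, ?_⟩
      rw [sub_add_cancel_left, abs_neg]
      exact abs_le.2 hs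
  rw [heq]
  refine isCompact_iUnion fun i => (isCompact_Icc.prod
    ((h.isCompact_transverseDisc (p i) hb).prod isCompact_Icc)).image_of_continuousOn ?_
  refine ContinuousOn.prodMk ?_ (ContinuousOn.add ?_ ?_)
  · exact (φ.continuous continuous_fst.neg (continuous_fst.comp continuous_snd)).continuousOn
  · exact (h.continuousOn_tnorm (p i)).comp (f := fun z : ℝ × M × ℝ => z.2.1)
      (continuous_fst.comp continuous_snd).continuousOn
      fun z hz => h.transverseDisc_subset (p i) hb hz.2.1
  · exact (continuous_snd.comp continuous_snd).continuousOn

/-- By the Borel–Cantelli lemma, almost every radius is good for a given orbit. -/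
theorem ae_mem_goodRadii {p : Fin k → M} {b κ T : ℝ}
    (hs : IsUniformSection φ (discUnion I X p b) κ T) (x : M) :
    ∀ᵐ ρ ∂(volume : Measure ℝ), (x, ρ) ∈ goodRadii I X φ ξ p b := by
  have hκ := hs.κ_pos
  simp only [goodRadii, mem_setOf_eq]
  rw [ae_all_iff]
  intro m
  refine ae_eventually_notMem (s := fun n => {ρ | (x, ρ) ∈ closeHits I X φ ξ p b m n}) ?_
  have hle : ∀ n : ℕ, volume {ρ | (x, ρ) ∈ closeHits I X φ ξ p b m n} ≤ ENNReal.ofReal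
      ((4 * (n + m) / κ + 1) * (k * (2 * Real.exp (-n / (m + 1))))) := by
    intro n
    set e := Real.exp (-n / (m + 1))
    obtain ⟨g, hg⟩ := exists_range_of_separated (a := n + m)
      (S := {t | φ t x ∈ discUnion I X p b} ∩ Icc (-(n + m : ℝ)) (n + m)) hκ inter_subset_right
      (fun s hs' t ht hst => hs.le_of_mem _ hs'.1 _ (sub_pos.2 hst) (by
        rw [← Flow.map_add, sub_add_cancel]; exact ht.1))
    have hsub : {ρ | (x, ρ) ∈ closeHits I X φ ξ p b m n} ⊆
        ⋃ l ∈ Finset.range (⌊4 * (n + m : ℝ) / κ⌋₊ + 1), ⋃ i ∈ (Finset.univ : Finset (Fin k)),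
          Metric.closedBall (tnorm I (p i) (ξ (p i) (φ (g l) x))) e := by
      rintro ρ ⟨t, ht, i, h1, h2⟩
      obtain ⟨l, hl, rfl⟩ := hg t ⟨mem_iUnion.2 ⟨i, h1⟩, abs_le.1 ht⟩
      refine mem_iUnion₂.2 ⟨l, Finset.mem_range.2 hl, mem_iUnion₂.2 ⟨i, Finset.mem_univ _, ?_⟩⟩
      rw [Metric.mem_closedBall, dist_comm, Real.dist_eq]
      exact h2
    refine (measure_mono hsub).trans ((measure_biUnion_finset_le _ _).trans ?_)
    have h1 : ∀ l ∈ Finset.range (⌊4 * (n + m : ℝ) / κ⌋₊ + 1),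
        volume (⋃ i ∈ (Finset.univ : Finset (Fin k)),
          Metric.closedBall (tnorm I (p i) (ξ (p i) (φ (g l) x))) e) ≤
        ENNReal.ofReal (k * (2 * e)) := by
      intro l _
      refine (measure_biUnion_finset_le _ _).trans ?_
      simp only [Real.volume_closedBall, Finset.sum_const, Finset.card_univ, Fintype.card_fin,
        nsmul_eq_mul]
      rw [← ENNReal.ofReal_natCast, ← ENNReal.ofReal_mul (Nat.cast_nonneg k)]
    refine (Finset.sum_le_sum h1).trans ?_
    rw [Finset.sum_const, Finset.card_range, nsmul_eq_mul, ← ENNReal.ofReal_natCast,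
      ← ENNReal.ofReal_mul (by positivity)]
    refine ENNReal.ofReal_le_ofReal ?_
    have h2 : ((⌊4 * (n + m : ℝ) / κ⌋₊ + 1 : ℕ) : ℝ) ≤ 4 * (n + m) / κ + 1 := by
      push_cast
      have := Nat.floor_le (show 0 ≤ 4 * (n + m : ℝ) / κ by positivity)
      linarith
    gcongr
  have hsum : Summable fun n : ℕ =>
      (4 * (n + m) / κ + 1) * (k * (2 * Real.exp (-n / (m + 1)))) := by
    have hr : (0 : ℝ) < 1 / (m + 1) := by positivity
    have h1 := Real.summable_pow_mul_exp_neg_nat_mul 1 hr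
    have h0 := Real.summable_pow_mul_exp_neg_nat_mul 0 hr
    refine ((h1.mul_left (4 / κ * (k * 2))).add (h0.mul_left ((4 * m / κ + 1) * (k * 2)))).congr
      fun n => ?_
    have : Real.exp (-(1 / ((m : ℝ) + 1)) * n) = Real.exp (-n / (m + 1)) := by
      congr 1
      ring
    rw [this]
    ring
  refine ne_top_of_le_ne_top ?_ (ENNReal.tsum_le_tsum hle)
  rw [← ENNReal.ofReal_tsum_of_nonneg (fun n => by positivity) hsum]
  exact ENNReal.ofReal_ne_top

/-- There is a radius which is good for almost every orbit. -/
theorem exists_goodRadius [CompactSpace M] [MeasurableSpace M] [BorelSpace M] {μ : Measure M}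
    [IsProbabilityMeasure μ] (h : FlowCharts I X φ r c C V B δ N ξ) {p : Fin k → M} {b κ T : ℝ}
    (hb : 0 < b) (hbr : b < r) (hs : IsUniformSection φ (discUnion I X p b) κ T) :
    ∃ ρ ∈ Ioo (b / 2) b, MeasurableSet {x | (x, ρ) ∈ goodRadii I X φ ξ p b} ∧
      ∀ᵐ x ∂μ, (x, ρ) ∈ goodRadii I X φ ξ p b := by
  have : SecondCountableTopology M := EMetric.secondCountable_of_sigmaCompact M
  have hmeas : MeasurableSet (goodRadii I X φ ξ p b) := by
    have heq : goodRadii I X φ ξ p b =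
        ⋂ m : ℕ, {q | ∀ᶠ n in atTop, q ∈ (closeHits I X φ ξ p b m n)ᶜ} := by
      ext q
      simp only [goodRadii, mem_setOf_eq, mem_iInter, mem_compl_iff]
    rw [heq]
    refine MeasurableSet.iInter fun m => ?_
    have heq' : {q | ∀ᶠ n in atTop, q ∈ (closeHits I X φ ξ p b m n)ᶜ} =
        ⋃ n₀ : ℕ, ⋂ n ≥ n₀, (closeHits I X φ ξ p b m n)ᶜ := by
      ext q
      simp only [mem_setOf_eq, eventually_atTop, mem_iUnion, mem_iInter]
    rw [heq']
    exact MeasurableSet.iUnion fun n₀ => MeasurableSet.biInter (to_countable _) fun n _ =>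
      (h.isCompact_closeHits p hbr m n).measurableSet.compl
  have hae : ∀ᵐ ρ ∂(volume : Measure ℝ), ∀ᵐ x ∂μ, (x, ρ) ∈ goodRadii I X φ ξ p b :=
    (Measure.ae_ae_comm (p := fun x ρ => (x, ρ) ∈ goodRadii I X φ ξ p b) hmeas).1
      (Eventually.of_forall fun x => ae_mem_goodRadii hs x)
  have hne : (volume (Ioo (b / 2) b)) ≠ 0 := by
    rw [Real.volume_Ioo, Ne, ENNReal.ofReal_eq_zero]
    linarith
  obtain ⟨ρ, hρ, hρ'⟩ := (frequently_ae_iff.2 (show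
    volume {ρ | ρ ∈ Ioo (b / 2) b} ≠ 0 from hne)).and_eventually hae |>.exists
  exact ⟨ρ, hρ, hmeas.preimage (measurable_id.prodMk measurable_const), hρ'⟩

end FlowCharts

end GenericRadius

/-! ### Regularity of the Poincaré map -/

section Regularity

variable {E : Type*} [NormedAddCommGroup E] [NormedSpace ℝ E] [FiniteDimensional ℝ E]
  {H : Type*} [TopologicalSpace H] {I : ModelWithCorners ℝ E H} [I.Boundaryless]
  {M : Type*} [TopologicalSpace M] [ChartedSpace H M] [IsManifold I ∞ M]

/-- The implicit function theorem for the hitting time of a level set of `g` by the orbits of a `C¹`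
flow transverse to it. -/
theorem exists_contMDiffAt_hittingTime {φ : Flow ℝ M}
    (hφ : ContMDiff (𝓘(ℝ, ℝ).prod I) I 1 (fun q : ℝ × M => φ q.1 q.2)) {x : M} {R d : ℝ}
    {g : M → ℝ} (hg : ContMDiffAt I 𝓘(ℝ, ℝ) 1 g (φ R x)) (hd : d ≠ 0)
    (hgd : HasDerivAt (fun s => g (φ s x)) d R) :
    ∃ τ : M → ℝ, ContMDiffAt I 𝓘(ℝ, ℝ) 1 τ x ∧ τ x = R ∧
      ∀ᶠ y in 𝓝 x, g (φ (τ y) y) = g (φ R x) := by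
  set χ := extChartAt I x with hχ
  set F : E × ℝ → ℝ := fun q => g (φ q.2 (χ.symm q.1)) with hF
  have hχx : χ.symm (χ x) = x := extChartAt_to_inv x
  have hs : ContMDiffAt 𝓘(ℝ, E) I 1 χ.symm (χ x) :=
    ((contMDiffOn_extChartAt_symm (I := I) (n := ∞) x).contMDiffAt
      (extChartAt_target_mem_nhds (I := I) x)).of_le (by simp)
  have hF1 : ContDiffAt ℝ 1 F (χ x, R) := by
    rw [← contMDiffAt_iff_contDiffAt]
    have h1 : ContMDiffAt 𝓘(ℝ, E × ℝ) (𝓘(ℝ, ℝ).prod I) 1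
        (fun q : E × ℝ => (q.2, χ.symm q.1)) (χ x, R) := by
      refine ContMDiffAt.prodMk contDiff_snd.contDiffAt.contMDiffAt ?_
      exact ContMDiffAt.comp (χ x, R) (g := χ.symm) hs contDiff_fst.contDiffAt.contMDiffAt
    refine ContMDiffAt.comp (I' := I) (χ x, R) (g := g) (f := fun q : E × ℝ => φ q.2 (χ.symm q.1)) ?_ ?_
    · simpa only [hχx] using hg
    · exact (hφ _).comp (χ x, R) h1
  have hF2 : (fderiv ℝ F (χ x, R) ∘L .inr ℝ E ℝ).IsInvertible := by
    have h1 : HasDerivAt (fun s => F (χ x, s)) (fderiv ℝ F (χ x, R) (0, 1)) R :=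
      (hF1.differentiableAt (by simp)).hasFDerivAt.comp_hasDerivAt R
        ((hasDerivAt_const R (χ x)).prodMk (hasDerivAt_id R))
    have h2 : HasDerivAt (fun s => F (χ x, s)) d R := by simpa only [hF, hχx] using hgd
    have h3 := h1.unique h2
    refine ⟨ContinuousLinearEquiv.smulLeft (R₁ := ℝ) (Units.mk0 d hd), ?_⟩
    ext
    simp [← h3]
  refine ⟨fun y => hF1.implicitFunction one_ne_zero hF2 (χ y), ?_, ?_, ?_⟩
  · exact ContMDiffAt.comp x (g := hF1.implicitFunction one_ne_zero hF2)
      (hF1.contDiffAt_implicitFunction one_ne_zero hF2).contMDiffAt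
      (contMDiffAt_extChartAt (I := I))
  · exact hF1.implicitFunction_apply_self one_ne_zero hF2
  · have h1 := (continuousAt_extChartAt (I := I) x).eventually
      (hF1.eventually_apply_implicitFunction one_ne_zero hF2)
    filter_upwards [h1, extChartAt_source_mem_nhds (I := I) x] with y hy hys
    simp only [hF, hχx] at hy
    rwa [χ.left_inv hys] at hy

/-- The Poincaré map is `C¹` at the points which it maps to points where the section is a level set
transverse to the flow. -/
theorem IsUniformSection.contMDiffWithinAt_poincareMap {φ : Flow ℝ M} {Λ : Set M} {κ T : ℝ}
    (h : IsUniformSection φ Λ κ T) (hΛ : IsClosed Λ)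
    (hφ : ContMDiff (𝓘(ℝ, ℝ).prod I) I 1 (fun q : ℝ × M => φ q.1 q.2)) {x : M} {d : ℝ} {g : M → ℝ}
    (hg : ContMDiffAt I 𝓘(ℝ, ℝ) 1 g (poincareMap φ Λ x))
    (hgΛ : ∀ᶠ w in 𝓝 (poincareMap φ Λ x), w ∈ Λ ↔ g w = 0) (hd : d ≠ 0)
    (hgd : HasDerivAt (fun s => g (φ s x)) d (roofFunction φ Λ x)) (hx : x ∈ Λ) :
    ContMDiffWithinAt I I 1 (poincareMap φ Λ) Λ x := by
  set R := roofFunction φ Λ x with hR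
  obtain ⟨τ, hτ, hτx, hτg⟩ := exists_contMDiffAt_hittingTime hφ hg hd hgd
  have hcomp : ContMDiffAt I I 1 (fun y => φ (τ y) y) x :=
    (hφ _).comp x (hτ.prodMk contMDiffAt_id)
  have hκ := h.κ_pos
  have hfx : φ (τ x) x = poincareMap φ Λ x := by rw [hτx]; rfl
  have hev1 : ∀ᶠ y in 𝓝 x, φ (τ y) y ∈ Λ ↔ g (φ (τ y) y) = 0 := by
    have h1 := hcomp.continuousAt
    rw [ContinuousAt, hfx] at h1
    exact h1.eventually hgΛ
  have hgx : g (φ R x) = 0 := hgΛ.self_of_nhds.1 (h.poincareMap_mem x)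
  have hclosed : IsClosed {y | ∃ t ∈ Icc κ (R - κ / 2), φ t y ∈ Λ} := by
    have heq : {y | ∃ t ∈ Icc κ (R - κ / 2), φ t y ∈ Λ} =
        Prod.snd '' ((fun q : ↥(Icc κ (R - κ / 2)) × M => φ q.1 q.2) ⁻¹' Λ) := by
      ext y
      constructor
      · rintro ⟨t, ht, hy⟩
        exact ⟨(⟨t, ht⟩, y), hy, rfl⟩
      · rintro ⟨⟨t, z⟩, hz, rfl⟩
        exact ⟨t, t.2, hz⟩
    rw [heq]
    exact isClosedMap_snd_of_compactSpace _ (hΛ.preimage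
      (φ.continuous (continuous_subtype_val.comp continuous_fst) continuous_snd))
  have hxK : x ∉ {y | ∃ t ∈ Icc κ (R - κ / 2), φ t y ∈ Λ} := by
    rintro ⟨t, ht, hxt⟩
    have := (h.isLeast_roofFunction x).2 ⟨hκ.trans_le ht.1, hxt⟩
    rw [← hR] at this
    linarith [ht.2]
  have hτR : ∀ᶠ y in 𝓝 x, τ y ∈ Ioo (R - κ / 2) (R + κ / 2) := by
    refine hτ.continuousAt.eventually (isOpen_Ioo.eventually_mem ?_)
    rw [hτx]
    constructor <;> linarith
  have hRκ : κ ≤ R := h.le_roofFunction hx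
  refine (hcomp.contMDiffWithinAt (s := Λ)).congr_of_eventuallyEq ?_ hfx.symm
  have hall : ∀ᶠ y in 𝓝 x, y ∈ Λ → poincareMap φ Λ y = φ (τ y) y := by
    filter_upwards [hτg, hev1, hτR, hclosed.isOpen_compl.eventually_mem hxK] with y h1 h2 h3 h4 hy
    have hmem : φ (τ y) y ∈ Λ := h2.2 (h1.trans hgx)
    have hle : roofFunction φ Λ y ≤ τ y :=
      (h.isLeast_roofFunction y).2 ⟨by linarith [h3.1], hmem⟩
    rcases hle.eq_or_lt with heq | hlt
    · rw [poincareMap, heq]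
    · have h5 := h.le_of_mem _ (h.poincareMap_mem y) (τ y - roofFunction φ Λ y) (by linarith) (by
        rw [poincareMap, ← Flow.map_add, sub_add_cancel]
        exact hmem)
      exact (h4 ⟨roofFunction φ Λ y, ⟨h.le_roofFunction hy, by linarith [h3.2]⟩,
        h.poincareMap_mem y⟩).elim
  exact eventually_nhdsWithin_iff.2 hall

end Regularity

/-! ### The singular set -/

section Singular

set_option linter.unusedSectionVars false

variable {E : Type*} [NormedAddCommGroup E] [NormedSpace ℝ E] [FiniteDimensional ℝ E]
  {H : Type*} [TopologicalSpace H] {I : ModelWithCorners ℝ E H} [I.Boundaryless]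
  {M : Type*} [EMetricSpace M] [ChartedSpace H M] [IsManifold I ∞ M]
  [RiemannianBundle (fun x : M => TangentSpace I x)]
  [IsContMDiffRiemannianBundle I ∞ E (fun x : M => TangentSpace I x)]
  [IsRiemannianManifold I M]

attribute [local instance] isContinuousRiemannianBundle_of_contMDiff

namespace FlowCharts

variable {X : (x : M) → TangentSpace I x} {φ : Flow ℝ M} {r c C V B δ : ℝ} {N : M → Set M}
  {ξ : M → M → E} {k : ℕ} {p : Fin k → M} {ρ κ T : ℝ}

theorem isCompact_transverseDiscBoundary (h : FlowCharts I X φ r c C V B δ N ξ) (q : M) {b : ℝ}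
    (hb : b < r) : IsCompact (transverseDiscBoundary I X q b) := by
  have heq : transverseDiscBoundary I X q b =
      expMap I q '' ({v : E | tnorm I q v ≤ b} ∩ {v | metricAt I q v (X q) = 0 ∧ tnorm I q v = b}) := by
    ext x
    constructor
    · rintro ⟨v, hv, hvb, rfl⟩
      exact ⟨v, ⟨hvb.le, hv, hvb⟩, rfl⟩
    · rintro ⟨v, ⟨-, hv, hvb⟩, rfl⟩
      exact ⟨v, hv, hvb, rfl⟩
  rw [heq]
  refine ((isCompact_setOf_tnorm_le q b).inter_right ?_).image_of_continuousOn ?_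
  · exact (isClosed_eq (metricForm I q (X q)).continuous continuous_const).inter
      (isClosed_eq (continuous_tnorm q) continuous_const)
  · rintro v ⟨hv, -⟩
    exact ((h.expChart q).contMDiffAt_expMap v (lt_of_le_of_lt hv hb)).continuousAt.continuousWithinAt

theorem isCompact_discUnionBoundary (h : FlowCharts I X φ r c C V B δ N ξ) (p : Fin k → M)
    (hρ : ρ < r) : IsCompact (discUnionBoundary I X p ρ) :=
  isCompact_iUnion fun i => h.isCompact_transverseDiscBoundary (p i) hρ

/-- Near a point in the relative interior, the section is a level set of a radial component. -/
theorem exists_eventually_mem_discUnion_iff (h : FlowCharts I X φ r c C V B δ N ξ) (hρ : ρ < r)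
    (hdisj : Pairwise fun i j => Disjoint (transverseDisc I X (p i) ρ) (transverseDisc I X (p j) ρ))
    {x : M} (hx : x ∈ discUnion I X p ρ) (hxB : x ∉ discUnionBoundary I X p ρ) :
    ∃ i, x ∈ N (p i) ∧ ∀ᶠ y in 𝓝 x, y ∈ discUnion I X p ρ ↔ radial I X (p i) (ξ (p i)) y = 0 := by
  obtain ⟨i, hi⟩ := mem_iUnion.1 hx
  obtain ⟨hN, hrad, hle⟩ := ((h.expChart (p i)).mem_transverseDisc hρ).1 hi
  have hlt : tnorm I (p i) (ξ (p i) x) < ρ := by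
    refine hle.lt_of_ne fun heq => hxB (mem_iUnion.2 ⟨i, ?_⟩)
    exact ((h.expChart (p i)).mem_transverseDiscBoundary hρ).2 ⟨hN, hrad, heq⟩
  have hothers : ∀ᶠ y in 𝓝 x, ∀ j, j ≠ i → y ∉ transverseDisc I X (p j) ρ := by
    refine eventually_all.2 fun j => ?_
    by_cases hj : j = i
    · exact Eventually.of_forall fun y hy => (hy hj).elim
    · have hxj : x ∉ transverseDisc I X (p j) ρ := disjoint_left.1 (hdisj (Ne.symm hj)) hi
      filter_upwards [(h.isCompact_transverseDisc (p j) hρ).isClosed.isOpen_compl.eventually_mem hxj]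
        with y hy _ using hy
  have hO := (h.expChart (p i)).isOpen
  refine ⟨i, hN, ?_⟩
  filter_upwards [hothers, hO.eventually_mem hN,
    ((h.continuousOn_tnorm (p i)).continuousAt (hO.mem_nhds hN)).eventually (gt_mem_nhds hlt)]
    with y h1 h2 h3
  constructor
  · intro hy
    obtain ⟨j, hj⟩ := mem_iUnion.1 hy
    by_cases hji : j = i
    · rw [hji] at hj
      exact (((h.expChart (p i)).mem_transverseDisc hρ).1 hj).2.1
    · exact (h1 j hji hj).elim
  · exact fun hy => mem_iUnion.2 ⟨i, ((h.expChart (p i)).mem_transverseDisc hρ).2 ⟨h2, hy, h3.le⟩⟩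

theorem discUnionBoundary_subset_discUnion : discUnionBoundary I X p ρ ⊆ discUnion I X p ρ :=
  iUnion_mono fun _ _ ⟨v, hv, hvρ, hx⟩ => ⟨v, hv, hvρ.le, hx⟩

theorem discUnionBoundary_subset_singularSet :
    discUnionBoundary I X p ρ ⊆ singularSet I φ (discUnion I X p ρ) (discUnionBoundary I X p ρ) :=
  fun _ hx => ⟨discUnionBoundary_subset_discUnion hx, fun ⟨_, hxV, _, hV, _⟩ => (hV hxV).2 hx⟩

variable [CompactSpace M]

theorem contMDiffWithinAt_poincareMap (h : FlowCharts I X φ r c C V B δ N ξ) (hρ : ρ < r)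
    (hdisj : Pairwise fun i j => Disjoint (transverseDisc I X (p i) ρ) (transverseDisc I X (p j) ρ))
    (hs : IsUniformSection φ (discUnion I X p ρ) κ T) {x : M} (hx : x ∈ discUnion I X p ρ)
    (hxB : poincareMap φ (discUnion I X p ρ) x ∉ discUnionBoundary I X p ρ) :
    ContMDiffWithinAt I I 1 (poincareMap φ (discUnion I X p ρ)) (discUnion I X p ρ) x := by
  obtain ⟨i, hi, hev⟩ := h.exists_eventually_mem_discUnion_iff hρ hdisj (hs.poincareMap_mem x) hxB
  obtain ⟨d, hd, hd'⟩ := h.isC1Flow.exists_hasDerivAt_radial (h.expChart (p i)) hi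
  exact hs.contMDiffWithinAt_poincareMap (h.isCompact_discUnion p hρ).isClosed h.isC1Flow.contMDiff
    (((h.expChart (p i)).contMDiffAt_radial hi).of_le (by simp)) hev (h.c_pos.trans_le hd).ne' hd' hx

theorem contMDiffWithinAt_poincareMapInv (h : FlowCharts I X φ r c C V B δ N ξ) (hρ : ρ < r)
    (hdisj : Pairwise fun i j => Disjoint (transverseDisc I X (p i) ρ) (transverseDisc I X (p j) ρ))
    (hs : IsUniformSection φ (discUnion I X p ρ) κ T) {x : M} (hx : x ∈ discUnion I X p ρ)
    (hxB : poincareMapInv φ (discUnion I X p ρ) x ∉ discUnionBoundary I X p ρ) :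
    ContMDiffWithinAt I I 1 (poincareMapInv φ (discUnion I X p ρ)) (discUnion I X p ρ) x := by
  obtain ⟨i, hi, hev⟩ := h.exists_eventually_mem_discUnion_iff hρ hdisj
    (hs.reverse.poincareMap_mem x) hxB
  obtain ⟨d, hd, hd'⟩ := h.isC1Flow.exists_hasDerivAt_radial (h.expChart (p i))
    (x := x) (s := -roofFunction φ.reverse (discUnion I X p ρ) x) hi
  refine hs.reverse.contMDiffWithinAt_poincareMap (d := -d) (h.isCompact_discUnion p hρ).isClosed
    h.isC1Flow.reverse.contMDiff (((h.expChart (p i)).contMDiffAt_radial hi).of_le (by simp)) hev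
    (neg_ne_zero.2 (h.c_pos.trans_le hd).ne') ?_ hx
  have h1 := hd'.scomp (roofFunction φ.reverse (discUnion I X p ρ) x) (hasDerivAt_neg _)
  simpa [Function.comp_def] using h1

/-- The relative interior of the section has small neighbourhoods which are discs. -/
theorem exists_disc_nhds (h : FlowCharts I X φ r c C V B δ N ξ) (hE : Module.finrank ℝ E = 3)
    (hρ : ρ < r)
    (hdisj : Pairwise fun i j => Disjoint (transverseDisc I X (p i) ρ) (transverseDisc I X (p j) ρ))
    {x : M} (hx : x ∈ discUnion I X p ρ) (hxB : x ∉ discUnionBoundary I X p ρ) {W : Set M}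
    (hW : W ∈ 𝓝 x) :
    ∃ A ⊆ W, x ∈ A ∧ (∃ U : Set M, IsOpen U ∧ A = U ∩ discUnion I X p ρ) ∧
      ∃ ψ : EuclideanSpace ℝ (Fin 2) → M,
        IsC1DiffeoOn (𝓡 2) I ψ (Metric.ball 0 1) ∧ ψ '' Metric.ball 0 1 = A := by
  obtain ⟨i, hxN, hev⟩ := h.exists_eventually_mem_discUnion_iff hρ hdisj hx hxB
  set q := p i
  set ζ := ξ q
  have hN := h.expChart q
  set ℓ : E →L[ℝ] ℝ := metricForm I q (X q) with hℓ
  have hℓ0 : (ℓ : E →ₗ[ℝ] ℝ) ≠ 0 := by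
    intro h0
    have h1 := hN.le_metricAt x hxN
    have h2 : ℓ (mfderiv I 𝓘(ℝ, E) ζ x (X x)) = 0 := by
      change (ℓ : E →ₗ[ℝ] ℝ) _ = 0
      rw [h0]
      rfl
    have h3 := h.c_pos
    exact absurd (h1.trans_eq h2) (not_le.2 h3)
  have hfin : Module.finrank ℝ (EuclideanSpace ℝ (Fin 2)) =
      Module.finrank ℝ (LinearMap.ker (ℓ : E →ₗ[ℝ] ℝ)) := by
    have h1 := Module.Dual.finrank_ker_add_one_of_ne_zero hℓ0
    rw [finrank_euclideanSpace_fin]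
    omega
  let e := LinearEquiv.ofFinrankEq _ _ hfin
  let L₀ : EuclideanSpace ℝ (Fin 2) →ₗ[ℝ] E := (LinearMap.ker (ℓ : E →ₗ[ℝ] ℝ)).subtype ∘ₗ e
  obtain ⟨P₀, hP₀⟩ := L₀.exists_leftInverse_of_injective (LinearMap.ker_eq_bot.2
    (Subtype.val_injective.comp e.injective))
  let L : EuclideanSpace ℝ (Fin 2) →L[ℝ] E := L₀.toContinuousLinearMap
  let P : E →L[ℝ] EuclideanSpace ℝ (Fin 2) := P₀.toContinuousLinearMap
  have hPL : ∀ u, P (L u) = u := fun u => LinearMap.congr_fun hP₀ u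
  have hℓL : ∀ u, ℓ (L u) = 0 := fun u => (e u).2
  have hLP : ∀ v, ℓ v = 0 → L (P v) = v := by
    intro v hv
    obtain ⟨u, hu⟩ := e.surjective ⟨v, hv⟩
    have h1 : L u = v := congrArg Subtype.val hu
    rw [← h1, hPL]
  have hrad : ∀ y, radial I X q ζ y = ℓ (ζ y) := fun _ => rfl
  have hx0 : ℓ (ζ x) = 0 := by
    rw [← hrad]
    exact hev.self_of_nhds.1 hx
  obtain ⟨O, hO, hOo, hxO⟩ := mem_nhds_iff.1 (inter_mem hW hev)
  -- a small parameter
  have hnear : ∀ᶠ v in 𝓝 (ζ x), expMap I q v ∈ O ∧ tnorm I q v < r := by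
    have hlt := hN.tnorm_lt x hxN
    have hc := (hN.contMDiffAt_expMap _ hlt).continuousAt
    refine (hc.eventually (hOo.eventually_mem ?_)).and
      ((continuous_tnorm (I := I) q).continuousAt.eventually (gt_mem_nhds hlt))
    rwa [hN.expMap_apply x hxN]
  obtain ⟨η, hη, hηv⟩ := Metric.eventually_nhds_iff.1 hnear
  set ε := η / (‖L‖ + 1) with hε
  have hL1 : 0 < ‖L‖ + 1 := by positivity
  have hεpos : 0 < ε := by positivity
  have hsmall : ∀ u : EuclideanSpace ℝ (Fin 2), ‖u‖ < ε → dist (ζ x + L u) (ζ x) < η := by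
    intro u hu
    rw [dist_eq_norm, add_sub_cancel_left]
    refine (L.le_opNorm u).trans_lt ?_
    calc ‖L‖ * ‖u‖ ≤ (‖L‖ + 1) * ‖u‖ := by gcongr; linarith
      _ < (‖L‖ + 1) * ε := by gcongr
      _ = η := mul_div_cancel₀ _ hL1.ne'
  set A := {y ∈ N q | ℓ (ζ y) = 0 ∧ ‖P (ζ y - ζ x)‖ < ε} with hA
  have hAO : A ⊆ O := by
    rintro y ⟨hyN, hy0, hyP⟩
    have h1 := (hηv (hsmall _ hyP)).1
    rw [hLP _ (by rw [map_sub, hy0, hx0, sub_zero]), add_sub_cancel, hN.expMap_apply y hyN] at h1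
    exact h1
  have hmem : ∀ u : EuclideanSpace ℝ (Fin 2), u ∈ Metric.ball (0 : EuclideanSpace ℝ (Fin 2)) 1 →
      tnorm I q (ζ x + L (ε • u)) < r ∧ ‖ε • u‖ < ε := by
    intro u hu
    have hu' : ‖ε • u‖ < ε := by
      rw [norm_smul, Real.norm_of_nonneg hεpos.le]
      nlinarith [mem_ball_zero_iff.1 hu]
    exact ⟨(hηv (hsmall _ hu')).2, hu'⟩
  refine ⟨A, hAO.trans (hO.trans inter_subset_left), ⟨hxN, hx0, by simpa using hεpos⟩,
    ⟨O ∩ {y ∈ N q | ‖P (ζ y - ζ x)‖ < ε}, hOo.inter ?_, ?_⟩, fun u => expMap I q (ζ x + L (ε • u)),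
    ⟨?_, fun y => ε⁻¹ • P (ζ y - ζ x), ?_, ?_⟩, ?_⟩
  · have hcont : ContinuousOn (fun y => ‖P (ζ y - ζ x)‖) (N q) := fun y hy =>
      ((P.continuous.continuousAt.comp ((hN.contMDiffAt y hy).continuousAt.sub
        continuousAt_const)).norm).continuousWithinAt
    exact hcont.isOpen_inter_preimage hN.isOpen isOpen_Iio
  · ext y
    constructor
    · intro hy
      exact ⟨⟨hAO hy, hy.1, hy.2.2⟩, (hO (hAO hy)).2.2 hy.2.1⟩
    · rintro ⟨⟨hyO, hyN, hyP⟩, hy⟩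
      exact ⟨hyN, (hO hyO).2.1 hy, hyP⟩
  · intro u hu
    have h1 : ContMDiffAt (𝓡 2) 𝓘(ℝ, E) 1 (fun u : EuclideanSpace ℝ (Fin 2) => ζ x + L (ε • u)) u :=
      ContDiffAt.contMDiffAt (by fun_prop)
    exact (((hN.contMDiffAt_expMap _ (hmem u hu).1).of_le (by simp)).comp u h1).contMDiffWithinAt
  · rintro _ ⟨u, hu, rfl⟩
    have h1 : ContMDiffAt 𝓘(ℝ, E) (𝓡 2) 1 (fun v : E => ε⁻¹ • P (v - ζ x))
        (ζ (expMap I q (ζ x + L (ε • u)))) := ContDiffAt.contMDiffAt (by fun_prop)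
    exact (h1.comp _ ((hN.contMDiffAt _ (hN.expMap_mem _ (hmem u hu).1)).of_le
      (by simp))).contMDiffWithinAt
  · intro u hu
    simp only [ζ, q] at *
    rw [hN.apply_expMap _ (hmem u hu).1, add_sub_cancel_left, hPL, inv_smul_smul₀ hεpos.ne']
  · ext y
    constructor
    · rintro ⟨u, hu, rfl⟩
      have h1 : ζ (expMap I q (ζ x + L (ε • u))) = _ := hN.apply_expMap _ (hmem u hu).1
      refine ⟨hN.expMap_mem _ (hmem u hu).1, ?_, ?_⟩
      · simp only
        rw [h1, map_add, hℓL, hx0, add_zero]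
      · simp only
        rw [h1, add_sub_cancel_left, hPL]
        exact (hmem u hu).2
    · rintro ⟨hyN, hy0, hyP⟩
      refine ⟨ε⁻¹ • P (ζ y - ζ x), ?_, ?_⟩
      · rw [mem_ball_zero_iff, norm_smul, norm_inv, Real.norm_of_nonneg hεpos.le,
          inv_mul_lt_one₀ hεpos]
        exact hyP
      · simp only
        rw [smul_inv_smul₀ hεpos.ne', hLP _ (by rw [map_sub, hy0, hx0, sub_zero]), add_sub_cancel,
          hN.expMap_apply y hyN]

/-- A point is not singular if neither it nor its images under the Poincaré map and its inverse lie on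
the boundary of the section. -/
theorem notMem_singularSet (h : FlowCharts I X φ r c C V B δ N ξ) (hE : Module.finrank ℝ E = 3)
    (hρ : ρ < r)
    (hdisj : Pairwise fun i j => Disjoint (transverseDisc I X (p i) ρ) (transverseDisc I X (p j) ρ))
    (hs : IsUniformSection φ (discUnion I X p ρ) κ T) {x : M}
    (hxB : x ∉ discUnionBoundary I X p ρ)
    (hfB : poincareMap φ (discUnion I X p ρ) x ∉ discUnionBoundary I X p ρ)
    (hgB : poincareMapInv φ (discUnion I X p ρ) x ∉ discUnionBoundary I X p ρ) :
    x ∉ singularSet I φ (discUnion I X p ρ) (discUnionBoundary I X p ρ) := by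
  rintro ⟨hx, hsing⟩
  set Λ := discUnion I X p ρ with hΛ
  set D := discUnionBoundary I X p ρ with hD
  have hDo : IsOpen Dᶜ := (h.isCompact_discUnionBoundary p hρ).isClosed.isOpen_compl
  have hfc := (h.contMDiffWithinAt_poincareMap hρ hdisj hs hx hfB).continuousWithinAt
  have hgc := (h.contMDiffWithinAt_poincareMapInv hρ hdisj hs hx hgB).continuousWithinAt
  have hev : ∀ᶠ y in 𝓝 x, y ∈ Λ → y ∉ D ∧ poincareMap φ Λ y ∉ D ∧ poincareMapInv φ Λ y ∉ D := by
    filter_upwards [hDo.eventually_mem hxB,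
      eventually_nhdsWithin_iff.1 (hfc.eventually (hDo.eventually_mem hfB)),
      eventually_nhdsWithin_iff.1 (hgc.eventually (hDo.eventually_mem hgB))] with y h1 h2 h3 hy
    exact ⟨h1, h2 hy, h3 hy⟩
  obtain ⟨A, hAW, hxA, ⟨U, hU, hAU⟩, hψ⟩ := h.exists_disc_nhds hE hρ hdisj hx hxB hev
  have hAΛ : A ⊆ Λ := by
    rw [hAU]
    exact inter_subset_right
  let _ : MeasurableSpace M := borel M
  have hleft : ∀ y ∈ A, poincareMapInv φ Λ (poincareMap φ Λ y) = y := fun y hy =>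
    poincareMapInv_flow (hAΛ hy) (hs.roofFunction_pos y) le_rfl
  have hright : ∀ y ∈ A, poincareMap φ Λ (poincareMapInv φ Λ y) = y := by
    intro y hy
    have h1 := poincareMapInv_flow (φ := φ.reverse) (hAΛ hy) (hs.reverse.roofFunction_pos y) le_rfl
    have h2 : φ.reverse.reverse = φ := by ext; simp
    rw [poincareMapInv, h2] at h1
    exact h1
  refine hsing ⟨A, hxA, ⟨U, hU, hAU⟩, fun y hy => ⟨hAΛ hy, (hAW hy (hAΛ hy)).1⟩, hψ,
    ⟨fun y hy => ?_, poincareMapInv φ Λ, ?_, hleft⟩,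
    ⟨fun y hy => ?_, poincareMap φ Λ, ?_, hright⟩⟩
  · exact (h.contMDiffWithinAt_poincareMap hρ hdisj hs (hAΛ hy) (hAW hy (hAΛ hy)).2.1).mono hAΛ
  · rintro _ ⟨y, hy, rfl⟩
    refine (h.contMDiffWithinAt_poincareMapInv hρ hdisj hs (hs.poincareMap_mem y) ?_).mono ?_
    · rw [hleft y hy]
      exact (hAW hy (hAΛ hy)).1
    · rintro _ ⟨z, -, rfl⟩
      exact hs.poincareMap_mem z
  · exact (h.contMDiffWithinAt_poincareMapInv hρ hdisj hs (hAΛ hy) (hAW hy (hAΛ hy)).2.2).mono hAΛ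
  · rintro _ ⟨y, hy, rfl⟩
    refine (h.contMDiffWithinAt_poincareMap hρ hdisj hs (hs.reverse.poincareMap_mem y) ?_).mono ?_
    · rw [← hΛ]
      change poincareMap φ Λ (poincareMapInv φ Λ y) ∉ D
      rw [hright y hy]
      exact (hAW hy (hAΛ hy)).1
    · rintro _ ⟨z, -, rfl⟩
      exact hs.reverse.poincareMap_mem z

end FlowCharts

end Singular

/-! ### Distances to the singular set -/

/-- A sequence with subexponential lower bounds and an upper bound has vanishing exponential growth
rate. -/
theorem tendsto_log_div_atTop {d : ℕ → ℝ≥0∞} {C D : ℝ} (hC : 0 < C) (hD : 0 < D)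
    (hlow : ∀ m : ℕ, ∀ᶠ n : ℕ in atTop, ENNReal.ofReal (C * Real.exp (-n / (m + 1))) ≤ d n)
    (hup : ∀ᶠ n in atTop, d n ≤ ENNReal.ofReal D) :
    Tendsto (fun n : ℕ => ENNReal.log (d n) / (n : EReal)) atTop (𝓝 0) := by
  have hdiv : ∀ a : ℝ, Tendsto (fun n : ℕ => a / (n : ℝ)) atTop (𝓝 0) := fun a =>
    tendsto_const_div_atTop_nhds_zero_nat a
  have hn0 : ∀ n : ℕ, (0 : EReal) ≤ n := fun n => by exact_mod_cast n.zero_le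
  refine tendsto_order.2 ⟨fun a ha => ?_, fun a ha => ?_⟩
  · obtain ⟨a', ha1, ha2⟩ := EReal.lt_iff_exists_real_btwn.1 ha
    have ha2' : a' < 0 := by exact_mod_cast ha2
    obtain ⟨m, hm⟩ := exists_nat_one_div_lt (show 0 < -a' / 2 by linarith)
    filter_upwards [hlow m, (hdiv (Real.log C)).eventually (lt_mem_nhds (show a' / 2 < 0 by linarith)),
      eventually_gt_atTop 0] with n h1 h2 h3
    have hnpos : (0 : ℝ) < n := by exact_mod_cast h3
    refine ha1.trans_le (le_trans ?_
      (EReal.div_le_div_right_of_nonneg (hn0 n) (ENNReal.log_le_log h1)))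
    rw [ENNReal.log_ofReal_of_pos (by positivity), Real.log_mul hC.ne' (Real.exp_pos _).ne',
      Real.log_exp, ← EReal.coe_natCast, ← EReal.coe_div, EReal.coe_le_coe_iff, add_div]
    have h4 : -(n : ℝ) / (m + 1) / n = -(1 / (m + 1)) := by field_simp
    rw [h4]
    linarith
  · obtain ⟨a', ha1, ha2⟩ := EReal.lt_iff_exists_real_btwn.1 ha
    have ha1' : 0 < a' := by exact_mod_cast ha1
    filter_upwards [hup, (hdiv (Real.log D)).eventually (gt_mem_nhds ha1')] with n h1 h2
    refine lt_of_le_of_lt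
      (EReal.div_le_div_right_of_nonneg (hn0 n) (ENNReal.log_le_log h1)) (lt_trans ?_ ha2)
    rw [ENNReal.log_ofReal_of_pos hD, ← EReal.coe_natCast, ← EReal.coe_div]
    exact_mod_cast h2

section Distance

set_option linter.unusedSectionVars false

variable {E : Type*} [NormedAddCommGroup E] [NormedSpace ℝ E] [FiniteDimensional ℝ E]
  {H : Type*} [TopologicalSpace H] {I : ModelWithCorners ℝ E H} [I.Boundaryless]
  {M : Type*} [EMetricSpace M] [ChartedSpace H M] [IsManifold I ∞ M]
  [RiemannianBundle (fun x : M => TangentSpace I x)]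
  [IsContMDiffRiemannianBundle I ∞ E (fun x : M => TangentSpace I x)]
  [IsRiemannianManifold I M]

attribute [local instance] isContinuousRiemannianBundle_of_contMDiff

namespace FlowCharts

variable {X : (x : M) → TangentSpace I x} {φ : Flow ℝ M} {r c C V B δ : ℝ} {N : M → Set M}
  {ξ : M → M → E} {k : ℕ} {p : Fin k → M} {b ρ κ T : ℝ}

/-- The exponential charts are uniformly Lipschitz at small scales near the boundary of a disc. -/
theorem exists_tnorm_sub_le (h : FlowCharts I X φ r c C V B δ N ξ) (q : M) (hρ : ρ < r) :
    ∃ L η : ℝ, 0 < L ∧ 0 < η ∧ ∀ z ∈ transverseDiscBoundary I X q ρ, ∀ (y : M) (e : ℝ), 0 ≤ e →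
      e < η → edist y z ≤ ENNReal.ofReal e →
      y ∈ N q ∧ tnorm I q (ξ q y - ξ q z) ≤ L * e := by
  have hIM : IsManifold I 1 M := IsManifold.of_le (n := ∞) (by simp)
  have hK := h.isCompact_transverseDiscBoundary q hρ
  have hKN : transverseDiscBoundary I X q ρ ⊆ N q := fun z hz =>
    (((h.expChart q).mem_transverseDiscBoundary hρ).1 hz).1
  obtain ⟨C₁, δ₁, hδ₁, hlip⟩ := hK.exists_edist_le_of_locLipAt (f := ξ q) fun z hz =>
    (((h.expChart q).contMDiffAt z (hKN hz)).of_le (by simp)).locLipAt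
  obtain ⟨δ₂, hδ₂, hsub⟩ := hK.exists_thickening_subset_open (h.expChart q).isOpen hKN
  obtain ⟨C₂, hC₂, htn⟩ := exists_tnorm_le_norm (I := I) q
  refine ⟨C₂ * (C₁ + 1), min δ₁ δ₂, by positivity, lt_min (by exact_mod_cast hδ₁) hδ₂,
    fun z hz y e he heη hyz => ⟨hsub ?_, ?_⟩⟩
  · rw [Metric.mem_thickening_iff_exists_edist_lt]
    exact ⟨z, hz, hyz.trans_lt ((ENNReal.ofReal_lt_ofReal_iff hδ₂).2
      (heη.trans_le (min_le_right _ _)))⟩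
  · have h1 : edist z y < δ₁ := by
      rw [edist_comm, ← ENNReal.ofReal_coe_nnreal]
      exact hyz.trans_lt ((ENNReal.ofReal_lt_ofReal_iff (by exact_mod_cast hδ₁)).2
        (heη.trans_le (min_le_left _ _)))
    have h2 := hlip z hz y h1
    have h3 : ‖ξ q y - ξ q z‖ ≤ C₁ * e := by
      rw [← dist_eq_norm, dist_comm, dist_edist]
      refine ENNReal.toReal_le_of_le_ofReal (by positivity) (h2.trans ?_)
      rw [ENNReal.ofReal_mul (by positivity), ENNReal.ofReal_coe_nnreal, edist_comm z y]
      gcongr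
    calc tnorm I q (ξ q y - ξ q z) ≤ C₂ * (C₁ * e) := (htn _).trans (by gcongr)
      _ ≤ C₂ * (C₁ + 1) * e := by nlinarith

/-- An orbit passing close to the boundary of a disc hits a larger disc close to this boundary. -/
theorem exists_hit_near_boundary (h : FlowCharts I X φ r c C V B δ N ξ) (q : M) (hb : b < r)
    (hρb : ρ < b) :
    ∃ A η : ℝ, 0 < A ∧ 0 < η ∧ ∀ z ∈ transverseDiscBoundary I X q ρ, ∀ (y : M) (e : ℝ), 0 ≤ e →
      e < η → edist y z ≤ ENNReal.ofReal e →
      ∃ t : ℝ, |t| ≤ A * e ∧ φ t y ∈ transverseDisc I X q b ∧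
        |tnorm I q (ξ q (φ t y)) - ρ| ≤ A * e := by
  obtain ⟨L, η, hL, hη, hLη⟩ := h.exists_tnorm_sub_le q (hρb.trans hb)
  have hV := h.V_pos
  have hc := h.c_pos
  have hB := h.B_pos
  have hδ := h.δ_pos
  set A₀ : ℝ := L * B / c with hA₀
  have hA₀pos : 0 < A₀ := by positivity
  set A₁ : ℝ := V * A₀ + 1 with hA₁
  have hA₁pos : 0 < A₁ := by positivity
  refine ⟨A₀ + L * A₁, min (δ / A₀) (min (η / A₁) ((b - ρ) / (L * A₁))), by positivity,
    lt_min (by positivity) (lt_min (by positivity) (div_pos (by linarith) (by positivity))),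
    fun z hz y e he heη hyz => ?_⟩
  obtain ⟨hzN, hz0, hzρ⟩ := ((h.expChart q).mem_transverseDiscBoundary (hρb.trans hb)).1 hz
  rw [lt_min_iff, lt_min_iff, lt_div_iff₀ hA₀pos, lt_div_iff₀ hA₁pos, lt_div_iff₀ (by positivity)]
    at heη
  obtain ⟨he1, he2, he3⟩ := heη
  set τ := A₀ * e with hτ
  have hτ0 : 0 ≤ τ := by positivity
  have hin : ∀ t, |t| ≤ τ → φ t y ∈ N q ∧ tnorm I q (ξ q (φ t y) - ξ q z) ≤ L * (A₁ * e) := by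
    intro t ht
    have h1 := edist_triangle_ofReal (by positivity) he (h.edist_flow_le y t (by linarith)) hyz
    refine hLη z hz _ (A₁ * e) (by positivity) (by linarith) (h1.trans ?_)
    refine ENNReal.ofReal_le_ofReal ?_
    have : V * |t| ≤ V * τ := by gcongr
    rw [hA₁]
    nlinarith
  have h0 : |radial I X q (ξ q) (φ 0 y)| ≤ c * τ := by
    rw [Flow.map_zero_apply]
    have h1 : radial I X q (ξ q) y = metricAt I q (ξ q y - ξ q z) (X q) := by
      have : metricAt I q (ξ q y - ξ q z) (X q) =
          metricAt I q (ξ q y) (X q) - metricAt I q (ξ q z) (X q) :=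
        map_sub (metricForm I q (X q)) _ _
      rw [this]
      change _ = _ - radial I X q (ξ q) z
      rw [hz0, sub_zero]
      rfl
    rw [h1]
    refine (abs_metricAt_le q _ _).trans ?_
    calc tnorm I q (ξ q y - ξ q z) * tnorm I q (X q) ≤ (L * e) * B := by
          gcongr
          · exact tnorm_nonneg _ _
          · refine (hLη z hz y e he ?_ hyz).2
            have : e ≤ A₁ * e := by
              rw [hA₁]
              nlinarith [show 0 ≤ V * A₀ * e by positivity]
            linarith
          · exact h.tnorm_le q
      _ = c * τ := by rw [hτ, hA₀]; field_simp
  have habs : ∀ t ∈ Icc (-τ) τ, |t| ≤ τ := fun t ht => abs_le.2 ht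
  have hup := h.isC1Flow.mul_le_radial_sub (h.expChart q) (x := y) hτ0
    (fun t ht => (hin t (habs t ⟨by linarith [ht.1], ht.2⟩)).1)
  have hdown := h.isC1Flow.mul_le_radial_sub (h.expChart q) (x := y) (a := -τ) (b := 0) (by linarith)
    (fun t ht => (hin t (habs t ⟨ht.1, by linarith [ht.2]⟩)).1)
  rw [abs_le] at h0
  have hcont : ContinuousOn (fun t => radial I X q (ξ q) (φ t y)) (Icc (-τ) τ) := fun t ht => by
    obtain ⟨d, -, hd⟩ := h.isC1Flow.exists_hasDerivAt_radial (h.expChart q) (hin t (habs t ht)).1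
    exact hd.continuousAt.continuousWithinAt
  obtain ⟨t, ht, ht0⟩ := intermediate_value_Icc (by linarith) hcont
    (show (0 : ℝ) ∈ Icc _ _ from ⟨by nlinarith, by nlinarith⟩)
  obtain ⟨htN, htL⟩ := hin t (habs t ht)
  have htρ : |tnorm I q (ξ q (φ t y)) - ρ| ≤ L * (A₁ * e) := by
    rw [← hzρ]
    exact (abs_tnorm_sub_le q _ _).trans htL
  refine ⟨t, (habs t ht).trans ?_, ((h.expChart q).mem_transverseDisc hb).2 ⟨htN, ht0, ?_⟩,
    htρ.trans ?_⟩
  · have : 0 ≤ L * A₁ * e := by positivity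
    nlinarith
  · linarith [(abs_le.1 htρ).2]
  · have : 0 ≤ A₀ * e := by positivity
    nlinarith

end FlowCharts

end Distance

section IntrinsicDistance

theorem edist_le_intrinsicEDist {M : Type*} [EMetricSpace M] (Y : Set M) (x y : M) :
    edist x y ≤ intrinsicEDist Y x y := by
  refine le_iInf₂ fun γ _ => ?_
  have h := eVariationOn.edist_le (γ : unitInterval → M) (mem_univ 0) (mem_univ 1)
  rwa [γ.source, γ.target] at h

theorem intrinsicEDist_anti {M : Type*} [EMetricSpace M] {Y Z : Set M} (h : Y ⊆ Z) (x y : M) :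
    intrinsicEDist Z x y ≤ intrinsicEDist Y x y :=
  iInf_mono fun _ => iInf_mono' fun hγ => ⟨fun t => h (hγ t), le_rfl⟩

theorem eVariationOn_unitInterval_le {M : Type*} [EMetricSpace M] {f : ℝ → M} {K : ℝ≥0}
    (hf : LipschitzOnWith K f (Icc 0 1)) :
    eVariationOn (fun t : unitInterval => f t) univ ≤ K := by
  have h1 : eVariationOn (fun t : unitInterval => (t : ℝ)) univ = 1 := by
    have hmono : MonotoneOn (fun t : unitInterval => (t : ℝ)) univ := fun _ _ _ _ hst => hst
    have h2 := hmono.eVariationOn_eq (mem_univ (0 : unitInterval)) (mem_univ (1 : unitInterval))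
    have h3 : univ ∩ Icc (0 : unitInterval) 1 = univ := by
      ext t
      exact iff_of_true ⟨mem_univ t, unitInterval.nonneg', unitInterval.le_one'⟩ (mem_univ t)
    rw [h3] at h2
    simpa using h2
  have h2 := hf.comp_eVariationOn_le (g := fun t : unitInterval => (t : ℝ)) (s := univ)
    (fun t _ => t.2)
  rw [h1, mul_one] at h2
  exact h2

end IntrinsicDistance

section DistanceBounds

set_option linter.unusedSectionVars false

variable {E : Type*} [NormedAddCommGroup E] [NormedSpace ℝ E] [FiniteDimensional ℝ E]
  {H : Type*} [TopologicalSpace H] {I : ModelWithCorners ℝ E H} [I.Boundaryless]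
  {M : Type*} [EMetricSpace M] [ChartedSpace H M] [IsManifold I ∞ M]
  [RiemannianBundle (fun x : M => TangentSpace I x)]
  [IsContMDiffRiemannianBundle I ∞ E (fun x : M => TangentSpace I x)]
  [IsRiemannianManifold I M]

attribute [local instance] isContinuousRiemannianBundle_of_contMDiff

namespace FlowCharts

variable {X : (x : M) → TangentSpace I x} {φ : Flow ℝ M} {r c C V B δ : ℝ} {N : M → Set M}
  {ξ : M → M → E} {k : ℕ} {p : Fin k → M} {b ρ κ T : ℝ}

/-- The exponential map is Lipschitz on closed balls. -/
theorem exists_lipschitzOnWith_expMap (h : FlowCharts I X φ r c C V B δ N ξ) (q : M) (hρ0 : 0 ≤ ρ)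
    (hρ : ρ < r) : ∃ K : ℝ≥0, LipschitzOnWith K (expMap I q) {v : E | tnorm I q v ≤ ρ} := by
  have hIM : IsManifold I 1 M := IsManifold.of_le (n := ∞) (by simp)
  have hlt : ∀ v : E, tnorm I q v ≤ ρ → tnorm I q v < r := fun v hv => hv.trans_lt hρ
  obtain ⟨K, η, hη, hK⟩ := (isCompact_setOf_tnorm_le q ρ).exists_edist_le_of_locLipAt
    (f := expMap I q) fun v hv =>
    (((h.expChart q).contMDiffAt_expMap v (hlt v hv)).of_le (by simp)).locLipAt_of_normedSpace
  have hdist : ∀ v : E, tnorm I q v ≤ ρ → edist (expMap I q v) q ≤ ENNReal.ofReal ρ := by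
    intro v hv
    refine ((h.expChart q).edist_le _ ((h.expChart q).expMap_mem v (hlt v hv))).trans ?_
    rw [(h.expChart q).apply_expMap v (hlt v hv)]
    exact ENNReal.ofReal_le_ofReal hv
  set D : ℝ≥0 := (ρ + ρ).toNNReal with hD
  refine ⟨max K (D / η), fun v hv w hw => ?_⟩
  rcases lt_or_ge (edist v w) η with hlt' | hge
  · refine (hK v hv w hlt').trans ?_
    gcongr
    exact le_max_left _ _
  · have h1 : edist (expMap I q v) (expMap I q w) ≤ D :=
      edist_triangle_ofReal hρ0 hρ0 (hdist v hv) (by rw [edist_comm]; exact hdist w hw)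
    calc edist (expMap I q v) (expMap I q w) ≤ D := h1
      _ = ((D / η : ℝ≥0) : ℝ≥0∞) * η := by
          rw [← ENNReal.coe_mul, div_mul_cancel₀ _ hη.ne']
      _ ≤ _ := by
          gcongr
          exact le_max_right _ _

/-- There are vectors of any length orthogonal to `X`. -/
theorem exists_metricAt_eq_zero_tnorm_eq (X : (x : M) → TangentSpace I x)
    (hE : 2 ≤ Module.finrank ℝ E) (q : M) (hρ0 : 0 < ρ) :
    ∃ v : E, metricAt I q v (X q) = 0 ∧ tnorm I q v = ρ := by
  obtain ⟨w, hw, hw0⟩ : ∃ w : E, metricForm I q (X q) w = 0 ∧ w ≠ 0 := by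
    by_contra! hall
    have hinj : Function.Injective (metricForm I q (X q) : E →ₗ[ℝ] ℝ) :=
      (injective_iff_map_eq_zero _).2 fun w hw => hall w hw
    have := LinearMap.finrank_le_finrank_of_injective hinj
    rw [Module.finrank_self] at this
    omega
  have hpos : 0 < tnorm I q w := (tnorm_nonneg q w).lt_of_ne fun h0 => hw0 (tnorm_eq_zero.1 h0.symm)
  refine ⟨(ρ / tnorm I q w) • w, ?_, ?_⟩
  · change metricForm I q (X q) _ = 0
    rw [map_smul, hw, smul_zero]
  · rw [tnorm_smul, abs_of_pos (by positivity), div_mul_cancel₀ _ hpos.ne']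

/-- The points of a disc can be joined to its boundary by curves of bounded length. -/
theorem exists_intrinsicEDist_le (h : FlowCharts I X φ r c C V B δ N ξ)
    (hE : 2 ≤ Module.finrank ℝ E) (q : M) (hρ0 : 0 < ρ) (hρ : ρ < r) :
    ∃ D : ℝ, ∃ z ∈ transverseDiscBoundary I X q ρ, ∀ y ∈ transverseDisc I X q ρ,
      intrinsicEDist (transverseDisc I X q ρ) y z ≤ ENNReal.ofReal D := by
  obtain ⟨K, hK⟩ := h.exists_lipschitzOnWith_expMap q hρ0.le hρ
  obtain ⟨w, hw, hwρ⟩ := exists_metricAt_eq_zero_tnorm_eq X hE q hρ0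
  obtain ⟨R, hR⟩ := (isCompact_setOf_tnorm_le (I := I) (M := M) q ρ).isBounded.exists_norm_le
  refine ⟨K * (R + R), expMap I q w, ⟨w, hw, hwρ, rfl⟩, ?_⟩
  rintro _ ⟨v', hv, hvρ, rfl⟩
  set v : E := v'
  have hv0 : metricForm I q (X q) v = 0 := hv
  have hw0 : metricForm I q (X q) w = 0 := hw
  have hvρ' : tnorm I q v ≤ ρ := hvρ
  set α : ℝ → E := fun t => v + t • (w - v) with hα
  have hαmem : ∀ t ∈ Icc (0 : ℝ) 1, tnorm I q (α t) ≤ ρ := by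
    intro t ht
    have h1 : α t = (1 - t) • v - (-t) • w := by
      simp only [hα]
      module
    rw [h1]
    refine (tnorm_sub_le _ _ _).trans ?_
    rw [tnorm_smul, tnorm_smul, abs_neg, abs_of_nonneg (sub_nonneg.2 ht.2), abs_of_nonneg ht.1, hwρ]
    nlinarith [ht.1, ht.2]
  have hα0 : ∀ t, metricForm I q (X q) (α t) = 0 := by
    intro t
    simp only [hα, map_add, map_smul, map_sub, hv0, hw0]
    simp
  have hαlip : LipschitzWith ‖w - v‖₊ α := by
    refine LipschitzWith.of_dist_le_mul fun s t => ?_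
    rw [dist_eq_norm, Real.dist_eq, coe_nnnorm]
    have : α s - α t = (s - t) • (w - v) := by
      simp only [hα]
      module
    rw [this, norm_smul, Real.norm_eq_abs, mul_comm]
  have hlip : LipschitzOnWith (K * ‖w - v‖₊) (fun t => expMap I q (α t)) (Icc 0 1) :=
    hK.comp hαlip.lipschitzOnWith hαmem
  let γ : Path (expMap I q v) (expMap I q w) :=
    { toFun := fun t => expMap I q (α t)
      continuous_toFun := hlip.continuousOn.comp_continuous continuous_subtype_val fun t => t.2
      source' := by simp [hα]
      target' := by simp [hα] }
  refine (iInf₂_le γ fun t => ⟨α t, hα0 t, hαmem t t.2, rfl⟩).trans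
    ((eVariationOn_unitInterval_le hlip).trans ?_)
  rw [← ENNReal.ofReal_coe_nnreal]
  refine ENNReal.ofReal_le_ofReal ?_
  push_cast
  gcongr
  exact (norm_sub_le _ _).trans (add_le_add (hR w hwρ.le) (hR v hvρ'))

theorem exists_intrinsicInfEDist_le (h : FlowCharts I X φ r c C V B δ N ξ)
    (hE : 2 ≤ Module.finrank ℝ E) (p : Fin k → M) (hρ0 : 0 < ρ) (hρ : ρ < r) :
    ∃ D : ℝ, 0 < D ∧ ∀ y ∈ discUnion I X p ρ, intrinsicInfEDist (discUnion I X p ρ) y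
      (singularSet I φ (discUnion I X p ρ) (discUnionBoundary I X p ρ)) ≤ ENNReal.ofReal D := by
  choose D z hz hD using fun i => h.exists_intrinsicEDist_le hE (p i) hρ0 hρ
  obtain ⟨D', hD'⟩ := Finite.exists_le D
  refine ⟨max D' 1, by positivity, fun y hy => ?_⟩
  obtain ⟨i, hi⟩ := mem_iUnion.1 hy
  calc _ ≤ intrinsicEDist (discUnion I X p ρ) y (z i) :=
        iInf₂_le (z i) (discUnionBoundary_subset_singularSet (mem_iUnion.2 ⟨i, hz i⟩))
    _ ≤ _ := intrinsicEDist_anti (subset_iUnion _ i) _ _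
    _ ≤ _ := (hD i y hi).trans (ENNReal.ofReal_le_ofReal ((hD' i).trans (le_max_left _ _)))

/-- The orbits for which the radius is good do not meet the boundary of the section. -/
theorem flow_notMem_discUnionBoundary (h : FlowCharts I X φ r c C V B δ N ξ) (hb : b < r)
    (hρb : ρ ≤ b) {x : M} (hx : (x, ρ) ∈ goodRadii I X φ ξ p b) (t : ℝ) :
    φ t x ∉ discUnionBoundary I X p ρ := by
  intro hmem
  obtain ⟨i, hi⟩ := mem_iUnion.1 hmem
  obtain ⟨hN, h0, heq⟩ := ((h.expChart (p i)).mem_transverseDiscBoundary (hρb.trans_lt hb)).1 hi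
  obtain ⟨m, hm⟩ := exists_nat_ge |t|
  obtain ⟨n, hn⟩ := (hx m).exists
  refine hn ⟨t, hm.trans (le_add_of_nonneg_left n.cast_nonneg), i,
    ((h.expChart (p i)).mem_transverseDisc hb).2 ⟨hN, h0, heq.trans_le hρb⟩, ?_⟩
  simp only [heq, sub_self, abs_zero]
  positivity

variable [CompactSpace M]

theorem notMem_singularSet_of_mem_goodRadii (h : FlowCharts I X φ r c C V B δ N ξ)
    (hE : Module.finrank ℝ E = 3) (hb : b < r) (hρb : ρ ≤ b)
    (hdisj : Pairwise fun i j => Disjoint (transverseDisc I X (p i) ρ) (transverseDisc I X (p j) ρ))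
    (hs : IsUniformSection φ (discUnion I X p ρ) κ T) {x : M}
    (hx : (x, ρ) ∈ goodRadii I X φ ξ p b) :
    x ∉ singularSet I φ (discUnion I X p ρ) (discUnionBoundary I X p ρ) := by
  have hall := h.flow_notMem_discUnionBoundary hb hρb hx
  refine h.notMem_singularSet hE (hρb.trans_lt hb) hdisj hs ?_ (hall _) (hall _)
  simpa using hall 0

/-- The orbit of a singular point meets the boundary of the section after a short time. -/
theorem exists_flow_mem_discUnionBoundary (h : FlowCharts I X φ r c C V B δ N ξ)
    (hE : Module.finrank ℝ E = 3) (hρ : ρ < r)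
    (hdisj : Pairwise fun i j => Disjoint (transverseDisc I X (p i) ρ) (transverseDisc I X (p j) ρ))
    (hs : IsUniformSection φ (discUnion I X p ρ) κ T) {x : M}
    (hx : x ∈ singularSet I φ (discUnion I X p ρ) (discUnionBoundary I X p ρ)) :
    ∃ t : ℝ, |t| ≤ T ∧ φ t x ∈ discUnionBoundary I X p ρ := by
  have hR := hs.roofFunction_pos x
  have hRT := (hs.roofFunction_lt x).le
  by_contra! hall
  refine h.notMem_singularSet hE hρ hdisj hs ?_ (hall _ ?_) (hall _ ?_) hx
  · simpa using hall 0 (by simpa using hR.le.trans hRT)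
  · rwa [abs_of_pos hR]
  · rw [abs_neg, abs_of_pos (hs.reverse.roofFunction_pos x)]
    exact (hs.reverse.roofFunction_lt x).le

/-- For good radii the distance to the singular set has subexponential lower bounds along orbits. -/
theorem exists_le_intrinsicInfEDist (h : FlowCharts I X φ r c C V B δ N ξ)
    (hE : Module.finrank ℝ E = 3) (hb : b < r) (hρb : ρ < b)
    (hdisj : Pairwise fun i j => Disjoint (transverseDisc I X (p i) ρ) (transverseDisc I X (p j) ρ))
    (hs : IsUniformSection φ (discUnion I X p ρ) κ T) (hT : T ≤ 1) :
    ∃ K : ℝ, 0 < K ∧ ∀ x, (x, ρ) ∈ goodRadii I X φ ξ p b → ∀ m : ℕ, ∀ᶠ n : ℕ in atTop,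
      ∀ t : ℝ, |t| ≤ n → ENNReal.ofReal (K * Real.exp (-n / (m + 1))) ≤
        intrinsicInfEDist (discUnion I X p ρ) (φ t x)
          (singularSet I φ (discUnion I X p ρ) (discUnionBoundary I X p ρ)) := by
  have hV := h.V_pos
  choose A η hA hη hhit using fun i => h.exists_hit_near_boundary (p i) hb hρb
  obtain ⟨A', hA'⟩ := Finite.exists_le A
  have hA1 : 0 < max A' 1 := by positivity
  refine ⟨1 / (V * max A' 1), by positivity, fun x hx m => ?_⟩
  set K : ℝ := 1 / (V * max A' 1) with hK
  have hKpos : 0 < K := by positivity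
  have htend : ∀ a : ℝ, Tendsto (fun n : ℕ => a * Real.exp (-(n : ℝ) / (m + 1))) atTop (𝓝 0) := by
    intro a
    have h1 : Tendsto (fun n : ℕ => (n : ℝ) / (m + 1)) atTop atTop :=
      tendsto_natCast_atTop_atTop.atTop_div_const (by positivity)
    have h2 := (Real.tendsto_exp_neg_atTop_nhds_zero.comp h1).const_mul a
    simpa [Function.comp_def, neg_div] using h2
  filter_upwards [hx (m + 2), (htend K).eventually (gt_mem_nhds h.δ_pos),
    eventually_all.2 fun i => (htend (V * K)).eventually (gt_mem_nhds (hη i))] with n h1 h2 h3 t ht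
  set e := Real.exp (-(n : ℝ) / (m + 1)) with he
  have he1 : e ≤ 1 := by
    rw [he, Real.exp_le_one_iff, neg_div]
    exact neg_nonpos.2 (by positivity)
  have he0 : 0 < e := Real.exp_pos _
  refine le_iInf₂ fun s hsing => ?_
  by_contra! hlt
  have hdist := ((edist_le_intrinsicEDist _ _ _).trans_lt hlt).le
  obtain ⟨u, hu, hus⟩ := h.exists_flow_mem_discUnionBoundary hE (hρb.trans hb) hdisj hs hsing
  obtain ⟨i, hi⟩ := mem_iUnion.1 hus
  have hdist' := h.edist_flow_flow_le _ _ u _ (hu.trans hT) h2 hdist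
  rw [← mul_assoc] at hdist'
  obtain ⟨v, hv, hvb, hvρ⟩ := hhit i _ hi _ (V * K * e) (by positivity) (h3 i) hdist'
  have hAe : A i * (V * K * e) ≤ e := by
    have h4 : V * K = 1 / max A' 1 := by
      rw [hK]
      field_simp
    have h5 : A i ≤ max A' 1 := (hA' i).trans (le_max_left _ _)
    rw [h4]
    calc A i * (1 / max A' 1 * e) ≤ max A' 1 * (1 / max A' 1 * e) := by gcongr
      _ = e := by field_simp
  simp only [← Flow.map_add] at hvb hvρ
  refine h1 ⟨v + (u + t), ?_, i, hvb, ?_⟩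
  · refine (abs_add_le _ _).trans ?_
    have := abs_add_le u t
    push_cast
    linarith [hv.trans hAe, (Nat.cast_nonneg m : (0 : ℝ) ≤ m)]
  · refine hvρ.trans (hAe.trans ?_)
    rw [he, Real.exp_le_exp, neg_div, neg_div, neg_le_neg_iff]
    push_cast
    gcongr
    linarith

end FlowCharts

end DistanceBounds

end

/-- Every flow invariant probability measure has adapted standard Poincaré sections with arbitrarily
small roof functions. -/
theorem mainTheorem7
    {M : Type*} [EMetricSpace M] [CompactSpace M]
    [ChartedSpace (EuclideanSpace ℝ (Fin 3)) M] [IsManifold (𝓡 3) ∞ M]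
    [RiemannianBundle (fun x : M => TangentSpace (𝓡 3) x)]
    [IsContMDiffRiemannianBundle (𝓡 3) ∞ (EuclideanSpace ℝ (Fin 3))
      (fun x : M => TangentSpace (𝓡 3) x)]
    [IsRiemannianManifold (𝓡 3) M]
    [MeasurableSpace M] [BorelSpace M]
    (β : ℝ≥0) (hβ₀ : 0 < β) (hβ₁ : β < 1)
    (X : (x : M) → TangentSpace (𝓡 3) x)
    (hX : IsC1HolderVectorField (𝓡 3) β X) (hX₀ : ∀ p, X p ≠ 0)
    (φ : Flow ℝ M) (hφ : ∀ p, IsMIntegralCurve (fun t => φ t p) X)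
    (μ : Measure M) [IsProbabilityMeasure μ] (hμ : ∀ t, MeasurePreserving (φ t) μ μ)
    (𝔯 : ℝ) (h𝔯 : 0 < 𝔯) (h₀ : ℝ) (hh₀ : 0 < h₀) :
    ∃ (N : ℕ) (p : Fin N → M) (r : ℝ),
      IsStandardPoincareSection (𝓡 3) φ X 𝔯 p r ∧
      RoofSupLT φ (discUnion (𝓡 3) X p r) h₀ ∧
      IsAdapted (𝓡 3) φ μ (discUnion (𝓡 3) X p r) (discUnionBoundary (𝓡 3) X p r) := by
  have hflow : IsC1Flow (𝓡 3) X φ := ⟨fun x₀ => (hX x₀).1, hφ⟩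
  obtain ⟨r, c, C, V, B, δ, N, ξ, h⟩ := hflow.exists_flowCharts hX₀
  have hE : Module.finrank ℝ (EuclideanSpace ℝ (Fin 3)) = 3 := finrank_euclideanSpace_fin
  obtain ⟨k, p, b, hb, hb₀, hbr, hdisj, hhit⟩ := h.exists_centers
    (T₀ := min 1 (min h₀ 𝔯) / 2) (b₀ := min c 𝔯) (by positivity) (lt_min h.c_pos h𝔯)
  set T := min 1 (min h₀ 𝔯) / 2 with hT
  have hm : 0 < min 1 (min h₀ 𝔯) := by positivity
  have hT1 : T ≤ 1 := by linarith [min_le_left 1 (min h₀ 𝔯)]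
  have hTh : T < h₀ := by linarith [(min_le_right 1 (min h₀ 𝔯)).trans (min_le_left _ _)]
  have hTr : T < 𝔯 := by linarith [(min_le_right 1 (min h₀ 𝔯)).trans (min_le_right _ _)]
  obtain ⟨κ, hκ⟩ := h.exists_isUniformSection hb hbr (hb₀.trans_le (min_le_left _ _)) hdisj hhit
  obtain ⟨ρ, hρ, hmeas, hae⟩ := h.exists_goodRadius (μ := μ) hb hbr
    (hκ b ⟨by linarith, le_rfl⟩)
  have hρ0 : 0 < ρ := (half_pos hb).trans hρ.1
  have hρr : ρ < r := hρ.2.trans hbr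
  have hs := hκ ρ ⟨hρ.1.le, hρ.2.le⟩
  have hdisj' : Pairwise fun i j =>
      Disjoint (transverseDisc (𝓡 3) X (p i) ρ) (transverseDisc (𝓡 3) X (p j) ρ) := fun i j hij =>
    (hdisj hij).mono (transverseDisc_mono hρ.2.le) (transverseDisc_mono hρ.2.le)
  have hcpt := h.isCompact_discUnion p hρr
  have : SecondCountableTopology M := EMetric.secondCountable_of_sigmaCompact M
  have hne : (discUnion (𝓡 3) X p ρ).Nonempty := by
    have : Nonempty M := nonempty_of_isProbabilityMeasure μ
    exact ⟨_, hs.poincareMap_mem (Classical.arbitrary M)⟩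
  have hgood := hs.ae_inducedMeasure hcpt hmeas hae fun x hx t ht htT =>
    goodRadii_flow hx (by rw [abs_neg, abs_of_nonneg ht]; exact htT.trans hT1)
  obtain ⟨D, hD, hup⟩ := h.exists_intrinsicInfEDist_le (by omega) p hρ0 hρr
  obtain ⟨K, hK, hlow⟩ := h.exists_le_intrinsicInfEDist hE hbr hρ.2 hdisj' hs hT1
  have htime : ∀ (n : ℕ) (t : ℝ), 0 ≤ t → t ≤ n * T → |t| ≤ n := fun n t ht htn => by
    rw [abs_of_nonneg ht]
    exact htn.trans (mul_le_of_le_one_right n.cast_nonneg hT1)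
  refine ⟨k, p, ρ, ⟨hρ0, hρ.2.trans (hb₀.trans_le (min_le_right _ _)), fun i =>
    (h.expChart (p i)).isEmbeddedTransverseDisc hρr h.c_pos, hdisj',
    hs.isPoincareSection hcpt.measurableSet, hs.roofSupLT hTr⟩, hs.roofSupLT hTh,
    ⟨hs.isProbabilityMeasure_inducedMeasure hμ hcpt hne, ?_, ?_, ?_⟩⟩
  · exact measure_eq_zero_iff_ae_notMem.2 (hgood.mono fun x hx =>
      h.notMem_singularSet_of_mem_goodRadii hE hbr hρ.2.le hdisj' hs hx)
  · refine hgood.mono fun x hx => tendsto_log_div_atTop hK hD (fun m => ?_) ?_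
    · filter_upwards [hlow x hx m] with n hn
      obtain ⟨t, ht0, htn, ht⟩ := hs.exists_iterate_poincareMap x n
      rw [ht]
      exact hn t (htime n t ht0 htn)
    · filter_upwards [eventually_ge_atTop 1] with n hn
      exact hup _ (hs.iterate_poincareMap_mem x hn)
  · refine hgood.mono fun x hx => tendsto_log_div_atTop hK hD (fun m => ?_) ?_
    · filter_upwards [hlow x hx m] with n hn
      obtain ⟨t, ht0, htn, ht⟩ := hs.reverse.exists_iterate_poincareMap x n
      rw [poincareMapInv, ht]
      exact hn (-t) (by rw [abs_neg]; exact htime n t ht0 htn)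
    · filter_upwards [eventually_ge_atTop 1] with n hn
      exact hup _ (hs.reverse.iterate_poincareMap_mem x hn)
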